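/- All graphs are finite and simple. For a graph $G=(V,E)$, let $\mathrm{SSP}(G)\subseteq\mathbb{R}^V$ be the convex hull of the incidence vectors of the stable (pairwise non-adjacent) subsets of $V$, and let $\mathrm{TSTAB}(G)$ be the set of all $x\in\mathbb{R}^V$ such that $0\le x_v\le 1$ for every vertex $v$, $x_u+x_v\le 1$ for every edge $uv$, and $\sum_{v\in V(C)}x_v\le\frac{|V(C)|-1}{2}$ for every odd cycle $C$ of $G$ (not necessarily induced). The graph $G$ is called t-perfect if $\mathrm{SSP}(G)=\mathrm{TSTAB}(G)$. Theorem. Every triangle-free t-perfect graph is $199052$-colourable, that is, its vertex set is a union of $199052$ stable sets. -/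

import Mathlib

namespace SimpleGraph

variable {V : Type*}

/-- The stable set polytope of `G`: the convex hull in `ℝ^V` of the incidence vectors of the
stable (independent) sets of `G`. -/
def stableSetPolytope (G : SimpleGraph V) : Set (V → ℝ) :=
  convexHull ℝ {x | ∃ S : Set V, G.IsIndepSet S ∧ x = S.indicator 1}

open Classical in
/-- The polytope `TSTAB(G)`: all `x ∈ ℝ^V` with `0 ≤ x_v ≤ 1` for every vertex `v`, satisfying the
edge inequalities and the odd cycle inequalities. Cycles are cycles of `G` as a subgraph, not
necessarily induced; a cycle `c` has `c.length` distinct vertices, and they form the finset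
`c.support.toFinset`. The bound `x_v ≤ 1` follows from the other inequalities unless `v` is an
isolated vertex. -/
def tstab (G : SimpleGraph V) : Set (V → ℝ) :=
  {x | (∀ v, 0 ≤ x v ∧ x v ≤ 1) ∧
    (∀ u v, G.Adj u v → x u + x v ≤ 1) ∧
    (∀ (u : V) (c : G.Walk u u), c.IsCycle → Odd c.length →
      ∑ v ∈ c.support.toFinset, x v ≤ ((c.length : ℝ) - 1) / 2)}

/-- A (finite) graph is t-perfect if its stable set polytope is `TSTAB(G)`. -/
def IsTPerfect (G : SimpleGraph V) : Prop :=
  G.stableSetPolytope = G.tstab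

end SimpleGraph

/-! The strategy is to forbid a generalised odd wheel in t-perfect graphs, and to build one inside
any triangle-free graph whose chromatic number is too large.

The obstruction. The rim is an odd induced cycle; the hub is a connected bipartite set with sides
`Up` and `Um` (`IsHub`). `Um` does not touch the rim, and `Up` is attached to three rim vertices
that cut the rim into arcs of odd length. A t-perfect graph contains no such configuration
(`IsTPerfect.rim_false`, `IsTPerfect.wheel_false`): a vector with entries 0, 1/3, 2/3 lies in
`tstab`, yet violates an inequality that holds for every stable set meeting all edges that are tight
for this vector. With a star as hub it follows that second neighbourhoods of vertices are
2-colourable, so that small neighbourhoods can always be deleted at bounded cost.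

Control of parity. A wheel needs arcs of prescribed parity. A connected set of large chromatic
number, entered from a vertex `q`, contains a vertex `u` reached from `q` by induced paths of both
parities, with a connected set of still large chromatic number behind `u` (`exists_parity_gadget`).
Chaining gadgets yields a rope whose segments have independently adjustable parities
(`exists_rope`).

The construction. Pass twice to a breadth-first level of large chromatic number. Inside the inner
level run a rope with six gadgets, starting at `r0` and ending at a set `K`. It closes to an induced
cycle through `K` to some `e`, from a parent of `e` down the inner levelling, and back up to a
vertex `d0` that sees only `r0` on the rope. The parent of `e` must miss the rope; such an `e`
exists since vertices of `K` with a parent seeing a given route need few colours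
(`IsLevelling.colOn_of_path`). The cycle lies in a single level of the outer levelling, so a hub can
be sought below it: six joints of the rope have parents and grandparents that do not interfere, and
some connected bipartite set below contains three of the grandparents on one side
(`ConnSet.exists_isHub_of_six`). Suitable parities of the segments turn cycle and hub into a
forbidden wheel (`IsTPerfect.rope_false`).

The bound for `IsLevelling.colOn_of_path` is the second main argument. Every `v` in `K` has a parent
`d v` that sees the path first at index `lam v`; a detour leads from `d v` through the lower levels
to `d0`. If no detour closes an odd cycle, comparing the detours of adjacent vertices forces a wheel
around a star (`Comb.colOn_not_oddDetour`). If there are odd detours, fix one; almost every other `d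
v` sees the path between two attachments at odd distance and hence offers a parity-changing
shortcut. Two shortcuts make the rim flexible, and a leg from a third `d v` down to the detour is
the hub (`Comb.leg_false`). -/

namespace SimpleGraph

variable {V : Type*} {G : SimpleGraph V}

/-! ### Colourings of vertex sets -/

/-- The vertex set `A` is `k`-colourable in `G`. -/
def ColOn (G : SimpleGraph V) (k : ℕ) (A : Set V) : Prop :=
  ∃ c : V → ℕ, (∀ v ∈ A, c v < k) ∧ ∀ u ∈ A, ∀ v ∈ A, G.Adj u v → c u ≠ c v

theorem ColOn.mono {k l : ℕ} {A B : Set V} (h : G.ColOn k B) (hkl : k ≤ l) (hAB : A ⊆ B) :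
    G.ColOn l A := by
  obtain ⟨c, h1, h2⟩ := h
  exact ⟨c, fun v hv => (h1 v (hAB hv)).trans_le hkl,
    fun u hu v hv => h2 u (hAB hu) v (hAB hv)⟩

theorem ColOn.subset {k : ℕ} {A B : Set V} (h : G.ColOn k B) (hAB : A ⊆ B) : G.ColOn k A :=
  h.mono le_rfl hAB

theorem ColOn.union {k l : ℕ} {A B : Set V} (hA : G.ColOn k A) (hB : G.ColOn l B) :
    G.ColOn (k + l) (A ∪ B) := by
  classical
  obtain ⟨c, h1, h2⟩ := hA
  obtain ⟨d, h3, h4⟩ := hB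
  refine ⟨fun v => if v ∈ A then c v else k + d v, ?_, ?_⟩
  · rintro v hv
    by_cases hvA : v ∈ A
    · simp only [hvA, if_true]; have := h1 v hvA; omega
    · have := h3 v (hv.resolve_left hvA)
      simp only [hvA, if_false]; omega
  · intro u hu v hv huv
    by_cases huA : u ∈ A <;> by_cases hvA : v ∈ A <;> simp only [huA, hvA, if_true, if_false]
    · exact h2 u huA v hvA huv
    · have := h1 u huA; omega
    · have := h1 v hvA; omega
    · have := h4 u (hu.resolve_left huA) v (hv.resolve_left hvA) huv; omega

theorem ColOn.of_diff {k l : ℕ} {A B : Set V} (hA : G.ColOn k (A \ B)) (hB : G.ColOn l B) :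
    G.ColOn (k + l) A :=
  (hA.union hB).subset fun v hv => by
    by_cases h : v ∈ B
    · exact Or.inr h
    · exact Or.inl ⟨hv, h⟩

theorem colOn_empty (k : ℕ) : G.ColOn k ∅ :=
  ⟨fun _ => 0, by simp, by simp⟩

theorem colOn_one {A : Set V} (h : ∀ u ∈ A, ∀ v ∈ A, ¬ G.Adj u v) : G.ColOn 1 A :=
  ⟨fun _ => 0, by simp, fun u hu v hv huv => (h u hu v hv huv).elim⟩

theorem exists_mem_of_not_colOn {k : ℕ} {A : Set V} (h : ¬ G.ColOn k A) : ∃ a, a ∈ A := by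
  by_contra hA
  push Not at hA
  exact h ((colOn_empty k).subset fun v hv => (hA v hv).elim)

theorem ColOn.colorable {k : ℕ} (h : G.ColOn k Set.univ) : G.Colorable k := by
  obtain ⟨c, h1, h2⟩ := h
  exact ⟨Coloring.mk (fun v => (⟨c v, h1 v trivial⟩ : Fin k))
    fun {u v} huv hc => h2 u trivial v trivial huv (by simpa using hc)⟩

/-- If adjacent vertices of `A` lie on equal or consecutive levels, and every level is
`k`-colourable, then `A` is `2 * k`-colourable. -/
theorem ColOn.of_levels {k : ℕ} {A : Set V} (l : V → ℕ)
    (hl : ∀ u ∈ A, ∀ v ∈ A, G.Adj u v → l u ≤ l v + 1)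
    (h : ∀ j, G.ColOn k {v ∈ A | l v = j}) : G.ColOn (2 * k) A := by
  choose c h1 h2 using h
  refine ⟨fun v => if Even (l v) then c (l v) v else k + c (l v) v, ?_, ?_⟩
  · intro v hv
    have := h1 (l v) v ⟨hv, rfl⟩
    dsimp only
    split_ifs <;> omega
  · intro u hu v hv huv
    have h3 := h1 (l v) v ⟨hv, rfl⟩
    have h4 := h1 (l u) u ⟨hu, rfl⟩
    have h5 := hl u hu v hv huv
    have h6 := hl v hv u hu huv.symm
    by_cases he : l u = l v
    · have h7 := h2 (l u) u ⟨hu, rfl⟩ v ⟨hv, he.symm⟩ huv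
      dsimp only
      rw [← he]
      split_ifs <;> omega
    · have : l u = l v + 1 ∨ l v = l u + 1 := by omega
      have h7 : Even (l u) ↔ ¬ Even (l v) := by
        rcases this with h | h <;> rw [h, Nat.even_add_one]
        tauto
      dsimp only
      split_ifs <;> first | omega | tauto

theorem ColOn.of_two {A : Set V} (h : G.ColOn 2 A) : ∃ A₁ A₂ : Set V, A = A₁ ∪ A₂ ∧
    (∀ u ∈ A₁, ∀ v ∈ A₁, ¬ G.Adj u v) ∧ (∀ u ∈ A₂, ∀ v ∈ A₂, ¬ G.Adj u v) ∧ Disjoint A₁ A₂ := by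
  obtain ⟨c, h1, h2⟩ := h
  refine ⟨{v ∈ A | c v = 0}, {v ∈ A | c v = 1}, ?_, ?_, ?_, ?_⟩
  · ext v
    simp only [Set.mem_union, Set.mem_ofPred_eq]
    constructor
    · intro hv
      have := h1 v hv
      have : c v = 0 ∨ c v = 1 := by omega
      tauto
    · tauto
  · rintro u ⟨hu, hu'⟩ v ⟨hv, hv'⟩ huv
    exact h2 u hu v hv huv (by omega)
  · rintro u ⟨hu, hu'⟩ v ⟨hv, hv'⟩ huv
    exact h2 u hu v hv huv (by omega)
  · rw [Set.disjoint_left]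
    rintro u ⟨_, hu⟩ ⟨_, hu'⟩
    omega

/-! ### Connected vertex sets -/

/-- The vertices `x` and `y` are joined by a walk inside `A` (or equal). -/
def ConnIn (G : SimpleGraph V) (A : Set V) (x y : V) : Prop :=
  Relation.ReflTransGen (fun x y => G.Adj x y ∧ x ∈ A ∧ y ∈ A) x y

/-- Any two vertices of `A` are joined by a walk inside `A`. -/
def ConnSet (G : SimpleGraph V) (A : Set V) : Prop :=
  ∀ x ∈ A, ∀ y ∈ A, G.ConnIn A x y

theorem ConnIn.refl {A : Set V} (x : V) : G.ConnIn A x x := Relation.ReflTransGen.refl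

theorem ConnIn.trans {A : Set V} {x y z : V} (h : G.ConnIn A x y) (h' : G.ConnIn A y z) :
    G.ConnIn A x z := Relation.ReflTransGen.trans h h'

theorem ConnIn.single {A : Set V} {x y : V} (h : G.Adj x y) (hx : x ∈ A) (hy : y ∈ A) :
    G.ConnIn A x y := Relation.ReflTransGen.single ⟨h, hx, hy⟩

theorem ConnIn.symm {A : Set V} {x y : V} (h : G.ConnIn A x y) : G.ConnIn A y x := by
  induction h with
  | refl => exact ConnIn.refl _
  | tail _ h ih => exact (ConnIn.single h.1.symm h.2.2 h.2.1).trans ih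

theorem ConnIn.mono {A B : Set V} {x y : V} (h : G.ConnIn A x y) (hAB : A ⊆ B) :
    G.ConnIn B x y := by
  induction h with
  | refl => exact ConnIn.refl _
  | tail _ h ih => exact ih.trans (ConnIn.single h.1 (hAB h.2.1) (hAB h.2.2))

theorem ConnIn.mem {A : Set V} {x y : V} (h : G.ConnIn A x y) (hx : x ∈ A) : y ∈ A := by
  induction h with
  | refl => exact hx
  | tail _ h _ => exact h.2.2

/-- A set closed under taking neighbours inside `A` is closed under walks inside `A`. -/
theorem ConnIn.mem_of_closed {A B : Set V} {x y : V} (h : G.ConnIn A x y) (hx : x ∈ B)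
    (hB : ∀ u ∈ B, ∀ v ∈ A, G.Adj u v → v ∈ B) : y ∈ B := by
  induction h with
  | refl => exact hx
  | tail _ h ih => exact hB _ ih _ h.2.2 h.1

theorem ConnSet.of_root {A : Set V} (r : V) (h : ∀ x ∈ A, G.ConnIn A r x) : G.ConnSet A :=
  fun x hx y hy => (h x hx).symm.trans (h y hy)

theorem connSet_singleton (x : V) : G.ConnSet {x} := by
  rintro a rfl b rfl; exact ConnIn.refl _

theorem ConnSet.union_of_adj {A B : Set V} (hA : G.ConnSet A)
    (h : ∀ b ∈ B, ∃ a ∈ A, G.Adj a b) : G.ConnSet (A ∪ B) := by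
  intro x hx y hy
  have key : ∀ x ∈ A ∪ B, ∃ a ∈ A, G.ConnIn (A ∪ B) x a := by
    rintro x (hx | hx)
    · exact ⟨x, hx, ConnIn.refl _⟩
    · obtain ⟨a, ha, hax⟩ := h x hx
      exact ⟨a, ha, ConnIn.single hax.symm (Or.inr hx) (Or.inl ha)⟩
  obtain ⟨a, ha, h1⟩ := key x hx
  obtain ⟨b, hb, h2⟩ := key y hy
  exact (h1.trans ((hA a ha b hb).mono Set.subset_union_left)).trans h2.symm

theorem ConnSet.insert {A : Set V} (hA : G.ConnSet A) {x a : V} (ha : a ∈ A)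
    (h : G.Adj a x) : G.ConnSet (insert x A) := by
  have := hA.union_of_adj (B := {x}) (by rintro b rfl; exact ⟨a, ha, h⟩)
  rwa [Set.union_comm, Set.singleton_union] at this

theorem ConnSet.union_of_edge {A B : Set V} (hA : G.ConnSet A) (hB : G.ConnSet B) {a b : V}
    (ha : a ∈ A) (hb : b ∈ B) (h : G.Adj a b) : G.ConnSet (A ∪ B) := by
  refine ConnSet.of_root a ?_
  rintro x (hx | hx)
  · exact (hA a ha x hx).mono Set.subset_union_left
  · exact (ConnIn.single h (Or.inl ha) (Or.inr hb)).trans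
      ((hB b hb x hx).mono Set.subset_union_right)

/-- The connected component of `a` inside `A`. -/
def compIn (G : SimpleGraph V) (A : Set V) (a : V) : Set V := {y | y ∈ A ∧ G.ConnIn A a y}

theorem compIn_subset (A : Set V) (a : V) : G.compIn A a ⊆ A := fun _ h => h.1

theorem mem_compIn_of_adj {A : Set V} {a x y : V} (hx : x ∈ G.compIn A a) (hy : y ∈ A)
    (h : G.Adj x y) : y ∈ G.compIn A a :=
  ⟨hy, hx.2.trans (ConnIn.single h hx.1 hy)⟩

theorem connSet_compIn (A : Set V) (a : V) : G.ConnSet (G.compIn A a) := by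
  refine ConnSet.of_root a ?_
  rintro x ⟨hxA, hx⟩
  clear hxA
  induction hx with
  | refl => exact ConnIn.refl _
  | tail h1 h2 ih => exact ih.trans (ConnIn.single h2.1 ⟨h2.2.1, h1⟩
      ⟨h2.2.2, h1.trans (ConnIn.single h2.1 h2.2.1 h2.2.2)⟩)

/-- Different components can share the same colours, so some component already needs as many as `A`.
-/
theorem exists_component_of_not_colOn {k : ℕ} {A : Set V} (h : ¬ G.ColOn k A) :
    ∃ C ⊆ A, G.ConnSet C ∧ ¬ G.ColOn k C ∧ ∀ x ∈ C, ∀ y ∈ A, G.Adj x y → y ∈ C := by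
  by_contra hc
  push Not at hc
  have h0 : ∀ a ∈ A, G.ColOn k (G.compIn A a) := by
    intro a ha
    by_contra h1
    obtain ⟨x, hx, y, hy, hxy, hn⟩ := hc _ (compIn_subset A a) (connSet_compIn A a) h1
    exact hn (mem_compIn_of_adj hx hy hxy)
  have h1 : ∀ a, ∃ c : V → ℕ, a ∈ A → (∀ v ∈ G.compIn A a, c v < k) ∧
      ∀ u ∈ G.compIn A a, ∀ v ∈ G.compIn A a, G.Adj u v → c u ≠ c v := by
    intro a
    by_cases ha : a ∈ A
    · obtain ⟨c, hc⟩ := h0 a ha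
      exact ⟨c, fun _ => hc⟩
    · exact ⟨fun _ => 0, fun h => (ha h).elim⟩
  choose f hf using h1
  -- One representative per component selects one colouring for the whole component, so adjacent
  -- vertices are coloured consistently.
  let s : Setoid V := ⟨G.ConnIn A, fun x => ConnIn.refl x, fun h => h.symm, fun h h' => h.trans h'⟩
  have hrep : ∀ v, G.ConnIn A (Quotient.out (Quotient.mk s v)) v := fun v =>
    Quotient.exact (Quotient.out_eq (Quotient.mk s v))
  refine h ⟨fun v => f (Quotient.out (Quotient.mk s v)) v, fun v hv => ?_, fun u hu v hv huv => ?_⟩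
  · exact (hf _ ((hrep v).symm.mem hv)).1 v ⟨hv, hrep v⟩
  · have he : Quotient.mk s u = Quotient.mk s v := Quotient.sound (ConnIn.single huv hu hv)
    have h3 := hrep u
    dsimp only
    rw [he] at h3 ⊢
    exact (hf _ ((hrep v).symm.mem hv)).2 u ⟨hu, h3⟩ v ⟨hv, hrep v⟩ huv

/-! ### Neighbourhoods of vertex sets -/

/-- The set of vertices with a neighbour in `A`. -/
def nbrs (G : SimpleGraph V) (A : Set V) : Set V := {v | ∃ a ∈ A, G.Adj a v}

theorem nbrs_mono {A B : Set V} (h : A ⊆ B) : G.nbrs A ⊆ G.nbrs B :=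
  fun _ ⟨a, ha, hv⟩ => ⟨a, h ha, hv⟩

theorem mem_nbrs_singleton {x v : V} : v ∈ G.nbrs {x} ↔ G.Adj x v := by simp [nbrs]

theorem CliqueFree.not_adj (h : G.CliqueFree 3) {a b c : V} (hab : G.Adj a b)
    (hac : G.Adj a c) : ¬ G.Adj b c := by
  classical
  intro hbc
  exact h {a, b, c} (is3Clique_triple_iff.2 ⟨hab, hac, hbc⟩)

theorem stable_nbrs_singleton (h : G.CliqueFree 3) (x : V) :
    ∀ u ∈ G.nbrs {x}, ∀ v ∈ G.nbrs {x}, ¬ G.Adj u v := fun _ hu _ hv =>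
  h.not_adj (mem_nbrs_singleton.1 hu) (mem_nbrs_singleton.1 hv)

theorem colOn_nbrs_singleton (h : G.CliqueFree 3) (x : V) : G.ColOn 1 (G.nbrs {x}) :=
  colOn_one (stable_nbrs_singleton h x)

/-! ### Induced paths as lists of vertices -/

/-- The list `l` is the vertex sequence of an induced path of `G`. -/
def IsIndPath (G : SimpleGraph V) : List V → Prop
  | [] => True
  | a :: l => a ∉ l ∧ (∀ b ∈ l, G.Adj a b ↔ l.head? = some b) ∧ IsIndPath G l

@[simp] theorem isIndPath_nil : G.IsIndPath [] := trivial

theorem isIndPath_cons {a : V} {l : List V} : G.IsIndPath (a :: l) ↔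
    a ∉ l ∧ (∀ b ∈ l, G.Adj a b ↔ l.head? = some b) ∧ G.IsIndPath l := Iff.rfl

@[simp] theorem isIndPath_singleton (a : V) : G.IsIndPath [a] := by simp [isIndPath_cons]

theorem IsIndPath.nodup {l : List V} (h : G.IsIndPath l) : l.Nodup := by
  induction l with
  | nil => simp
  | cons a l ih => exact List.nodup_cons.2 ⟨h.1, ih h.2.2⟩

theorem isIndPath_append {l₁ l₂ : List V} : G.IsIndPath (l₁ ++ l₂) ↔
    G.IsIndPath l₁ ∧ G.IsIndPath l₂ ∧ ∀ x ∈ l₁, ∀ y ∈ l₂, x ≠ y ∧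
      (G.Adj x y ↔ l₁.getLast? = some x ∧ l₂.head? = some y) := by
  induction l₁ with
  | nil => simp
  | cons a l ih =>
    rw [List.cons_append, isIndPath_cons, ih, isIndPath_cons]
    rcases l with _ | ⟨b, l⟩
    · simp only [List.nil_append, isIndPath_nil, List.not_mem_nil, List.mem_singleton,
        List.getLast?_singleton]
      constructor
      · rintro ⟨h1, h2, -, h3, -⟩
        refine ⟨by simp, h3, ?_⟩
        rintro x rfl y hy
        exact ⟨by rintro rfl; exact h1 hy, by simp [h2 y hy]⟩
      · rintro ⟨-, h2, h3⟩
        refine ⟨fun h => (h3 a rfl a h).1 rfl, fun y hy => ?_, by simp, h2, by simp⟩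
        simpa using (h3 a rfl y hy).2
    · have hlast : (a :: b :: l).getLast? = (b :: l).getLast? := by simp [List.getLast?_cons]
      rw [hlast]
      simp only [List.cons_append, List.head?_cons]
      constructor
      · rintro ⟨h1, h2, h3, h4, h5⟩
        refine ⟨⟨fun h => h1 (by simp at h ⊢; tauto), fun y hy => h2 y (by simp at hy ⊢; tauto),
          h3⟩, h4, ?_⟩
        intro x hx y hy
        rcases List.mem_cons.1 hx with rfl | hx
        · have hxy : x ≠ y := by rintro rfl; exact h1 (by simp [hy])
          refine ⟨hxy, ?_⟩
          rw [h2 y (by simp [hy])]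
          constructor
          · intro h
            exact ((h5 b (by simp) y hy).1 (by simpa using h)).elim
          · rintro ⟨h, -⟩
            exact (h1 (by
              have := List.mem_of_getLast? h
              simp at this ⊢; tauto)).elim
        · exact h5 x hx y hy
      · rintro ⟨⟨h1, h2, h3⟩, h4, h5⟩
        refine ⟨?_, ?_, h3, h4, fun x hx y hy => h5 x (List.mem_cons_of_mem _ hx) y hy⟩
        · intro h
          rcases List.mem_append.1 (show a ∈ (b :: l) ++ l₂ from h) with h | h
          · exact h1 h
          · exact (h5 a (by simp) a h).1 rfl
        · intro y hy
          rcases List.mem_append.1 (show y ∈ (b :: l) ++ l₂ from hy) with h | h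
          · exact h2 y h
          · rw [(h5 a (by simp) y h).2]
            constructor
            · rintro ⟨h', -⟩
              exact (h1 (List.mem_of_getLast? h')).elim
            · intro h'
              exact ((h5 b (by simp) y h).1 (by simpa using h')).elim

theorem IsIndPath.append {l₁ l₂ : List V} (h₁ : G.IsIndPath l₁) (h₂ : G.IsIndPath l₂)
    (h : ∀ x ∈ l₁, ∀ y ∈ l₂, x ≠ y ∧ (G.Adj x y ↔ l₁.getLast? = some x ∧ l₂.head? = some y)) :
    G.IsIndPath (l₁ ++ l₂) := isIndPath_append.2 ⟨h₁, h₂, h⟩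

theorem IsIndPath.left {l₁ l₂ : List V} (h : G.IsIndPath (l₁ ++ l₂)) : G.IsIndPath l₁ :=
  (isIndPath_append.1 h).1

theorem IsIndPath.right {l₁ l₂ : List V} (h : G.IsIndPath (l₁ ++ l₂)) : G.IsIndPath l₂ :=
  (isIndPath_append.1 h).2.1

/-- Any list with an entry satisfying `p` splits at the last such entry. -/
theorem exists_split_last {l : List V} {p : V → Prop} (h : ∃ x ∈ l, p x) :
    ∃ l₁ b l₂, l = l₁ ++ b :: l₂ ∧ p b ∧ ∀ c ∈ l₂, ¬ p c := by
  induction l with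
  | nil => simp at h
  | cons a l ih =>
    by_cases h' : ∃ x ∈ l, p x
    · obtain ⟨l₁, b, l₂, rfl, hb, hc⟩ := ih h'
      exact ⟨a :: l₁, b, l₂, rfl, hb, hc⟩
    · push Not at h'
      obtain ⟨x, hx, hpx⟩ := h
      rcases List.mem_cons.1 hx with rfl | hx
      · exact ⟨[], x, l, rfl, hpx, h'⟩
      · exact (h' x hx hpx).elim

/-- Any list with an entry satisfying `p` splits at the first such entry. -/
theorem exists_split_first {l : List V} {p : V → Prop} (h : ∃ x ∈ l, p x) :
    ∃ l₁ b l₂, l = l₁ ++ b :: l₂ ∧ p b ∧ ∀ c ∈ l₁, ¬ p c := by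
  induction l with
  | nil => simp at h
  | cons a l ih =>
    by_cases ha : p a
    · exact ⟨[], a, l, rfl, ha, by simp⟩
    · have h' : ∃ x ∈ l, p x := by
        obtain ⟨x, hx, hpx⟩ := h
        rcases List.mem_cons.1 hx with rfl | hx
        · exact (ha hpx).elim
        · exact ⟨x, hx, hpx⟩
      obtain ⟨l₁, b, l₂, rfl, hb, hc⟩ := ih h'
      exact ⟨a :: l₁, b, l₂, rfl, hb, by simpa [ha] using hc⟩

theorem IsIndPath.cons_of_last {a b : V} {l : List V} (h : G.IsIndPath (b :: l))
    (hab : G.Adj a b) (ha : a ∉ l) (hl : ∀ c ∈ l, ¬ G.Adj a c) : G.IsIndPath (a :: b :: l) := by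
  refine ⟨by simp [hab.ne, ha], ?_, h⟩
  intro c hc
  rcases List.mem_cons.1 hc with rfl | hc
  · simp [hab]
  · simp only [hl c hc, List.head?_cons, Option.some.injEq, false_iff]
    rintro rfl
    exact h.1 hc

/-- An induced path inside `A` from `x` to a vertex satisfying `T`, no earlier vertex of which
satisfies `T`. -/
theorem ConnIn.exists_isIndPath {A : Set V} {x y : V} (h : G.ConnIn A x y) (hx : x ∈ A)
    (T : V → Prop) (hT : T y) :
    ∃ l : List V, ∃ b, G.IsIndPath (l ++ [b]) ∧ (l ++ [b]).head? = some x ∧ T b ∧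
      (∀ c ∈ l, ¬ T c) ∧ ∀ c ∈ l ++ [b], c ∈ A := by
  induction h using Relation.ReflTransGen.head_induction_on with
  | refl => exact ⟨[], y, by simp, by simp, hT, by simp, by simpa⟩
  | @head x z hxz _ ih =>
    by_cases hTx : T x
    · exact ⟨[], x, by simp, by simp, hTx, by simp, by simpa⟩
    obtain ⟨l, b, h1, h2, h3, h4, h5⟩ := ih hxz.2.2
    -- If `x` lies on the path already found, cut the path there; otherwise jump from `x` to its
    -- last neighbour on the path. Both keep the path induced.
    by_cases hxl : x ∈ l
    · obtain ⟨l₁, l₂, rfl⟩ := List.append_of_mem hxl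
      refine ⟨x :: l₂, b, ?_, by simp, h3, fun c hc => h4 c (by simp at hc ⊢; tauto),
        fun c hc => h5 c (by simp at hc ⊢; tauto)⟩
      rw [List.append_assoc] at h1
      exact h1.right
    · have hxb : x ≠ b := by rintro rfl; exact hTx h3
      have hz : z ∈ l ++ [b] := by
        exact List.mem_of_mem_head? h2
      obtain ⟨l₁, e, l₂, he, hxe, hl₂⟩ := exists_split_last (p := G.Adj x) ⟨z, hz, hxz.1⟩
      have hr : G.IsIndPath (x :: e :: l₂) := by
        rw [he] at h1
        refine h1.right.cons_of_last hxe (fun h => ?_) hl₂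
        have : x ∈ l ++ [b] := by rw [he]; simp [h]
        simp [hxl, hxb] at this
      rcases List.eq_nil_or_concat l₂ with rfl | ⟨l₃, f, rfl⟩
      · obtain ⟨rfl, hh⟩ := List.append_inj' he rfl
        obtain rfl : b = e := by simpa using hh
        exact ⟨[x], b, hr, by simp, h3, by simpa using hTx, by
          intro c hc
          simp at hc
          rcases hc with rfl | rfl
          · exact hx
          · exact h5 c (by simp)⟩
      · rw [show l₁ ++ e :: l₃.concat f = (l₁ ++ e :: l₃) ++ [f] by simp] at he
        obtain ⟨rfl, hh⟩ := List.append_inj' he rfl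
        obtain rfl : b = f := by simpa using hh
        refine ⟨x :: e :: l₃, b, by simpa using hr, by simp, h3, ?_, ?_⟩
        · intro c hc
          rcases List.mem_cons.1 hc with rfl | hc
          · exact hTx
          · exact h4 c (by simp at hc ⊢; tauto)
        · intro c hc
          rcases List.mem_cons.1 hc with rfl | hc
          · exact hx
          · exact h5 c (by simp at hc ⊢; tauto)

/-! ### Induced cycles as lists of vertices -/

/-- The list `c` is the cyclic vertex sequence of an induced cycle of `G` (for length at least
three). -/
def IsIndCycle (G : SimpleGraph V) : List V → Prop
  | [] => False
  | a :: l => a ∉ l ∧ (∀ b ∈ l, G.Adj a b ↔ l.head? = some b ∨ l.getLast? = some b) ∧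
      G.IsIndPath l

/-- The definition singles out the first vertex; cutting into two arcs gives a condition symmetric
in the arcs, from which rotation invariance is immediate. -/
theorem isIndCycle_append {l₁ l₂ : List V} (hl₁ : l₁ ≠ []) (hl₂ : l₂ ≠ []) :
    G.IsIndCycle (l₁ ++ l₂) ↔ G.IsIndPath l₁ ∧ G.IsIndPath l₂ ∧ ∀ x ∈ l₁, ∀ y ∈ l₂, x ≠ y ∧
      (G.Adj x y ↔ (l₁.getLast? = some x ∧ l₂.head? = some y) ∨
        (l₁.head? = some x ∧ l₂.getLast? = some y)) := by
  obtain ⟨a, l, rfl⟩ := List.exists_cons_of_ne_nil hl₁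
  have hlast : ∀ l : List V, (l ++ l₂).getLast? = l₂.getLast? := fun l => by
    rw [List.getLast?_append]
    obtain ⟨b, hb⟩ : ∃ b, l₂.getLast? = some b := ⟨_, List.getLast?_eq_some_getLast hl₂⟩
    simp [hb]
  rw [List.cons_append, IsIndCycle, isIndPath_append, isIndPath_cons, hlast]
  rcases l with _ | ⟨b, l⟩
  · simp only [List.nil_append, isIndPath_nil, List.not_mem_nil, List.mem_singleton,
      List.getLast?_singleton, List.head?_cons]
    constructor
    · rintro ⟨h1, h2, -, h3, -⟩
      refine ⟨by simp, h3, ?_⟩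
      rintro x rfl y hy
      exact ⟨by rintro rfl; exact h1 hy, by simp [h2 y hy]⟩
    · rintro ⟨-, h2, h3⟩
      refine ⟨fun h => (h3 a rfl a h).1 rfl, fun y hy => ?_, by simp, h2, by simp⟩
      simpa using (h3 a rfl y hy).2
  · have hl : (a :: b :: l).getLast? = (b :: l).getLast? := by simp [List.getLast?_cons]
    rw [hl]
    simp only [List.cons_append, List.head?_cons, Option.some.injEq]
    constructor
    · rintro ⟨h1, h2, h3, h4, h5⟩
      have ha : a ∉ b :: l := fun h => h1 (by simp at h ⊢; tauto)
      refine ⟨⟨ha, fun y hy => ?_, h3⟩, h4, ?_⟩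
      · rw [h2 y (by simp at hy ⊢; tauto)]
        constructor
        · rintro (h | h)
          · exact h
          · exact ((h5 y hy y (List.mem_of_getLast? h)).1 rfl).elim
        · exact Or.inl
      · intro x hx y hy
        rcases List.mem_cons.1 hx with rfl | hx
        · have hxy : x ≠ y := by rintro rfl; exact h1 (by simp [hy])
          refine ⟨hxy, ?_⟩
          rw [h2 y (by simp [hy])]
          constructor
          · rintro (h | h)
            · exact ((h5 b (by simp) y hy).1 (by simpa using h)).elim
            · exact Or.inr ⟨rfl, h⟩
          · rintro (⟨h, -⟩ | ⟨-, h⟩)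
            · exact (ha (List.mem_of_getLast? h)).elim
            · exact Or.inr h
        · refine ⟨(h5 x hx y hy).1, ?_⟩
          rw [(h5 x hx y hy).2]
          constructor
          · exact Or.inl
          · rintro (h | ⟨h, -⟩)
            · exact h
            · exact (ha (by rwa [← h] at hx)).elim
    · rintro ⟨⟨h1, h2, h3⟩, h4, h5⟩
      refine ⟨?_, ?_, h3, h4, fun x hx y hy => ?_⟩
      · intro h
        rcases List.mem_append.1 (show a ∈ (b :: l) ++ l₂ from h) with h | h
        · exact h1 h
        · exact (h5 a (by simp) a h).1 rfl
      · intro y hy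
        rcases List.mem_append.1 (show y ∈ (b :: l) ++ l₂ from hy) with h | h
        · rw [h2 y h]
          constructor
          · exact Or.inl
          · rintro (h' | h')
            · exact h'
            · exact ((h5 y (List.mem_cons_of_mem _ h) y (List.mem_of_getLast? h')).1 rfl).elim
        · rw [(h5 a (by simp) y h).2]
          constructor
          · rintro (⟨h', -⟩ | ⟨-, h'⟩)
            · exact (h1 (List.mem_of_getLast? h')).elim
            · exact Or.inr h'
          · rintro (h' | h')
            · exact ((h5 b (by simp) y h).1 (by simpa using h')).elim
            · exact Or.inr ⟨rfl, h'⟩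
      · refine ⟨(h5 x (List.mem_cons_of_mem _ hx) y hy).1, ?_⟩
        rw [(h5 x (List.mem_cons_of_mem _ hx) y hy).2]
        constructor
        · rintro (h | ⟨h, -⟩)
          · exact h
          · exact (h1 (by rwa [← h] at hx)).elim
        · exact Or.inl

theorem IsIndCycle.rotate {l₁ l₂ : List V} (h : G.IsIndCycle (l₁ ++ l₂)) :
    G.IsIndCycle (l₂ ++ l₁) := by
  rcases eq_or_ne l₁ [] with rfl | h₁
  · simpa using h
  rcases eq_or_ne l₂ [] with rfl | h₂
  · simpa using h
  rw [isIndCycle_append h₁ h₂] at h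
  rw [isIndCycle_append h₂ h₁]
  refine ⟨h.2.1, h.1, fun x hx y hy => ⟨(h.2.2 y hy x hx).1.symm, ?_⟩⟩
  rw [G.adj_comm, (h.2.2 y hy x hx).2]
  tauto

theorem IsIndPath.getElem {l : List V} (h : G.IsIndPath l) {i j : ℕ} (hij : i < j)
    (hj : j < l.length) : l[i] ≠ l[j] ∧ (G.Adj l[i] l[j] ↔ j = i + 1) := by
  induction l generalizing i j with
  | nil => simp at hj
  | cons a l ih =>
    obtain ⟨j, rfl⟩ : ∃ j', j = j' + 1 := ⟨j - 1, by omega⟩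
    have hj' : j < l.length := by simpa using hj
    rcases i with _ | i
    · have hm : l[j] ∈ l := List.getElem_mem _
      simp only [List.getElem_cons_zero, List.getElem_cons_succ]
      refine ⟨fun he => h.1 (he ▸ hm), ?_⟩
      rw [h.2.1 _ hm, List.head?_eq_getElem?, List.getElem?_eq_getElem (by omega),
        Option.some.injEq, h.2.2.nodup.getElem_inj_iff]
      omega
    · simp only [List.getElem_cons_succ]
      rw [(ih h.2.2 (i := i) (j := j) (by omega) hj').2]
      exact ⟨(ih h.2.2 (i := i) (j := j) (by omega) hj').1, by omega⟩

theorem IsIndCycle.getElem {l : List V} (h : G.IsIndCycle l) {i j : ℕ} (hij : i < j)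
    (hj : j < l.length) :
    l[i] ≠ l[j] ∧ (G.Adj l[i] l[j] ↔ j = i + 1 ∨ (i = 0 ∧ j + 1 = l.length)) := by
  rcases l with _ | ⟨a, l⟩
  · simp at hj
  obtain ⟨j, rfl⟩ : ∃ j', j = j' + 1 := ⟨j - 1, by omega⟩
  have hj' : j < l.length := by simpa using hj
  rcases i with _ | i
  · have hm : l[j] ∈ l := List.getElem_mem _
    simp only [List.getElem_cons_zero, List.getElem_cons_succ, List.length_cons]
    refine ⟨fun he => h.1 (he ▸ hm), ?_⟩
    rw [h.2.1 _ hm, List.head?_eq_getElem?, List.getElem?_eq_getElem (by omega),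
      Option.some.injEq, h.2.2.nodup.getElem_inj_iff, List.getLast?_eq_getElem?,
      List.getElem?_eq_getElem (by omega), Option.some.injEq, h.2.2.nodup.getElem_inj_iff]
    have hlen : (a :: l).length = l.length + 1 := rfl
    simp only [true_and]
    omega
  · simp only [List.getElem_cons_succ]
    rw [(h.2.2.getElem (i := i) (j := j) (by omega) hj').2]
    exact ⟨(h.2.2.getElem (i := i) (j := j) (by omega) hj').1, by omega⟩

/-! ### Odd induced cycles -/

theorem isIndPath_of_splits {l : List V} (hc : l.IsChain G.Adj)
    (h : ∀ l₁ x l₂ y l₃, l = l₁ ++ x :: (l₂ ++ y :: l₃) → x ≠ y ∧ (G.Adj x y → l₂ = [])) :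
    G.IsIndPath l := by
  induction l with
  | nil => simp
  | cons a l ih =>
    refine ⟨fun ha => ?_, fun b hb => ?_, ih hc.tail fun l₁ x l₂ y l₃ he =>
      h (a :: l₁) x l₂ y l₃ (by rw [he]; rfl)⟩
    · obtain ⟨l₂, l₃, rfl⟩ := List.append_of_mem ha
      exact (h [] a l₂ a l₃ rfl).1 rfl
    · constructor
      · intro hab
        obtain ⟨l₂, l₃, rfl⟩ := List.append_of_mem hb
        obtain rfl := (h [] a l₂ b l₃ rfl).2 hab
        rfl
      · intro hh
        obtain ⟨l', rfl⟩ := List.head?_eq_some_iff.1 hh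
        exact (List.isChain_cons_cons.1 hc).1

/-- The hypothesis speaks of splittings of the list so that its failure hands over the two pieces
into which a repeated vertex or a chord cuts a closed walk. -/
theorem isIndCycle_of_splits {a : V} {l : List V} (hc : (a :: l ++ [a]).IsChain G.Adj)
    (h : ∀ l₁ x l₂ y l₃, a :: l = l₁ ++ x :: (l₂ ++ y :: l₃) →
      x ≠ y ∧ (G.Adj x y → l₂ = [] ∨ (l₁ = [] ∧ l₃ = []))) :
    G.IsIndCycle (a :: l) := by
  refine ⟨fun ha => ?_, fun b hb => ?_, isIndPath_of_splits ?_ fun l₁ x l₂ y l₃ he => ?_⟩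
  · obtain ⟨l₂, l₃, rfl⟩ := List.append_of_mem ha
    exact (h [] a l₂ a l₃ rfl).1 rfl
  · constructor
    · intro hab
      obtain ⟨l₂, l₃, rfl⟩ := List.append_of_mem hb
      rcases (h [] a l₂ b l₃ rfl).2 hab with rfl | ⟨-, rfl⟩
      · exact Or.inl rfl
      · right; simp
    · rintro (hh | hh)
      · obtain ⟨l', rfl⟩ := List.head?_eq_some_iff.1 hh
        exact (List.isChain_cons_cons.1 hc).1
      · obtain ⟨l', rfl⟩ := List.getLast?_eq_some_iff.1 hh
        have : (a :: l' ++ b :: [a]).IsChain G.Adj := by simpa using hc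
        have := (List.isChain_split.1 this).2
        exact (List.isChain_cons_cons.1 this).1.symm
  · exact hc.left_of_append.tail
  · have := h (a :: l₁) x l₂ y l₃ (by rw [he]; rfl)
    exact ⟨this.1, fun hxy => (this.2 hxy).resolve_right (by simp)⟩

/-- A shortest odd closed walk is induced: a repeated vertex or a chord splits a closed walk into
two shorter ones, and when the total length is odd, one of these is odd. -/
theorem exists_odd_isIndCycle_of_chain (n : ℕ) : ∀ (a : V) (l : List V), l.length = n → Even n →
    (a :: l ++ [a]).IsChain G.Adj →
    ∃ c, G.IsIndCycle c ∧ Odd c.length ∧ 3 ≤ c.length ∧ ∀ x ∈ c, x ∈ a :: l := by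
  induction n using Nat.strong_induction_on with
  | _ n ih =>
  intro a l hl hn hc
  by_cases h : ∀ l₁ x l₂ y l₃, a :: l = l₁ ++ x :: (l₂ ++ y :: l₃) →
      x ≠ y ∧ (G.Adj x y → l₂ = [] ∨ (l₁ = [] ∧ l₃ = []))
  · refine ⟨a :: l, isIndCycle_of_splits hc h, ?_, ?_, fun x hx => hx⟩
    · rw [List.length_cons, hl]; exact hn.add_one
    · rcases l with _ | ⟨b, l⟩
      · simp at hc
      · rcases l with _ | ⟨b', l⟩
        · simp at hl; subst hl; exact absurd hn (by decide)
        · simp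
  · push Not at h
    obtain ⟨l₁, x, l₂, y, l₃, he, h⟩ := h
    have hlen : l₁.length + l₂.length + l₃.length + 1 = n := by
      have := congrArg List.length he
      simp at this; omega
    have hsub : ∀ z, z = x ∨ z = y ∨ z ∈ l₁ ∨ z ∈ l₂ ∨ z ∈ l₃ → z ∈ a :: l := by
      intro z hz
      rw [he]; simp; tauto
    -- Restart the closed walk at `x`, so that its two pieces run from `x` to `y` and from `y` back
    -- to `x`.
    have hrot : (x :: l₂ ++ y :: (l₃ ++ l₁) ++ [x]).IsChain G.Adj := by
      rcases l₁ with _ | ⟨b, l₁⟩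
      · simp at he ⊢
        obtain ⟨rfl, rfl⟩ := he
        simpa using hc
      · simp only [List.cons_append, List.cons.injEq] at he
        obtain ⟨rfl, rfl⟩ := he
        have h1 : ((a :: l₁) ++ x :: (l₂ ++ y :: l₃ ++ [a])).IsChain G.Adj := by simpa using hc
        have h2 := List.isChain_split.1 h1
        have h3 : ((x :: l₂ ++ y :: l₃) ++ a :: (l₁ ++ [x])).IsChain G.Adj :=
          List.isChain_split.2 ⟨by simpa using h2.2, by simpa using h2.1⟩
        simpa using h3
    have hrot' : (x :: l₂ ++ y :: (l₃ ++ l₁ ++ [x])).IsChain G.Adj := by simpa using hrot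
    obtain ⟨h1, h2⟩ := List.isChain_split.1 hrot'
    by_cases hxy : x = y
    · subst hxy
      rcases Nat.even_or_odd l₂.length with hev | hod
      · obtain ⟨c, hc1, hc2, hc3, hc4⟩ := ih l₂.length (by omega) x l₂ rfl hev h1
        refine ⟨c, hc1, hc2, hc3, fun z hz => hsub z ?_⟩
        have := hc4 z hz
        simp at this; tauto
      · have hev : Even (l₃ ++ l₁).length := by
          rw [List.length_append]
          rw [Nat.even_iff] at hn ⊢; rw [Nat.odd_iff] at hod; omega
        obtain ⟨c, hc1, hc2, hc3, hc4⟩ := ih (l₃ ++ l₁).length (by simp; omega) x _ rfl hev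
          (by simpa using h2)
        refine ⟨c, hc1, hc2, hc3, fun z hz => hsub z ?_⟩
        have := hc4 z hz
        simp at this; tauto
    · obtain ⟨hxy', hl2, hl13⟩ := h hxy
      have hl2' : 0 < l₂.length := List.length_pos_of_ne_nil hl2
      have hl13' : 0 < l₁.length + l₃.length := by
        by_contra h0
        have h01 : l₁.length = 0 := by omega
        have h02 : l₃.length = 0 := by omega
        exact hl13 (List.length_eq_zero_iff.1 h01) (List.length_eq_zero_iff.1 h02)
      rcases Nat.even_or_odd l₂.length with hev | hod
      · have hev : Even (y :: (l₃ ++ l₁)).length := by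
          rw [List.length_cons, List.length_append]
          rw [Nat.even_iff] at hn hev ⊢; omega
        obtain ⟨c, hc1, hc2, hc3, hc4⟩ := ih (y :: (l₃ ++ l₁)).length (by simp; omega) x _ rfl hev
          (List.isChain_cons_cons.2 ⟨hxy', by simpa using h2⟩)
        refine ⟨c, hc1, hc2, hc3, fun z hz => hsub z ?_⟩
        have := hc4 z hz
        simp at this; tauto
      · have hev : Even (l₂ ++ [y]).length := by
          rw [List.length_append]; exact hod.add_one
        obtain ⟨c, hc1, hc2, hc3, hc4⟩ := ih (l₂ ++ [y]).length (by simp; omega) x _ rfl hev (by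
          have : (x :: l₂ ++ y :: [x]).IsChain G.Adj :=
            List.isChain_split.2 ⟨h1, by simpa using hxy'.symm⟩
          simpa using this)
        refine ⟨c, hc1, hc2, hc3, fun z hz => hsub z ?_⟩
        have := hc4 z hz
        simp at this; tauto

/-- A vertex set that is not 2-colourable contains an odd induced cycle. -/
theorem exists_odd_isIndCycle {A : Set V} (h : ¬ G.ColOn 2 A) :
    ∃ c, G.IsIndCycle c ∧ Odd c.length ∧ 3 ≤ c.length ∧ ∀ x ∈ c, x ∈ A := by
  classical
  have h1 : ¬ (G.induce A).Colorable 2 := by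
    rintro ⟨c⟩
    refine h ⟨fun v => if hv : v ∈ A then (c ⟨v, hv⟩ : Fin 2) else (0 : Fin 2), ?_, ?_⟩
    · intro v hv
      simp only [hv, dif_pos]; exact (c ⟨v, hv⟩).2
    · intro u hu v hv huv
      simp only [hu, hv, dif_pos]
      intro he
      exact c.valid (v := ⟨u, hu⟩) (w := ⟨v, hv⟩) huv (Fin.ext he)
  rw [two_colorable_iff_forall_loop_even] at h1
  push Not at h1
  obtain ⟨u, w, hw⟩ := h1
  rw [Nat.not_even_iff_odd] at hw
  have hch : (w.support.map Subtype.val).IsChain G.Adj := by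
    rw [List.isChain_map]
    exact w.isChain_adj_support
  have hlen := w.length_support
  rw [← Walk.cons_tail_support] at hch hlen
  rcases List.eq_nil_or_concat w.support.tail with he | ⟨l, b, he⟩
  · rw [he] at hlen
    have h0 : w.length = 0 := by simpa using hlen.symm
    rw [h0] at hw; simp at hw
  · have hb : b = u := by
      have h0 : w.support.getLast? = some u := by
        rw [List.getLast?_eq_some_getLast w.support_ne_nil, w.getLast_support]
      rw [← Walk.cons_tail_support, he, List.concat_eq_append, ← List.cons_append,
        List.getLast?_concat] at h0
      exact Option.some.inj h0
    subst hb
    rw [he] at hch hlen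
    obtain ⟨c, h2, h3, h4, h5⟩ := exists_odd_isIndCycle_of_chain (G := G) (l.map Subtype.val).length b
      (l.map Subtype.val) rfl (by
        simp at hlen ⊢
        rw [← hlen] at hw
        rw [Nat.odd_iff] at hw; rw [Nat.even_iff]; omega) (by simpa using hch)
    refine ⟨c, h2, h3, h4, fun x hx => ?_⟩
    have := h5 x hx
    simp at this
    rcases this with rfl | ⟨h, -⟩
    · exact b.2
    · exact h

/-! ### Points of `TSTAB` and valid inequalities -/

open Classical in
-- Put 0 outside `M` and `P`. Edges between `M` and `P` are tight and preserve the label. Measured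
-- in thirds, the slack along an odd cycle is odd, and the cycle inequality says that it is at least
-- 3. Slack 1 would mean a single non-tight edge whose ends are joined by tight edges only: both
-- ends then have nonzero value, so they lie in `P`, and they have the same label, which `hPP`
-- excludes.
theorem mem_tstab_of_labelling {ι : Type*} {M P : Set V} {φ : V → ι}
    (hM : ∀ u ∈ M, ∀ v ∈ M, ¬ G.Adj u v) (hd : Disjoint M P)
    (hMP : ∀ u ∈ M, ∀ v ∈ P, G.Adj u v → φ u = φ v)
    (hPP : ∀ u ∈ P, ∀ v ∈ P, G.Adj u v → φ u ≠ φ v) :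
    ∃ x ∈ G.tstab, (∀ v ∈ M, x v = 2 / 3) ∧ ∀ v ∈ P, x v = 1 / 3 := by
  set t : V → ℕ := fun v => if v ∈ M then 2 else if v ∈ P then 1 else 0 with ht
  have ht2 : ∀ v, t v ≤ 2 := by intro v; simp only [ht]; split_ifs <;> omega
  have htM : ∀ v, t v = 2 ↔ v ∈ M := by
    intro v; simp only [ht]; split_ifs <;> simp_all
  have htP : ∀ v, t v = 1 ↔ v ∈ P := by
    intro v; simp only [ht]
    have : v ∈ M → v ∉ P := fun h => Set.disjoint_left.1 hd h
    split_ifs <;> simp_all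
  have hadj : ∀ u v, G.Adj u v → t u + t v ≤ 3 := by
    intro u v huv
    by_contra hc
    have h1 := ht2 u
    have h2 := ht2 v
    exact hM u ((htM u).1 (by omega)) v ((htM v).1 (by omega)) huv
  have heq : ∀ u v, G.Adj u v → t u + t v = 3 → φ u = φ v := by
    intro u v huv h
    have h1 := ht2 u
    have h2 := ht2 v
    rcases (show t u = 2 ∧ t v = 1 ∨ t u = 1 ∧ t v = 2 by omega) with h | h
    · exact hMP u ((htM u).1 h.1) v ((htP v).1 h.2) huv
    · exact (hMP v ((htM v).1 h.2) u ((htP u).1 h.1) huv.symm).symm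
  -- Total slack of the edges of a walk, in units of 1/3.
  let D : ∀ {u v : V}, G.Walk u v → ℕ := fun w => (w.darts.map fun d => 3 - t d.fst - t d.snd).sum
  have hDcons : ∀ {u v w : V} (h : G.Adj u v) (p : G.Walk v w),
      D (Walk.cons h p) = (3 - t u - t v) + D p := by
    intro u v w h p
    simp [D]
  have hD0 : ∀ {u v : V} (w : G.Walk u v), D w = 0 → φ u = φ v ∧ (t u = 0 ↔ t v = 0) := by
    intro u v w
    induction w with
    | nil => simp
    | cons h p ih =>
      intro h0
      rw [hDcons] at h0
      have h1 := hadj _ _ h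
      have h2 := heq _ _ h (by omega)
      have h3 := ih (by omega)
      rw [h2, h3.1]
      refine ⟨rfl, ?_⟩
      rw [← h3.2]
      have := ht2
      rename_i a b c
      have := ht2 a
      have := ht2 b
      omega
  have hD1 : ∀ {u v : V} (w : G.Walk u v), D w = 1 → t u ≠ 0 → t v ≠ 0 → φ u ≠ φ v := by
    intro u v w
    induction w with
    | nil => simp [D]
    | @cons a b c h p ih =>
      intro h0 ha hc
      rw [hDcons] at h0
      have h1 := hadj _ _ h
      have h3 := ht2 a
      have h4 := ht2 b
      by_cases hab : t a + t b = 3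
      · rw [heq _ _ h hab]
        exact ih (by omega) (by omega) hc
      · have h5 := hD0 p (by omega)
        rw [← h5.1]
        have : t b ≠ 0 := fun h => hc (h5.2.1 h)
        exact hPP a ((htP a).1 (by omega)) b ((htP b).1 (by omega)) h
  have hDclosed : ∀ {u : V} (w : G.Walk u u), D w ≠ 1 := by
    intro u w hw
    by_cases hu : t u = 0
    · cases w with
      | nil => simp [D] at hw
      | @cons _ b _ h p =>
        rw [hDcons] at hw
        have h4 := ht2 b
        have h5 := hD0 p (by omega)
        have := h5.2.2 hu
        omega
    · exact hD1 w hw hu hu rfl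
  have hsum : ∀ {u v : V} (w : G.Walk u v),
      D w + 2 * (w.support.tail.map t).sum + t u = 3 * w.length + t v := by
    intro u v w
    induction w with
    | nil => simp [D]
    | @cons a b c h p ih =>
      rw [hDcons, Walk.support_cons, List.tail_cons, ← Walk.cons_tail_support p, Walk.length_cons,
        List.map_cons, List.sum_cons]
      have h1 := hadj _ _ h
      omega
  refine ⟨fun v => (t v : ℝ) / 3, ?_, fun v hv => by simp [(htM v).2 hv],
    fun v hv => by simp [(htP v).2 hv]⟩
  refine ⟨fun v => ?_, fun u v huv => ?_, fun u c hc hodd => ?_⟩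
  · dsimp only
    have : (t v : ℝ) ≤ 2 := by exact_mod_cast ht2 v
    constructor
    · positivity
    · linarith
  · dsimp only
    have : (t u : ℝ) + t v ≤ 3 := by exact_mod_cast hadj u v huv
    linarith
  · have h1 : c.support.toFinset = c.support.tail.toFinset := by
      ext z
      rw [List.mem_toFinset, List.mem_toFinset]
      constructor
      · intro hz
        rw [← Walk.cons_tail_support] at hz
        rcases List.mem_cons.1 hz with rfl | hz
        · exact Walk.end_mem_tail_support hc.not_nil
        · exact hz
      · exact List.mem_of_mem_tail
    rw [h1, List.sum_toFinset _ hc.support_nodup]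
    have h2 := hsum c
    have h3 := hDclosed c
    -- On a closed walk slack plus twice the sum of the values is three times the length; so the
    -- slack is odd, and not being 1 it is at least 3.
    have h4 : 2 * (c.support.tail.map t).sum ≤ 3 * c.length - 3 := by
      rw [Nat.odd_iff] at hodd; omega
    have h5 : 1 ≤ c.length := hodd.pos
    have h6 : ∀ L : List V, (L.map fun v => (t v : ℝ) / 3).sum = ((L.map t).sum : ℕ) / 3 := by
      intro L
      induction L with
      | nil => simp
      | cons a L ih =>
        rw [List.map_cons, List.sum_cons, ih, List.map_cons, List.sum_cons, Nat.cast_add]; ring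
    rw [h6]
    have h7 : (2 * (c.support.tail.map t).sum : ℕ) + 3 ≤ 3 * c.length := by omega
    have h8 : (2 * ((c.support.tail.map t).sum : ℕ) + 3 : ℝ) ≤ 3 * c.length := by
      exact_mod_cast h7
    linarith

open Classical in
/-- An inequality valid for the stable sets meeting every edge of `E` holds at a point of
`TSTAB` for which the edges of `E` are tight. -/
theorem IsTPerfect.le_of_forall_indepSet (hG : G.IsTPerfect) {x : V → ℝ} (hx : x ∈ G.tstab)
    {E : Finset (V × V)} (hE : ∀ e ∈ E, G.Adj e.1 e.2 ∧ x e.1 + x e.2 = 1)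
    (n : ℕ) (r : ℕ → V) (h : V) {w β : ℝ} (hw : 0 ≤ w)
    (hS : ∀ S : Set V, G.IsIndepSet S → (∀ e ∈ E, e.1 ∈ S ∨ e.2 ∈ S) →
      2 * ∑ j ∈ Finset.range n, S.indicator (1 : V → ℝ) (r j) + w * S.indicator (1 : V → ℝ) h ≤ β) :
    2 * ∑ j ∈ Finset.range n, x (r j) + w * x h ≤ β := by
  -- A penalty per unmet edge of `E`: it outweighs the largest possible left-hand side, `2 * n + w`,
  -- even when `β` is negative.
  set C : ℝ := 2 * n + w + |β| with hC
  have hC0 : 0 ≤ C := by positivity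
  let f : (V → ℝ) → ℝ := fun y => 2 * ∑ j ∈ Finset.range n, y (r j) + w * y h
    + C * ∑ e ∈ E, (y e.1 + y e.2)
  have hf : IsLinearMap ℝ f := by
    constructor
    · intro y z
      simp only [f, Pi.add_apply, Finset.sum_add_distrib]; ring
    · intro c y
      simp only [f, Pi.smul_apply, smul_eq_mul, Finset.sum_add_distrib, ← Finset.mul_sum]; ring
  have hsub : G.stableSetPolytope ⊆ {y | f y ≤ β + C * E.card} := by
    refine convexHull_min ?_ (convex_halfSpace_le hf _)
    rintro y ⟨S, hSI, rfl⟩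
    have hind : ∀ v, S.indicator (1 : V → ℝ) v = if v ∈ S then 1 else 0 := fun v => by
      simp [Set.indicator]
    have hle : ∀ e ∈ E, S.indicator (1 : V → ℝ) e.1 + S.indicator (1 : V → ℝ) e.2 ≤ 1 := by
      intro e he
      rw [hind, hind]
      have h1 : ¬ (e.1 ∈ S ∧ e.2 ∈ S) := fun h => hSI h.1 h.2 (hE e he).1.ne (hE e he).1
      split_ifs <;> first | (exfalso; tauto) | norm_num
    by_cases hall : ∀ e ∈ E, e.1 ∈ S ∨ e.2 ∈ S
    · have h1 := hS S hSI hall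
      have h2 : ∑ e ∈ E, (S.indicator (1 : V → ℝ) e.1 + S.indicator (1 : V → ℝ) e.2) ≤ E.card := by
        have := Finset.sum_le_sum hle
        simpa using this
      have h3 := mul_le_mul_of_nonneg_left h2 hC0
      show 2 * ∑ j ∈ Finset.range n, S.indicator (1 : V → ℝ) (r j) + w * S.indicator (1 : V → ℝ) h
        + C * ∑ e ∈ E, (S.indicator (1 : V → ℝ) e.1 + S.indicator (1 : V → ℝ) e.2) ≤ _
      linarith
    · push Not at hall
      obtain ⟨e, he, he1, he2⟩ := hall
      have h2 : ∑ e ∈ E, (S.indicator (1 : V → ℝ) e.1 + S.indicator (1 : V → ℝ) e.2)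
          ≤ E.card - 1 := by
        rw [← Finset.add_sum_erase _ _ he]
        have := Finset.sum_le_sum fun e' (he' : e' ∈ E.erase e) => hle e' (Finset.mem_of_mem_erase he')
        rw [Finset.sum_const, nsmul_eq_mul, mul_one, Finset.card_erase_of_mem he,
          Nat.cast_sub (Finset.card_pos.2 ⟨e, he⟩)] at this
        rw [hind e.1, hind e.2, if_neg he1, if_neg he2]
        push_cast at this
        linarith
      have h3 := mul_le_mul_of_nonneg_left h2 hC0
      have h4 : ∑ j ∈ Finset.range n, S.indicator (1 : V → ℝ) (r j) ≤ n := by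
        have := Finset.sum_le_sum (s := Finset.range n) (f := fun j => S.indicator (1 : V → ℝ) (r j))
          (g := fun _ => (1 : ℝ)) fun j _ => by
            rw [hind]; split_ifs <;> norm_num
        simpa using this
      have h5 : w * S.indicator (1 : V → ℝ) h ≤ w := by
        rw [hind]; split_ifs <;> linarith
      have h6 : -|β| ≤ β := neg_abs_le β
      show 2 * ∑ j ∈ Finset.range n, S.indicator (1 : V → ℝ) (r j) + w * S.indicator (1 : V → ℝ) h
        + C * ∑ e ∈ E, (S.indicator (1 : V → ℝ) e.1 + S.indicator (1 : V → ℝ) e.2) ≤ _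
      rw [hC] at h3 ⊢
      linarith
  have hx' : x ∈ G.stableSetPolytope := by rw [hG]; exact hx
  have h1 : f x ≤ β + C * E.card := hsub hx'
  have h2 : ∑ e ∈ E, (x e.1 + x e.2) = E.card := by
    rw [Finset.sum_congr rfl fun e he => (hE e he).2]; simp
  simp only [f, h2] at h1
  linarith

/-! ### The rim lemma -/

open Classical in
/-- An odd induced cycle `r`, whose attached vertices `B` include three at odd distances, does not
occur together with a hub `Hm ∪ Hp`, possibly extended by vertices `X` seeing only the last vertex
of the cycle. -/
theorem IsTPerfect.rim_false [Finite V] (hG : G.IsTPerfect) {n : ℕ} (hn : Odd n) {r : ℕ → V}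
    (hrn : r n = r 0) (hinj : ∀ i < n, ∀ j < n, r i = r j → i = j)
    (hadj : ∀ i < n, G.Adj (r i) (r (i + 1)))
    (honly : ∀ i < n, ∀ j < n, G.Adj (r i) (r j) → r j = r (i + 1) ∨ r i = r (j + 1))
    {B Hm Hp X : Set V}
    (hmr : ∀ v ∈ Hm, ∀ j < n, v ≠ r j ∧ ¬ G.Adj v (r j))
    (hpr : ∀ v ∈ Hp, ∀ j < n, v ≠ r j ∧ (G.Adj v (r j) → r j ∈ B))
    (hxr : ∀ v ∈ X, ∀ j < n, v ≠ r j ∧ (G.Adj v (r j) → j + 1 = n))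
    (hX : X.Nonempty → r (n - 1) ∉ B ∧ r (n - 2) ∈ B)
    (hmm : ∀ u ∈ Hm, ∀ v ∈ Hm, ¬ G.Adj u v) (hpp : ∀ u ∈ Hp, ∀ v ∈ Hp, ¬ G.Adj u v)
    (hxx : ∀ u ∈ X, ∀ v ∈ X, ¬ G.Adj u v) (hmx : ∀ u ∈ Hm, ∀ v ∈ X, ¬ G.Adj u v)
    (hmp : Disjoint Hm Hp) (hmX : Disjoint Hm X) (hpX : Disjoint Hp X)
    {h : V} (hh : h ∈ Hp)
    (hstar : ∀ S : Set V, G.IsIndepSet S →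
      (∀ u ∈ Hm, ∀ v ∈ Hp, G.Adj u v → u ∈ S ∨ v ∈ S) →
      (∀ u ∈ X, ∀ j < n, G.Adj u (r j) → u ∈ S ∨ r j ∈ S) → h ∈ S →
      ∀ j < n, r j ∈ B → r j ∉ S)
    (h0 : r 0 ∈ B) {j k : ℕ} (hjk : j < k) (hkn : k < n) (hj : Odd j) (hk : Even k)
    (hjB : r j ∈ B) (hkB : r k ∈ B) : False := by
  have := Fintype.ofFinite V
  -- `dl j` counts the steps back from `r j` to the latest attachment. `e j` is 1 when the step from
  -- `r j` to `r (j + 1)` completes a gap of odd length between attachments, and `ct` counts the odd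
  -- gaps completed so far.
  obtain ⟨dl, dl0, dls⟩ : ∃ dl : ℕ → ℕ, dl 0 = 0 ∧
      ∀ j : ℕ, dl (j + 1) = if r (j + 1) ∈ B then 0 else dl j + 1 :=
    ⟨fun j => Nat.rec (motive := fun _ => ℕ) 0 (fun i d => if r (i + 1) ∈ B then 0 else d + 1) j,
      rfl, fun j => rfl⟩
  obtain ⟨e, he⟩ : ∃ e : ℕ → ℕ, ∀ j : ℕ, e j = if r (j + 1) ∈ B ∧ Even (dl j) then 1 else 0 :=
    ⟨fun j => if r (j + 1) ∈ B ∧ Even (dl j) then 1 else 0, fun j => rfl⟩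
  let ct : ℕ → ℕ := fun j => ∑ i ∈ Finset.range j, e i
  have ct0 : ct 0 = 0 := rfl
  have cts : ∀ j, ct (j + 1) = ct j + e j := fun j => Finset.sum_range_succ _ _
  have hpar : ∀ j, (ct j + dl j) % 2 = j % 2 := by
    intro j
    induction j with
    | zero => rw [ct0, dl0]
    | succ j ih =>
      rw [cts, dls, he]
      by_cases hb : r (j + 1) ∈ B <;> by_cases hev : Even (dl j) <;> simp only [hb, hev, if_true,
        if_false, and_true, and_false] <;> rw [Nat.even_iff] at hev <;> omega
  have hdlB : ∀ j, r j ∈ B → dl j = 0 := by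
    intro j hb
    rcases j with _ | j
    · exact dl0
    · rw [dls, if_pos hb]
  have hctmono : ∀ i j, i ≤ j → ct i ≤ ct j := by
    intro i j hij
    induction hij with
    | refl => exact le_rfl
    | step _ ih => exact ih.trans (by rw [cts]; omega)
  set N := ct n with hN
  have hdn : dl n = 0 := hdlB n (by rw [hrn]; exact h0)
  -- At attachments `ct` has the parity of the index. It starts at 0, is odd at `j`, even at `k` and
  -- odd at `n`; being monotone it reaches 3.
  have hN3 : 3 ≤ N ∧ N % 2 = 1 := by
    have h1 := hpar j
    have h2 := hpar k
    have h3 := hpar n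
    rw [hdlB j hjB] at h1
    rw [hdlB k hkB] at h2
    rw [hdn] at h3
    have h4 := hctmono j k hjk.le
    have h5 := hctmono k n hkn.le
    rw [Nat.odd_iff] at hj hn
    rw [Nat.even_iff] at hk
    omega
  -- the labelling
  let M : Set V := {v | v ∈ Hm ∨ ∃ j < n, v = r j ∧ Odd (dl j)}
  let P : Set V := {v | v ∈ Hp ∨ v ∈ X ∨ ∃ j < n, v = r j ∧ Even (dl j)}
  -- Labels count odd gaps modulo `N`, which is consistent at `r n = r 0`. Hub vertices get `none`,
  -- which differs from every rim label; vertices of `X` copy the label of `r (n - 1)`, the only rim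
  -- vertex they may see.
  let φ : V → Option ℕ := fun v => if hv : ∃ j < n, v = r j then some (ct hv.choose % N)
    else if v ∈ X then some (ct (n - 1) % N) else none
  have hφr' : ∀ j < n, φ (r j) = some (ct j % N) := by
    intro j hj
    have hv : ∃ i < n, r j = r i := ⟨j, hj, rfl⟩
    simp only [φ, dif_pos hv]
    rw [← hinj j hj _ hv.choose_spec.1 hv.choose_spec.2]
  have hφr : ∀ j ≤ n, φ (r j) = some (ct j % N) := by
    intro j hj
    rcases hj.lt_or_eq with hj | rfl
    · exact hφr' j hj
    · rw [hrn, hφr' 0 (by omega), ct0, ← hN, Nat.mod_self, Nat.zero_mod]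
  have hφm : ∀ v ∈ Hm, φ v = none := by
    intro v hv
    simp only [φ]
    rw [dif_neg (by rintro ⟨j, hj, he⟩; exact (hmr v hv j hj).1 he),
      if_neg (Set.disjoint_left.1 hmX hv)]
  have hφp : ∀ v ∈ Hp, φ v = none := by
    intro v hv
    simp only [φ]
    rw [dif_neg (by rintro ⟨j, hj, he⟩; exact (hpr v hv j hj).1 he),
      if_neg (Set.disjoint_left.1 hpX hv)]
  have hφx : ∀ v ∈ X, φ v = some (ct (n - 1) % N) := by
    intro v hv
    simp only [φ]
    rw [dif_neg (by rintro ⟨j, hj, he⟩; exact (hxr v hv j hj).1 he), if_pos hv]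
  have hMr : ∀ j ≤ n, r j ∈ M ↔ Odd (dl j) := by
    have key : ∀ j < n, r j ∈ M ↔ Odd (dl j) := by
      intro j hj
      constructor
      · rintro (h | ⟨i, hi, he, h⟩)
        · exact ((hmr _ h j hj).1 rfl).elim
        · rwa [hinj j hj i hi he]
      · exact fun h => Or.inr ⟨j, hj, rfl, h⟩
    intro j hj
    rcases hj.lt_or_eq with hj | rfl
    · exact key j hj
    · rw [hrn, key 0 (by omega), dl0, hdn]
  have hPr : ∀ j ≤ n, r j ∈ P ↔ Even (dl j) := by
    have key : ∀ j < n, r j ∈ P ↔ Even (dl j) := by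
      intro j hj
      constructor
      · rintro (h | h | ⟨i, hi, he, h⟩)
        · exact ((hpr _ h j hj).1 rfl).elim
        · exact ((hxr _ h j hj).1 rfl).elim
        · rwa [hinj j hj i hi he]
      · exact fun h => Or.inr (Or.inr ⟨j, hj, rfl, h⟩)
    intro j hj
    rcases hj.lt_or_eq with hj | rfl
    · exact key j hj
    · rw [hrn, key 0 (by omega), dl0, hdn]
  have hstep : ∀ j : ℕ, r (j + 1) ∈ B ∧ dl (j + 1) = 0 ∨ r (j + 1) ∉ B ∧ dl (j + 1) = dl j + 1 := by
    intro j
    rw [dls]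
    split_ifs <;> tauto
  have hXd : X.Nonempty → Odd (dl (n - 1)) := by
    intro hx
    obtain ⟨h1, h2⟩ := hX hx
    have h3 : n - 1 = n - 2 + 1 := by omega
    rw [h3, dls, if_neg (by rwa [← h3]), hdlB _ h2]
    decide
  have hMstab : ∀ u ∈ M, ∀ v ∈ M, ¬ G.Adj u v := by
    have key : ∀ i < n, Odd (dl i) → Odd (dl (i + 1)) → False := by
      intro i _ h1 h2
      rcases hstep i with ⟨-, h3⟩ | ⟨-, h3⟩
      · rw [h3] at h2; exact absurd h2 (by decide)
      · rw [h3] at h2; rw [Nat.odd_iff] at h1 h2; omega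
    rintro u (hu | ⟨i, hi, rfl, hi'⟩) v (hv | ⟨j, hj, rfl, hj'⟩) huv
    · exact hmm u hu v hv huv
    · exact (hmr u hu j hj).2 huv
    · exact (hmr v hv i hi).2 huv.symm
    · rcases honly i hi j hj huv with h | h
      · rw [← hMr j hj.le, h, hMr (i + 1) hi] at hj'
        exact key i hi hi' hj'
      · rw [← hMr i hi.le, h, hMr (j + 1) hj] at hi'
        exact key j hj hj' hi'
  have hdisj : Disjoint M P := by
    rw [Set.disjoint_left]
    rintro u (hu | ⟨i, hi, rfl, hi'⟩) hP
    · rcases hP with h | h | ⟨j, hj, rfl, -⟩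
      · exact Set.disjoint_left.1 hmp hu h
      · exact Set.disjoint_left.1 hmX hu h
      · exact (hmr _ hu j hj).1 rfl
    · rw [hPr i hi.le] at hP
      exact (Nat.not_even_iff_odd.2 hi') hP
  have hMP : ∀ u ∈ M, ∀ v ∈ P, G.Adj u v → φ u = φ v := by
    rintro u (hu | ⟨i, hi, rfl, hi'⟩) v (hv | hv | ⟨j, hj, rfl, hj'⟩) huv
    · rw [hφm u hu, hφp v hv]
    · exact (hmx u hu v hv huv).elim
    · exact ((hmr u hu j hj).2 huv).elim
    · have := hdlB i ((hpr v hv i hi).2 huv.symm)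
      rw [this] at hi'
      exact absurd hi' (by decide)
    · have := (hxr v hv i hi).2 huv.symm
      rw [hφx v hv, hφr i hi.le, show i = n - 1 by omega]
    · rcases honly i hi j hj huv with h | h
      · rw [← hPr j hj.le, h, hPr (i + 1) hi] at hj'
        rw [h, hφr i hi.le, hφr (i + 1) hi, cts, he, if_neg, Nat.add_zero]
        rintro ⟨-, h2⟩
        exact (Nat.not_even_iff_odd.2 hi') h2
      · rw [← hMr i hi.le, h, hMr (j + 1) hj] at hi'
        rw [h, hφr j hj.le, hφr (j + 1) hj, cts, he, if_neg, Nat.add_zero]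
        rintro ⟨h1, h2⟩
        rw [hdlB _ h1] at hi'
        exact absurd hi' (by decide)
  have hPP : ∀ u ∈ P, ∀ v ∈ P, G.Adj u v → φ u ≠ φ v := by
    have hne : ∀ a, a % N ≠ (a + 1) % N := by
      intro a ha
      have h1 : a + 0 ≡ a + 1 [MOD N] := ha
      have h2 := Nat.ModEq.add_left_cancel' a h1
      have h3 : (0 : ℕ) % N = 1 % N := h2
      rw [Nat.zero_mod, Nat.mod_eq_of_lt (by omega)] at h3
      omega
    have key : ∀ i < n, Even (dl i) → Even (dl (i + 1)) → φ (r i) ≠ φ (r (i + 1)) := by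
      intro i hi h1 h2
      rcases hstep i with ⟨h3, h4⟩ | ⟨h3, h4⟩
      · rw [hφr i hi.le, hφr (i + 1) hi, cts, he, if_pos ⟨h3, h1⟩]
        simpa using hne _
      · rw [h4] at h2; rw [Nat.even_iff] at h1 h2; omega
    have keyx : ∀ u ∈ X, ∀ j < n, Even (dl j) → ¬ G.Adj u (r j) := by
      intro u hu j hj h huv
      have h1 := (hxr u hu j hj).2 huv
      have h2 := hXd ⟨u, hu⟩
      rw [show n - 1 = j by omega] at h2
      exact (Nat.not_even_iff_odd.2 h2) h
    rintro u (hu | hu | ⟨i, hi, rfl, hi'⟩) v (hv | hv | ⟨j, hj, rfl, hj'⟩) huv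
    · exact (hpp u hu v hv huv).elim
    · rw [hφp u hu, hφx v hv]; simp
    · rw [hφp u hu, hφr j hj.le]; simp
    · rw [hφp v hv, hφx u hu]; simp
    · exact (hxx u hu v hv huv).elim
    · exact (keyx u hu j hj hj' huv).elim
    · rw [hφp v hv, hφr i hi.le]; simp
    · exact (keyx v hv i hi hi' huv.symm).elim
    · rcases honly i hi j hj huv with h | h
      · rw [← hPr j hj.le, h, hPr (i + 1) hi] at hj'
        rw [h]; exact key i hi hi' hj'
      · rw [← hPr i hi.le, h, hPr (j + 1) hj] at hi'
        rw [h]; exact (key j hj hj' hi').symm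
  -- the violated inequality
  obtain ⟨x, hx, hxM, hxP⟩ := mem_tstab_of_labelling hMstab hdisj hMP hPP
  have hshift : ∀ {R : Type} [AddCommMonoid R] (f : ℕ → R), f n = f 0 →
      ∑ j ∈ Finset.range n, f (j + 1) = ∑ j ∈ Finset.range n, f j := by
    intro R _ f hf
    obtain ⟨m, rfl⟩ : ∃ m, n = m + 1 := ⟨n - 1, by omega⟩
    rw [Finset.sum_range_succ, Finset.sum_range_succ' f, hf]
  let E : Finset (V × V) := Finset.univ.filter fun q => q.1 ∈ M ∧ q.2 ∈ P ∧ G.Adj q.1 q.2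
  have hE : ∀ q ∈ E, G.Adj q.1 q.2 ∧ x q.1 + x q.2 = 1 := by
    intro q hq
    obtain ⟨h1, h2, h3⟩ := (Finset.mem_filter.1 hq).2
    exact ⟨h3, by rw [hxM _ h1, hxP _ h2]; norm_num⟩
  have hrE : ∀ S : Set V, (∀ q ∈ E, q.1 ∈ S ∨ q.2 ∈ S) → ∀ u ∈ M, ∀ v ∈ P, G.Adj u v →
      u ∈ S ∨ v ∈ S := fun S hS u hu v hv huv =>
    hS (u, v) (Finset.mem_filter.2 ⟨Finset.mem_univ _, hu, hv, huv⟩)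
  -- At `x` the left-hand side is `n - N / 3 + (N - 1) / 3 = n - 1 / 3`, exceeding the bound `n -
  -- 1`.
  have hbound := hG.le_of_forall_indepSet hx hE n r h (w := (N : ℝ) - 1) (β := n - 1)
    (by have : (3 : ℝ) ≤ N := by exact_mod_cast hN3.1
        linarith) ?_
  · have ht : ∀ j < n, x (r j) + x (r (j + 1)) + (e j : ℝ) / 3 = 1 := by
      intro j hj
      have hval : ∀ i ≤ n, x (r i) = if Odd (dl i) then 2 / 3 else 1 / 3 := by
        intro i hi
        split_ifs with ho
        · exact hxM _ ((hMr i hi).2 ho)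
        · exact hxP _ ((hPr i hi).2 (Nat.not_odd_iff_even.1 ho))
      rw [hval j hj.le, hval (j + 1) hj, he]
      rcases hstep j with ⟨h3, h4⟩ | ⟨h3, h4⟩
      · rw [h4]
        by_cases ho : Odd (dl j)
        · have := Nat.not_even_iff_odd.2 ho
          simp [ho, this]; norm_num
        · have := Nat.not_odd_iff_even.1 ho
          rw [if_neg ho, if_neg (by decide), if_pos ⟨h3, this⟩]; norm_num
      · rw [h4]
        by_cases ho : Odd (dl j)
        · have h5 : ¬ Odd (dl j + 1) := by rw [Nat.odd_add_one]; simpa using ho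
          simp [ho, h3, h5]; norm_num
        · have h5 : Odd (dl j + 1) := by rw [Nat.odd_add_one]; exact ho
          simp [ho, h3, h5]; norm_num
    have h1 := Finset.sum_congr (rfl : Finset.range n = _) fun j hj => ht j (Finset.mem_range.1 hj)
    rw [Finset.sum_add_distrib, Finset.sum_add_distrib, hshift (fun j => x (r j)) (by simp [hrn]),
      ← Finset.sum_div, ← Nat.cast_sum] at h1
    change _ + (N : ℝ) / 3 = _ at h1
    rw [Finset.sum_const, Finset.card_range, nsmul_eq_mul, mul_one] at h1
    rw [hxP h (Or.inl hh)] at hbound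
    linarith
  · intro S hSI hS
    have hS' := hrE S hS
    have hind : ∀ v, S.indicator (1 : V → ℝ) v = ((if v ∈ S then 1 else 0 : ℕ) : ℝ) := fun v => by
      simp [Set.indicator]
    simp only [hind]
    rw [← Nat.cast_sum]
    set s : ℕ → ℕ := fun j => if r j ∈ S then 1 else 0 with hs
    have hs1 : ∀ j, r j ∈ S → s j = 1 := fun j hj => if_pos hj
    have hs2 : ∀ j, r j ∉ S → s j = 0 := fun j hj => if_neg hj
    have hs0 : s n = s 0 := by simp only [hs, hrn]
    have hsle : ∀ j < n, s j + s (j + 1) ≤ 1 := by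
      intro j hj
      have h1 : ¬ (r j ∈ S ∧ r (j + 1) ∈ S) := fun h => hSI h.1 h.2 (hadj j hj).ne (hadj j hj)
      by_cases h2 : r j ∈ S
      · rw [hs1 _ h2, hs2 _ fun h3 => h1 ⟨h2, h3⟩]
      · rw [hs2 _ h2]
        by_cases h3 : r (j + 1) ∈ S
        · rw [hs1 _ h3]
        · rw [hs2 _ h3]; omega
    -- If `h` is in `S`, then no attachment is, and the tight edges force `S` to alternate within
    -- each gap; every odd gap loses one, so twice the rim count is `n - N`. If `h` is not in `S`,
    -- oddness of the rim suffices.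
    by_cases hhS : h ∈ S
    · rw [if_pos hhS]
      have hBS : ∀ j < n, r j ∈ B → s j = 0 := by
        intro j hj hjB
        refine hs2 _ ?_
        refine hstar S hSI ?_ ?_ hhS j hj hjB
        · exact fun u hu v hv huv => hS' u (Or.inl hu) v (Or.inl hv) huv
        · intro u hu j hj huj
          have h1 := hXd ⟨u, hu⟩
          have h2 := (hxr u hu j hj).2 huj
          rw [show n - 1 = j by omega, ← hMr j hj.le] at h1
          exact (hS' _ h1 u (Or.inr (Or.inl hu)) huj.symm).symm
      have hBS' : ∀ j ≤ n, r j ∈ B → s j = 0 := by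
        intro j hj hjB
        rcases hj.lt_or_eq with hj | rfl
        · exact hBS j hj hjB
        · rw [hs0]; exact hBS 0 (by omega) h0
      have halt : ∀ j < n, r (j + 1) ∉ B → s j + s (j + 1) = 1 := by
        intro j hj hb
        have h1 := hsle j hj
        have h2 : r j ∈ S ∨ r (j + 1) ∈ S := by
          rcases hstep j with ⟨h3, -⟩ | ⟨-, h4⟩
          · exact (hb h3).elim
          by_cases ho : Odd (dl j)
          · refine hS' _ ((hMr j hj.le).2 ho) _ ((hPr (j + 1) hj).2 ?_) (hadj j hj)
            rw [h4]; exact ho.add_one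
          · rw [Nat.not_odd_iff_even] at ho
            refine (hS' _ ((hMr (j + 1) hj).2 ?_) _ ((hPr j hj.le).2 ho) (hadj j hj).symm).symm
            rw [h4]; exact ho.add_one
        rcases h2 with h2 | h2 <;> rw [hs1 _ h2] at h1 ⊢ <;> omega
      have hsd : ∀ j ≤ n, s j = dl j % 2 := by
        intro j
        induction j with
        | zero => intro _; rw [dl0, hBS' 0 (by omega) h0]
        | succ j ih =>
          intro hj
          have h1 := ih (by omega)
          rcases hstep j with ⟨h3, h4⟩ | ⟨h3, h4⟩
          · rw [h4, hBS' _ hj h3]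
          · have := halt j hj h3
            omega
      have h1 : ∀ j ∈ Finset.range n, s j + s (j + 1) + e j = 1 := by
        intro j hj
        rw [Finset.mem_range] at hj
        have h2 := hsd j hj.le
        rcases hstep j with ⟨h3, h4⟩ | ⟨h3, h4⟩
        · rw [hBS' _ hj h3, h2, he]
          by_cases hev : Even (dl j)
          · rw [if_pos ⟨h3, hev⟩, Nat.even_iff.1 hev]
          · rw [if_neg (fun h => hev h.2), Nat.not_even_iff.1 hev]
        · rw [halt j hj h3, he, if_neg (fun h => h3 h.1)]
      have h2 := Finset.sum_congr rfl h1
      rw [Finset.sum_add_distrib, Finset.sum_add_distrib, hshift s hs0, Finset.sum_const,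
        Finset.card_range] at h2
      change _ + N = _ at h2
      have h3 : (2 * (∑ j ∈ Finset.range n, s j : ℕ) + N : ℝ) = n := by
        have : 2 * (∑ j ∈ Finset.range n, s j) + N = n := by simp at h2; omega
        exact_mod_cast this
      push_cast at h3 ⊢
      linarith
    · rw [if_neg hhS]
      have h2 := Finset.sum_le_sum fun j (hj : j ∈ Finset.range n) =>
        hsle j (Finset.mem_range.1 hj)
      rw [Finset.sum_add_distrib, hshift s hs0, Finset.sum_const, Finset.card_range] at h2
      have h3 : (2 * (∑ j ∈ Finset.range n, s j : ℕ) + 1 : ℝ) ≤ n := by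
        have : 2 * (∑ j ∈ Finset.range n, s j) + 1 ≤ n := by
          simp at h2; rw [Nat.odd_iff] at hn; omega
        exact_mod_cast this
      push_cast at h3 ⊢
      linarith

/-! ### Hubs -/

/-- `A` is a stable set of vertices. -/
def Stable (G : SimpleGraph V) (A : Set V) : Prop := ∀ u ∈ A, ∀ v ∈ A, ¬ G.Adj u v

theorem stable_singleton (x : V) : G.Stable {x} := by
  rintro u rfl v rfl h
  exact G.loopless.irrefl _ h

/-- A connected bipartite set of vertices with sides `A` and `B`. -/
structure IsHub (G : SimpleGraph V) (A B : Set V) : Prop where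
  left : G.Stable A
  right : G.Stable B
  disj : Disjoint A B
  conn : G.ConnSet (A ∪ B)

theorem IsHub.symm {A B : Set V} (h : G.IsHub A B) : G.IsHub B A :=
  ⟨h.right, h.left, h.disj.symm, by rw [Set.union_comm]; exact h.conn⟩

/-- A stable set meeting every edge between the sides contains exactly one end of each, so
membership alternates along walks in the connected hub. -/
theorem IsHub.subset_of_mem {A B S : Set V} (h : G.IsHub A B) (hS : G.IsIndepSet S)
    (hAB : ∀ u ∈ B, ∀ v ∈ A, G.Adj u v → u ∈ S ∨ v ∈ S) {a : V} (ha : a ∈ A) (haS : a ∈ S) :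
    A ⊆ S := by
  intro x hx
  have key : ∀ y, G.ConnIn (A ∪ B) a y → (y ∈ A → y ∈ S) ∧ (y ∈ B → y ∉ S) := by
    intro y hy
    induction hy with
    | refl => exact ⟨fun _ => haS, fun hb => (Set.disjoint_left.1 h.disj ha hb).elim⟩
    | @tail y z _ hyz ih =>
      obtain ⟨hyz, hy, hz⟩ := hyz
      constructor
      · intro hzA
        have hyB : y ∈ B := hy.resolve_left fun hyA => h.left y hyA z hzA hyz
        exact (hAB y hyB z hzA hyz).resolve_left (ih.2 hyB)
      · intro hzB hzS
        have hyA : y ∈ A := hy.resolve_right fun hyB => h.right y hyB z hzB hyz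
        exact hS (ih.1 hyA) hzS hyz.ne hyz
  exact (key x (h.conn a (Or.inl ha) x (Or.inl hx))).1 hx

theorem IsIndCycle.exists_fun {l : List V} (h : G.IsIndCycle l) (hn : 2 ≤ l.length) :
    ∃ r : ℕ → V, (∀ i (hi : i < l.length), r i = l[i]) ∧ r l.length = r 0 ∧
      (∀ i < l.length, ∀ j < l.length, r i = r j → i = j) ∧
      (∀ i < l.length, G.Adj (r i) (r (i + 1))) ∧
      ∀ i < l.length, ∀ j < l.length, G.Adj (r i) (r j) →
        r j = r (i + 1) ∨ r i = r (j + 1) := by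
  have hpos : 0 < l.length := by omega
  refine ⟨fun i => l[i % l.length]'(Nat.mod_lt _ hpos), ?_, ?_, ?_, ?_, ?_⟩
  · intro i hi
    simp only [Nat.mod_eq_of_lt hi]
  · simp only [Nat.mod_self, Nat.zero_mod]
  · intro i hi j hj hij
    simp only [Nat.mod_eq_of_lt hi, Nat.mod_eq_of_lt hj] at hij
    rcases lt_trichotomy i j with h1 | h1 | h1
    · exact ((h.getElem h1 hj).1 hij).elim
    · exact h1
    · exact ((h.getElem h1 hi).1 hij.symm).elim
  · intro i hi
    rcases (show i + 1 < l.length ∨ i + 1 = l.length by omega) with h1 | h1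
    · simp only [Nat.mod_eq_of_lt hi, Nat.mod_eq_of_lt h1]
      exact (h.getElem (by omega) h1).2.2 (Or.inl rfl)
    · simp only [Nat.mod_eq_of_lt hi, h1, Nat.mod_self]
      exact ((h.getElem (by omega) hi).2.2 (Or.inr ⟨rfl, h1⟩)).symm
  · intro i hi j hj hij
    simp only [Nat.mod_eq_of_lt hi, Nat.mod_eq_of_lt hj] at hij ⊢
    have key : ∀ i j (hi : i < l.length) (hj : j < l.length), i < j → G.Adj l[i] l[j] →
        l[j] = l[(i + 1) % l.length]'(Nat.mod_lt _ hpos) ∨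
        l[i] = l[(j + 1) % l.length]'(Nat.mod_lt _ hpos) := by
      intro i j hi hj h1 hij
      rcases (h.getElem h1 hj).2.1 hij with rfl | ⟨rfl, h2⟩
      · left; simp only [Nat.mod_eq_of_lt hj]
      · right; simp only [h2, Nat.mod_self]
    rcases lt_trichotomy i j with h1 | h1 | h1
    · exact key i j hi hj h1 hij
    · subst h1; exact (G.loopless.irrefl _ hij).elim
    · exact (key j i hj hi h1 hij.symm).symm

/-- Odd wheels with a bipartite hub do not occur in a t-perfect graph. -/
theorem IsTPerfect.wheel_false [Finite V] (hG : G.IsTPerfect) {Up Um : Set V}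
    (hU : G.IsHub Up Um) {a b d : V} {A B D : List V}
    (hc : G.IsIndCycle (a :: A ++ b :: B ++ d :: D))
    (hA : Even A.length) (hB : Even B.length) (hD : Even D.length)
    (hdisj : ∀ x ∈ a :: A ++ b :: B ++ d :: D, x ∉ Up ∧ x ∉ Um ∧ x ∉ G.nbrs Um)
    (ha : a ∈ G.nbrs Up) (hb : b ∈ G.nbrs Up) (hd : d ∈ G.nbrs Up) : False := by
  obtain ⟨r, hr, hrn, hinj, hadj, honly⟩ := hc.exists_fun (by simp; omega)
  set c := a :: A ++ b :: B ++ d :: D with hcdef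
  have hmem : ∀ j < c.length, r j ∈ c := fun j hj => by rw [hr j hj]; exact List.getElem_mem _
  have hlen : c.length = A.length + B.length + D.length + 3 := by simp [hcdef]; omega
  have hodd : Odd c.length := by
    rw [hlen, Nat.odd_iff]; rw [Nat.even_iff] at hA hB hD; omega
  have h0 : r 0 = a := by rw [hr 0 (by omega)]; simp [hcdef]
  have h1 : r (A.length + 1) = b := by
    rw [hr _ (by omega)]; simp [hcdef]
  have h2 : r (A.length + B.length + 2) = d := by
    rw [hr _ (by omega)]
    have : (a :: A ++ b :: B).length = A.length + B.length + 2 := by simp; omega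
    simp only [hcdef]
    rw [List.getElem_append_right (by omega)]
    simp
  obtain ⟨h, hh, hha⟩ := ha
  refine hG.rim_false hodd hrn hinj hadj honly (B := G.nbrs Up) (Hm := Um) (Hp := Up) (X := ∅)
    (fun v hv j hj => ⟨?_, ?_⟩) (fun v hv j hj => ⟨?_, ?_⟩) (by simp) (by simp) hU.right hU.left
    (by simp) (by simp) hU.disj.symm (by simp) (by simp) hh ?_ (j := A.length + 1)
    (k := A.length + B.length + 2) ?_ (by omega) (by omega) hA.add_one
    ?_ ?_ ?_
  · rintro rfl; exact (hdisj _ (hmem j hj)).2.1 hv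
  · intro hvj; exact (hdisj _ (hmem j hj)).2.2 ⟨v, hv, hvj⟩
  · rintro rfl; exact (hdisj _ (hmem j hj)).1 hv
  · intro hvj; exact ⟨v, hv, hvj⟩
  · rintro S hS halt - hhS j hj ⟨u, hu, huj⟩ hjS
    exact hS (hU.subset_of_mem hS halt hh hhS hu) hjS huj.ne huj
  · rw [h0]; exact ⟨h, hh, hha⟩
  · exact (hA.add hB).add (by decide)
  · rw [h1]; exact hb
  · rw [h2]; exact hd

/-- The variant of `wheel_false` where the third attachment goes through a vertex `u` seeing
the rim only in `s`: then the neighbours `e` and `a` of `s` on the rim act as attachments. -/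
theorem IsTPerfect.wheel_false_of_pendant [Finite V] (hG : G.IsTPerfect) {Up Um : Set V}
    (hU : G.IsHub Up Um) {a b d e s u : V} {A B D : List V}
    (hc : G.IsIndCycle (a :: A ++ b :: B ++ d :: D ++ [e, s]))
    (hA : Even A.length) (hB : Even B.length) (hD : Even D.length)
    (hdisj : ∀ x ∈ a :: A ++ b :: B ++ d :: D ++ [e, s], x ∉ Up ∧ x ∉ Um ∧ x ∉ G.nbrs Um)
    (hb : b ∈ G.nbrs Up) (hd : d ∈ G.nbrs Up) (hs : s ∉ G.nbrs Up)
    (hup : u ∉ Up) (hum : u ∉ Um) (huU : u ∈ G.nbrs Up) (hun : u ∉ G.nbrs Um)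
    (hus : G.Adj u s)
    (hu : ∀ x ∈ a :: A ++ b :: B ++ d :: D ++ [e, s], u ≠ x ∧ (G.Adj u x → x = s)) :
    False := by
  obtain ⟨r, hr, hrn, hinj, hadj, honly⟩ := hc.exists_fun (by simp; omega)
  set c := a :: A ++ b :: B ++ d :: D ++ [e, s] with hcdef
  have hmem : ∀ j < c.length, r j ∈ c := fun j hj => by rw [hr j hj]; exact List.getElem_mem _
  have hlen : c.length = A.length + B.length + D.length + 5 := by simp [hcdef]; omega
  have hlen' : (a :: A ++ b :: B ++ d :: D).length = A.length + B.length + D.length + 3 := by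
    simp; omega
  have hodd : Odd c.length := by
    rw [hlen, Nat.odd_iff]; rw [Nat.even_iff] at hA hB hD; omega
  have h0 : r 0 = a := by rw [hr 0 (by omega)]; simp [hcdef]
  have h1 : r (A.length + 1) = b := by
    rw [hr _ (by omega)]; simp [hcdef]
  have h2 : r (A.length + B.length + 2) = d := by
    rw [hr _ (by omega)]
    have : (a :: A ++ b :: B).length = A.length + B.length + 2 := by simp; omega
    simp only [hcdef]
    rw [List.getElem_append_left (by omega), List.getElem_append_right (by omega)]
    simp
  have h3 : r (c.length - 2) = e := by
    rw [hr _ (by omega)]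
    simp only [hlen]
    simp only [hcdef]
    rw [List.getElem_append_right (by omega)]
    simp only [hlen']
    simp
  have h4 : r (c.length - 1) = s := by
    rw [hr _ (by omega)]
    simp only [hlen]
    simp only [hcdef]
    rw [List.getElem_append_right (by omega)]
    simp only [hlen']
    simp
  have hsi : ∀ j < c.length, r j = s → j + 1 = c.length := by
    intro j hj hjs
    have := hinj j hj (c.length - 1) (by omega) (by rw [hjs, h4])
    omega
  obtain ⟨h, hh, hhb⟩ := hb
  -- Once `h` is in `S`, all of `Up` is, which keeps `u` out; the tight edge from `u` to `s` puts
  -- `s` into `S` and thereby excludes `a` and `e`. They may thus be treated as attachments.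
  refine hG.rim_false hodd hrn hinj hadj honly (B := G.nbrs Up ∪ {a, e}) (Hm := Um) (Hp := Up)
    (X := {u}) (fun v hv j hj => ⟨?_, ?_⟩) (fun v hv j hj => ⟨?_, ?_⟩) ?_ ?_ hU.right hU.left
    (stable_singleton u) ?_ hU.disj.symm (by simpa using hum) (by simpa using hup) hh ?_ ?_
    (j := A.length + 1)
    (k := A.length + B.length + 2) (by omega) (by omega) hA.add_one
    ?_ ?_ ?_
  · rintro rfl; exact (hdisj _ (hmem j hj)).2.1 hv
  · intro hvj; exact (hdisj _ (hmem j hj)).2.2 ⟨v, hv, hvj⟩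
  · rintro rfl; exact (hdisj _ (hmem j hj)).1 hv
  · intro hvj; exact Or.inl ⟨v, hv, hvj⟩
  · rintro v rfl j hj
    exact ⟨(hu _ (hmem j hj)).1, fun h => hsi j hj ((hu _ (hmem j hj)).2 h)⟩
  · rintro -
    refine ⟨?_, by rw [h3]; simp⟩
    rw [h4]
    rintro (h | h | h)
    · exact hs h
    · rw [← h0] at h
      have := hsi 0 (by omega) h.symm
      omega
    · rw [Set.mem_singleton_iff, ← h3] at h
      have := hsi _ (by omega) h.symm
      omega
  · rintro v hv w rfl hvw
    exact hun ⟨v, hv, hvw⟩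
  · rintro S hS halt haltX hhS j hj hjB hjS
    have hsub := hU.subset_of_mem hS halt hh hhS
    have huS : u ∉ S := by
      obtain ⟨p, hp, hpu⟩ := huU
      intro huS
      exact hS (hsub hp) huS hpu.ne hpu
    have hsS : s ∈ S := by
      have := haltX u rfl (c.length - 1) (by omega) (by rw [h4]; exact hus)
      rw [h4] at this
      exact this.resolve_left huS
    have hse : G.Adj e s := by
      have := hadj (c.length - 2) (by omega)
      rwa [show c.length - 2 + 1 = c.length - 1 by omega, h3, h4] at this
    have hsa : G.Adj s a := by
      have := hadj (c.length - 1) (by omega)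
      rwa [show c.length - 1 + 1 = c.length by omega, hrn, h4, h0] at this
    rcases hjB with ⟨v, hv, hvj⟩ | hj | hj
    · exact hS (hsub hv) hjS hvj.ne hvj
    · rw [hj] at hjS; exact hS hsS hjS hsa.ne hsa
    · rw [Set.mem_singleton_iff] at hj
      rw [hj] at hjS; exact hS hjS hsS hse.ne hse
  · rw [h0]; right; simp
  · exact (hA.add hB).add (by decide)
  · rw [h1]; exact Or.inl ⟨h, hh, hhb⟩
  · rw [h2]; exact Or.inl hd

/-- The private neighbourhood of one side of a hub is 2-colourable. -/
theorem IsHub.colOn_two [Finite V] {Up Um : Set V} (hU : G.IsHub Up Um) (hG : G.IsTPerfect) :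
    G.ColOn 2 (G.nbrs Up \ (Up ∪ Um ∪ G.nbrs Um)) := by
  by_contra h
  obtain ⟨c, hc, hodd, h3, hsub⟩ := exists_odd_isIndCycle h
  -- All vertices of the cycle are attached to `Up`, so any three consecutive ones serve; two arcs
  -- have empty interior.
  match c, h3 with
  | a :: b :: d :: D, _ =>
    refine hG.wheel_false hU (A := []) (B := []) (D := D) hc (by simp) (by simp) ?_ ?_
      (hsub a (by simp)).1 (hsub b (by simp)).1 (hsub d (by simp)).1
    · simp only [List.length_cons] at hodd
      rw [Nat.odd_iff] at hodd; rw [Nat.even_iff]; omega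
    · intro x hx
      have := (hsub x hx).2
      simp only [Set.mem_union, not_or] at this
      tauto

/-- Each of the two colour classes of the private neighbourhood of `Up` can be added to `Um`, giving
a new hub. The remote vertices seeing that class lie in the private neighbourhood of the enlarged
side, which takes two colours. -/
theorem IsHub.colOn_four [Finite V] {Up Um : Set V} (hU : G.IsHub Up Um) (hG : G.IsTPerfect) :
    G.ColOn 4 {v | v ∉ Up ∧ v ∉ Um ∧ v ∉ G.nbrs Up ∧ v ∉ G.nbrs Um ∧
      ∃ d, d ∉ Up ∧ d ∉ Um ∧ G.Adj d v ∧ d ∈ G.nbrs Up ∧ d ∉ G.nbrs Um} := by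
  have key : ∀ A : Set V, G.Stable A → A ⊆ G.nbrs Up \ (Up ∪ Um ∪ G.nbrs Um) →
      G.ColOn 2 {v | v ∉ Up ∧ v ∉ Um ∧ v ∉ G.nbrs Up ∧ ∃ d ∈ A, G.Adj d v} := by
    intro A hA hAs
    have hH : G.IsHub (Um ∪ A) Up := by
      refine ⟨?_, hU.left, ?_, ?_⟩
      · rintro u (hu | hu) v (hv | hv) huv
        · exact hU.right u hu v hv huv
        · exact (hAs hv).2 (Or.inr ⟨u, hu, huv⟩)
        · exact (hAs hu).2 (Or.inr ⟨v, hv, huv.symm⟩)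
        · exact hA u hu v hv huv
      · rw [Set.disjoint_left]
        rintro u (hu | hu) hup
        · exact Set.disjoint_left.1 hU.disj hup hu
        · exact (hAs hu).2 (Or.inl (Or.inl hup))
      · have := hU.conn.union_of_adj (B := A) fun b hb => by
          obtain ⟨a, ha, hab⟩ := (hAs hb).1
          exact ⟨a, Or.inl ha, hab⟩
        rwa [Set.union_comm Up, Set.union_assoc, Set.union_comm Up, ← Set.union_assoc] at this
    refine (hH.colOn_two hG).subset ?_
    rintro v ⟨h1, h2, h3, d, hd, hdv⟩
    refine ⟨⟨d, Or.inr hd, hdv⟩, ?_⟩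
    rintro (((h | h) | h) | h)
    · exact h2 h
    · exact h3 (hAs h).1
    · exact h1 h
    · exact h3 h
  obtain ⟨A₁, A₂, hA, h1, h2, -⟩ := (hU.colOn_two hG).of_two
  refine ((key A₁ h1 (by rw [hA]; exact Set.subset_union_left)).union
    (key A₂ h2 (by rw [hA]; exact Set.subset_union_right))).subset ?_
  rintro v ⟨h3, h4, h5, h6, d, h7, h8, h9, h10, h11⟩
  have hd : d ∈ A₁ ∪ A₂ := by
    rw [← hA]
    refine ⟨h10, ?_⟩
    rintro ((h | h) | h) <;> tauto
  rcases hd with hd | hd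
  · exact Or.inl ⟨h3, h4, h5, d, hd, h9⟩
  · exact Or.inr ⟨h3, h4, h5, d, hd, h9⟩

/-- The vertices away from a hub with a neighbour seeing exactly one side of the hub. -/
theorem IsHub.colOn_eight [Finite V] {Up Um : Set V} (hU : G.IsHub Up Um) (hG : G.IsTPerfect) :
    G.ColOn 8 {v | v ∉ Up ∧ v ∉ Um ∧ v ∉ G.nbrs Up ∧ v ∉ G.nbrs Um ∧
      ∃ d, d ∉ Up ∧ d ∉ Um ∧ G.Adj d v ∧ ¬ (d ∈ G.nbrs Up ↔ d ∈ G.nbrs Um)} := by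
  refine ((hU.colOn_four hG).union (hU.symm.colOn_four hG)).subset ?_
  rintro v ⟨h1, h2, h3, h4, d, h5, h6, h7, h8⟩
  by_cases h9 : d ∈ G.nbrs Up
  · exact Or.inl ⟨h1, h2, h3, h4, d, h5, h6, h7, h9, fun h => h8 ⟨fun _ => h, fun _ => h9⟩⟩
  · refine Or.inr ⟨h2, h1, h4, h3, d, h6, h5, h7, ?_, h9⟩
    by_contra h
    exact h8 ⟨fun h' => (h9 h').elim, fun h' => (h h').elim⟩

theorem isHub_nbrs_singleton (htri : G.CliqueFree 3) (y : V) : G.IsHub (G.nbrs {y}) {y} := by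
  refine ⟨stable_nbrs_singleton htri y, stable_singleton y, ?_, ?_⟩
  · rw [Set.disjoint_singleton_right, mem_nbrs_singleton]
    exact G.loopless.irrefl y
  · rw [Set.union_comm]
    exact (connSet_singleton y).union_of_adj fun b hb => hb

theorem ColOn.insert_of_not_mem_nbrs {k : ℕ} {A : Set V} {y : V} (h : G.ColOn k A) (hk : 0 < k)
    (hy : ∀ x ∈ A, ¬ G.Adj y x) : G.ColOn k (insert y A) := by
  classical
  obtain ⟨c, h1, h2⟩ := h
  refine ⟨fun v => if v ∈ A then c v else 0, fun v _ => ?_, ?_⟩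
  · dsimp only
    split_ifs with hv
    · exact h1 v hv
    · exact hk
  · intro u hu v hv huv
    have huA : u ∈ A := by
      rcases hu with rfl | hu
      · rcases hv with rfl | hv
        · exact (G.loopless.irrefl _ huv).elim
        · exact (hy v hv huv).elim
      · exact hu
    have hvA : v ∈ A := by
      rcases hv with rfl | hv
      · exact (hy u huA huv.symm).elim
      · exact hv
    simp only [huA, hvA, if_true]
    exact h2 u huA v hvA huv

/-- The hub is the star at `y`. The vertex `y` itself may belong to the set but sees nothing else in
it, so it needs no extra colour. -/
theorem colOn_nbrs_nbrs [Finite V] (hG : G.IsTPerfect) (htri : G.CliqueFree 3) (y : V) :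
    G.ColOn 2 (G.nbrs (G.nbrs {y})) := by
  refine (((isHub_nbrs_singleton htri y).colOn_two hG).insert_of_not_mem_nbrs (y := y)
    (by omega) ?_).subset ?_
  · rintro x ⟨-, hx⟩ hyx
    exact hx (Or.inr (mem_nbrs_singleton.2 hyx))
  · intro v hv
    by_cases hvy : v = y
    · exact Or.inl hvy
    · right
      refine ⟨hv, ?_⟩
      have : v ∉ G.nbrs {y} := by
        intro h
        obtain ⟨w, hw, hwv⟩ := hv
        exact stable_nbrs_singleton htri y w hw v h hwv
      rintro ((h | h) | h)
      · exact this h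
      · exact hvy h
      · exact this h

/-- For the star at `y`, vertices outside the first two neighbourhoods fall under
`IsHub.colOn_four`; the other colours are two for the second neighbourhood and one for the first. -/
theorem colOn_nbrs_nbrs_nbrs [Finite V] (hG : G.IsTPerfect) (htri : G.CliqueFree 3) (y : V) :
    G.ColOn 7 (G.nbrs (G.nbrs (G.nbrs {y}))) := by
  have h := ((isHub_nbrs_singleton htri y).colOn_four hG).union
    ((colOn_nbrs_nbrs hG htri y).union (colOn_nbrs_singleton htri y))
  refine h.subset ?_
  intro v hv
  by_cases h1 : v ∈ G.nbrs {y}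
  · exact Or.inr (Or.inr h1)
  by_cases h2 : v ∈ G.nbrs (G.nbrs {y})
  · exact Or.inr (Or.inl h2)
  left
  obtain ⟨d, hd, hdv⟩ := hv
  have hdn : d ∉ G.nbrs {y} := fun h => h2 ⟨d, h, hdv⟩
  refine ⟨h1, ?_, h2, h1, d, hdn, ?_, hdv, hd, hdn⟩
  · rintro rfl
    obtain ⟨w, hw, -⟩ := hd
    exact h2 ⟨w, hw, (mem_nbrs_singleton.1 hw).symm⟩
  · rintro rfl
    exact h1 (mem_nbrs_singleton.2 hdv)

/-! ### Levellings -/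

/-- A breadth-first levelling `l` of the vertex set `H` with root `z`. -/
structure IsLevelling (G : SimpleGraph V) (H : Set V) (z : V) (l : V → ℕ) : Prop where
  root_mem : z ∈ H
  eq_zero_iff : ∀ v ∈ H, l v = 0 ↔ v = z
  le_succ : ∀ u ∈ H, ∀ v ∈ H, G.Adj u v → l u ≤ l v + 1
  exists_parent : ∀ v ∈ H, 0 < l v → ∃ u ∈ H, G.Adj u v ∧ l u + 1 = l v

theorem ConnSet.exists_isLevelling {H : Set V} (hH : G.ConnSet H) {z : V} (hz : z ∈ H) :
    ∃ l, G.IsLevelling H z l := by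
  obtain ⟨R, hR0, hRs⟩ : ∃ R : ℕ → Set V, R 0 = {z} ∧
      ∀ n, R (n + 1) = {v | v ∈ H ∧ ∃ u ∈ R n, G.Adj u v} :=
    ⟨fun n => Nat.rec (motive := fun _ => Set V) {z}
      (fun _ S => {v | v ∈ H ∧ ∃ u ∈ S, G.Adj u v}) n, rfl, fun n => rfl⟩
  have hR : ∀ n, R n ⊆ H := by
    intro n
    cases n with
    | zero => rw [hR0]; rintro x rfl; exact hz
    | succ n => rw [hRs]; exact fun x hx => hx.1
  have hex : ∀ v ∈ H, ∃ n, v ∈ R n := by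
    intro v hv
    have := hH z hz v hv
    clear hv
    induction this with
    | refl => exact ⟨0, by rw [hR0]; rfl⟩
    | tail _ h ih =>
      obtain ⟨n, hn⟩ := ih
      exact ⟨n + 1, by rw [hRs]; exact ⟨h.2.2, _, hn, h.1⟩⟩
  obtain ⟨l, hmem, hle⟩ : ∃ l : V → ℕ, (∀ v ∈ H, v ∈ R (l v)) ∧ ∀ v n, v ∈ R n → l v ≤ n :=
    ⟨fun v => sInf {n | v ∈ R n}, fun v hv => Nat.sInf_mem (hex v hv), fun v n h => Nat.sInf_le h⟩
  have hstep : ∀ u ∈ H, ∀ v ∈ H, G.Adj u v → l u ≤ l v + 1 := by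
    intro u hu v hv huv
    exact hle u _ (by rw [hRs]; exact ⟨hu, v, hmem v hv, huv.symm⟩)
  refine ⟨l, hz, fun v hv => ⟨fun h => ?_, ?_⟩, hstep, ?_⟩
  · have := hmem v hv
    rw [h, hR0] at this
    exact this
  · rintro rfl
    exact Nat.le_zero.1 (hle v 0 (by rw [hR0]; rfl))
  · intro v hv h0
    have h1 := hmem v hv
    obtain ⟨k, hk⟩ : ∃ k, l v = k + 1 := ⟨l v - 1, by omega⟩
    rw [hk, hRs] at h1
    obtain ⟨-, u, hu, huv⟩ := h1
    have h2 := hle u k hu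
    have h3 := hstep v hv u (hR k hu) huv.symm
    exact ⟨u, hR k hu, huv, by omega⟩

theorem IsLevelling.connIn {H : Set V} {z : V} {l : V → ℕ} (h : G.IsLevelling H z l) {v : V}
    (hv : v ∈ H) : G.ConnIn ({v} ∪ {u | u ∈ H ∧ l u < l v}) v z := by
  induction hn : l v using Nat.strong_induction_on generalizing v with
  | _ n ih =>
    rcases Nat.eq_zero_or_pos (l v) with h0 | h0
    · rw [(h.eq_zero_iff v hv).1 h0]; exact ConnIn.refl _
    · obtain ⟨u, hu, huv, hl⟩ := h.exists_parent v hv h0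
      refine (ConnIn.single huv.symm (Or.inl rfl) (Or.inr ⟨hu, by omega⟩)).trans
        ((ih (l u) (by omega) hu rfl).mono ?_)
      rintro x (rfl | ⟨hx, hx'⟩)
      · exact Or.inr ⟨hu, by omega⟩
      · exact Or.inr ⟨hx, by omega⟩

theorem isIndPath_cons_cons {a b : V} {l : List V} : G.IsIndPath (a :: b :: l) ↔
    G.Adj a b ∧ (∀ c ∈ l, c ≠ a ∧ ¬ G.Adj a c) ∧ G.IsIndPath (b :: l) := by
  constructor
  · rintro ⟨h1, h2, h3⟩
    refine ⟨by simpa using h2 b (by simp), fun c hc => ⟨?_, fun hac => ?_⟩, h3⟩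
    · rintro rfl; exact h1 (by simp [hc])
    · have := (h2 c (by simp [hc])).1 hac
      simp only [List.head?_cons, Option.some.injEq] at this
      subst this
      exact h3.1 hc
  · rintro ⟨h1, h2, h3⟩
    exact h3.cons_of_last h1 (fun h => (h2 a h).1 rfl) fun c hc => (h2 c hc).2

/-- A path descending from the root of a levelling to `v`, to be extended above `v`. -/
theorem IsLevelling.exists_path {H : Set V} {z : V} {l : V → ℕ} (h : G.IsLevelling H z l) {v : V}
    (hv : v ∈ H) : ∃ L : List V, L.length = l v ∧ (L ++ [v]).head? = some z ∧
      (∀ x ∈ L, x ∈ H ∧ l x < l v) ∧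
      ∀ E, G.IsIndPath (v :: E) → (∀ y ∈ E, y ∈ H ∧ l v < l y) → G.IsIndPath (L ++ v :: E) := by
  induction hn : l v generalizing v with
  | zero =>
    refine ⟨[], by simp, by simp [(h.eq_zero_iff v hv).1 hn], by simp, ?_⟩
    intro E hE _
    simpa using hE
  | succ n ih =>
    obtain ⟨u, hu, huv, hl⟩ := h.exists_parent v hv (by omega)
    obtain ⟨L, h1, h2, h3, h4⟩ := ih hu (by omega)
    refine ⟨L ++ [u], by simp [h1], ?_, ?_, ?_⟩
    · rw [List.head?_append, h2]; rfl
    · intro x hx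
      rcases List.mem_append.1 hx with hx | hx
      · exact ⟨(h3 x hx).1, by have := (h3 x hx).2; omega⟩
      · rw [List.mem_singleton] at hx
        subst hx
        exact ⟨hu, by omega⟩
    · intro E hE hlE
      rw [List.append_assoc]
      refine h4 (v :: E) (isIndPath_cons_cons.2 ⟨huv, fun c hc => ?_, hE⟩) ?_
      · obtain ⟨hc1, hc2⟩ := hlE c hc
        refine ⟨by rintro rfl; omega, fun huc => ?_⟩
        have := h.le_succ c hc1 u hu huc.symm
        omega
      · intro y hy
        rcases List.mem_cons.1 hy with rfl | hy
        · exact ⟨hv, by omega⟩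
        · exact ⟨(hlE y hy).1, by have := (hlE y hy).2; omega⟩

/-- Deleting a set `D` of few colours that meets the connected set `K` leaves a component `C` of
many colours together with a vertex of `D ∩ K` attached to it. -/
theorem ConnSet.exists_component_diff {K D : Set V} (hK : G.ConnSet K) {k d : ℕ}
    (hbig : ¬ G.ColOn (k + d) K) (hD : G.ColOn d D) {x : V} (hx : x ∈ K) (hxD : x ∈ D) :
    ∃ C ⊆ K \ D, G.ConnSet C ∧ ¬ G.ColOn k C ∧ ∃ w ∈ K, w ∈ D ∧ ∃ s ∈ C, G.Adj w s := by
  obtain ⟨C, h1, h2, h3, h4⟩ := exists_component_of_not_colOn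
    (fun h => hbig (h.of_diff hD) : ¬ G.ColOn k (K \ D))
  refine ⟨C, h1, h2, h3, ?_⟩
  by_contra hc
  push Not at hc
  obtain ⟨s, hs⟩ := exists_mem_of_not_colOn h3
  have := (hK s (h1 hs).1 x hx).mem_of_closed (B := C) hs fun u hu v hv huv => by
    by_cases hvD : v ∈ D
    · exact (hc v hv hvD u hu huv.symm).elim
    · exact h4 u hu v ⟨hv, hvD⟩ huv
  exact (h1 this).2 hxD

/-! ### Parity gadgets -/

/-- Work in a level `j` of large chromatic number of a breadth-first search from `q`. Deleting the
vertices two steps above a vertex `c` of level `j - 2` leaves a component `K₂` attached to a deleted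
vertex `w`. A neighbour `s₁` of `w` in `K₂` has a parent `a'` that is not adjacent to `c`. Descents
through `c` and through `a'` differ in length by one, and both extend to a common vertex `u`, after
a further deletion that protects the rest from the routes. The routes avoid chords because the
deleted neighbourhoods contain every vertex that could cause one. -/
theorem exists_parity_gadget [Finite V] (hG : G.IsTPerfect) (htri : G.CliqueFree 3) {K : Set V} {q : V}
    {k : ℕ} (hK : G.ConnSet K) (hqK : q ∉ K) (hq : ∃ s ∈ K, G.Adj q s)
    (hbig : ¬ G.ColOn (2 * (k + 5)) K) :
    ∃ u ∈ K, ∃ K' ⊆ K, G.ConnSet K' ∧ ¬ G.ColOn k K' ∧ u ∉ K' ∧ (∃ s ∈ K', G.Adj u s) ∧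
      ∀ p : ℕ, ∃ L : List V, G.IsIndPath (L ++ [u]) ∧ (L ++ [u]).head? = some q ∧
        (∀ x ∈ L, x ∈ insert q K ∧ x ∉ K' ∧ ∀ s ∈ K', ¬ G.Adj x s) ∧ L.length % 2 = p % 2 := by
  have hH : G.ConnSet (insert q K) := by
    obtain ⟨s, hs, hqs⟩ := hq
    exact hK.insert hs hqs.symm
  obtain ⟨l, hl⟩ := hH.exists_isLevelling (Set.mem_insert q K)
  have hsub : K ⊆ insert q K := Set.subset_insert q K
  obtain ⟨j, hj⟩ : ∃ j, ¬ G.ColOn (k + 5) {v | v ∈ K ∧ l v = j} := by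
    by_contra h
    push Not at h
    exact hbig (ColOn.of_levels l (fun u hu v hv => hl.le_succ u (hsub hu) v (hsub hv)) h)
  -- Levels up to 1 lie in the neighbourhood of `q` once `q` itself is excluded, and this is stable.
  have hj2 : 2 ≤ j := by
    by_contra h
    refine hj ((colOn_nbrs_singleton htri q).mono (by omega) ?_)
    rintro v ⟨hv, hvj⟩
    have h0 : l v ≠ 0 := fun h0 => hqK ((hl.eq_zero_iff v (hsub hv)).1 h0 ▸ hv)
    obtain ⟨u, hu, huv, hlu⟩ := hl.exists_parent v (hsub hv) (by omega)
    rw [(hl.eq_zero_iff u hu).1 (by omega)] at huv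
    exact mem_nbrs_singleton.2 huv
  obtain ⟨K₁, h11, h12, h13, -⟩ := exists_component_of_not_colOn hj
  obtain ⟨w₀, hw₀⟩ := exists_mem_of_not_colOn h13
  obtain ⟨a₁, ha₁, ha₁w, hla₁⟩ := hl.exists_parent w₀ (hsub (h11 hw₀).1)
    (by have := (h11 hw₀).2; omega)
  obtain ⟨c, hc, hca₁, hlc⟩ := hl.exists_parent a₁ ha₁ (by have := (h11 hw₀).2; omega)
  have hlc' : l c + 2 = j := by have := (h11 hw₀).2; omega
  -- The deleted set lies in a second neighbourhood of `c`, hence the two colours. The vertex `w`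
  -- reaches `c` through `a₀`, whereas no vertex of `K₂` has a parent adjacent to `c`.
  obtain ⟨K₂, h21, h22, h23, w, hw, ⟨a₀, ⟨ha₀, hla₀, hca₀⟩, ha₀w⟩, s₁, hs₁, hws₁⟩ :=
    h12.exists_component_diff (k := k + 3) (d := 2) h13
    (D := G.nbrs {a | a ∈ insert q K ∧ l a + 1 = j ∧ G.Adj c a})
    ((colOn_nbrs_nbrs hG htri c).subset (nbrs_mono fun a ha => mem_nbrs_singleton.2 ha.2.2))
    hw₀ ⟨a₁, ⟨ha₁, by omega, hca₁⟩, ha₁w⟩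
  have hK₂ : ∀ x ∈ K₂, x ∈ K ∧ l x = j ∧ ∀ a ∈ insert q K, l a + 1 = j → G.Adj c a → ¬ G.Adj a x := by
    intro x hx
    have := h21 hx
    exact ⟨(h11 this.1).1, (h11 this.1).2, fun a ha hla hca hax => this.2 ⟨a, ⟨ha, hla, hca⟩, hax⟩⟩
  obtain ⟨a', ha', ha's₁, hla'⟩ := hl.exists_parent s₁ (hsub (hK₂ s₁ hs₁).1)
    (by have := (hK₂ s₁ hs₁).2.1; omega)
  have hlw : l w = j := (h11 hw).2
  have hls₁ : l s₁ = j := (hK₂ s₁ hs₁).2.1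
  have hca' : ¬ G.Adj c a' := fun h => (hK₂ s₁ hs₁).2.2 a' ha' (by omega) h ha's₁
  have ha'w : ¬ G.Adj a' w := htri.not_adj ha's₁.symm hws₁.symm
  -- Deleting the neighbours of `a'`, `s₁` and `w`, one colour each, leaves nothing for the routes
  -- to see. By its choice `u` is adjacent to at least one of the three.
  obtain ⟨K₃, h31, h32, h33, u, hu, hu', s₂, hs₂, hus₂⟩ :=
    h22.exists_component_diff (k := k) (d := 3) h23 (D := G.nbrs {a'} ∪ (G.nbrs {s₁} ∪ G.nbrs {w}))
    (((colOn_nbrs_singleton htri a').union ((colOn_nbrs_singleton htri s₁).union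
      (colOn_nbrs_singleton htri w))).mono (by omega) subset_rfl) hs₁
    (Or.inl (mem_nbrs_singleton.2 ha's₁))
  obtain ⟨hwK, -⟩ := h11 hw
  obtain ⟨huK, hlu, huA⟩ := hK₂ u hu
  have ha₀u := huA a₀ ha₀ hla₀ hca₀
  have ha₀s₁ := (hK₂ s₁ hs₁).2.2 a₀ ha₀ hla₀ hca₀
  have hwu : w ≠ u := by
    rintro rfl
    exact ha₀u ha₀w
  have hlow : ∀ x ∈ insert q K, l x + 1 < j → ∀ s ∈ K₃, ¬ G.Adj x s := by
    intro x hx hlx s hs hxs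
    have h1 := hK₂ s (h31 hs).1
    have := hl.le_succ s (hsub h1.1) x hx hxs.symm
    omega
  have hne : ∀ x, l x < j → x ∉ K₃ := by
    intro x hlx hx
    have h1 := hK₂ x (h31 hx).1
    omega
  have hmem₃ : ∀ s ∈ K₃, ¬ G.Adj a' s ∧ ¬ G.Adj s₁ s ∧ ¬ G.Adj w s ∧ ¬ G.Adj a₀ s ∧ w ≠ s ∧
      s₁ ≠ s := by
    intro s hs
    have h1 := (h31 hs).2
    have h2 := (hK₂ s (h31 hs).1).2.2 a₀ ha₀ hla₀ hca₀
    simp only [Set.mem_union, mem_nbrs_singleton, not_or] at h1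
    refine ⟨h1.1, h1.2.1, h1.2.2, h2, ?_, ?_⟩
    · rintro rfl; exact h2 ha₀w
    · rintro rfl; exact h1.1 ha's₁
  have hlu_u : u ∉ K₃ := by
    intro h
    exact (h31 h).2 hu'
  have hwK₃ : w ∉ K₃ := fun h => (hmem₃ w h).2.2.2.2.1 rfl
  have hs₁K₃ : s₁ ∉ K₃ := fun h => (hmem₃ s₁ h).2.2.2.2.2 rfl
  obtain ⟨Lc, hLc1, hLc2, hLc3, hLc4⟩ := hl.exists_path hc
  obtain ⟨La, hLa1, hLa2, hLa3, hLa4⟩ := hl.exists_path ha'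
  -- paths starting with the descent to `c` or to `a'`
  have goodc : ∀ E : List V, G.IsIndPath (c :: E ++ [u]) →
      (∀ y ∈ E, y ∈ insert q K ∧ l c < l y ∧ y ∉ K₃ ∧ ∀ s ∈ K₃, ¬ G.Adj y s) →
      ∃ L : List V, G.IsIndPath (L ++ [u]) ∧ (L ++ [u]).head? = some q ∧
        (∀ x ∈ L, x ∈ insert q K ∧ x ∉ K₃ ∧ ∀ s ∈ K₃, ¬ G.Adj x s) ∧
        L.length = j - 1 + E.length := by
    intro E hE hE'
    refine ⟨Lc ++ c :: E, ?_, ?_, ?_, ?_⟩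
    · have := hLc4 (E ++ [u]) hE ?_
      · simpa using this
      · intro y hy
        rcases List.mem_append.1 hy with hy | hy
        · exact ⟨(hE' y hy).1, (hE' y hy).2.1⟩
        · rw [List.mem_singleton] at hy
          subst hy
          exact ⟨hsub huK, by omega⟩
    · rw [show Lc ++ c :: E ++ [u] = (Lc ++ [c]) ++ (E ++ [u]) by simp, List.head?_append, hLc2]
      rfl
    · intro x hx
      simp only [List.mem_append, List.mem_cons] at hx
      rcases hx with hx | rfl | hx
      · have := hLc3 x hx
        exact ⟨this.1, hne x (by omega), hlow x this.1 (by omega)⟩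
      · exact ⟨hc, hne x (by omega), hlow x hc (by omega)⟩
      · exact ⟨(hE' x hx).1, (hE' x hx).2.2⟩
    · simp; omega
  have gooda : ∀ E : List V, G.IsIndPath (a' :: E ++ [u]) →
      (∀ y ∈ E, y ∈ insert q K ∧ l a' < l y ∧ y ∉ K₃ ∧ ∀ s ∈ K₃, ¬ G.Adj y s) →
      ∃ L : List V, G.IsIndPath (L ++ [u]) ∧ (L ++ [u]).head? = some q ∧
        (∀ x ∈ L, x ∈ insert q K ∧ x ∉ K₃ ∧ ∀ s ∈ K₃, ¬ G.Adj x s) ∧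
        L.length = j + E.length := by
    intro E hE hE'
    refine ⟨La ++ a' :: E, ?_, ?_, ?_, ?_⟩
    · have := hLa4 (E ++ [u]) hE ?_
      · simpa using this
      · intro y hy
        rcases List.mem_append.1 hy with hy | hy
        · exact ⟨(hE' y hy).1, (hE' y hy).2.1⟩
        · rw [List.mem_singleton] at hy
          subst hy
          exact ⟨hsub huK, by omega⟩
    · rw [show La ++ a' :: E ++ [u] = (La ++ [a']) ++ (E ++ [u]) by simp, List.head?_append, hLa2]
      rfl
    · intro x hx
      simp only [List.mem_append, List.mem_cons] at hx
      rcases hx with hx | rfl | hx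
      · have := hLa3 x hx
        exact ⟨this.1, hne x (by omega), hlow x this.1 (by omega)⟩
      · exact ⟨ha', hne x (by omega), fun s hs => (hmem₃ s hs).1⟩
      · exact ⟨(hE' x hx).1, (hE' x hx).2.2⟩
    · simp; omega
  have hcw : ¬ G.Adj c w := fun h => by
    have := hl.le_succ w (hsub hwK) c hc h.symm; omega
  have hcu : ¬ G.Adj c u := fun h => by
    have := hl.le_succ u (hsub huK) c hc h.symm; omega
  have hcs₁ : ¬ G.Adj c s₁ := fun h => by
    have := hl.le_succ s₁ (hsub (hK₂ s₁ hs₁).1) c hc h.symm; omega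
  have nlev : ∀ {x y : V}, l x < l y → y ≠ x := by rintro x y h rfl; omega
  have fw : w ∈ insert q K ∧ l c < l w ∧ w ∉ K₃ ∧ ∀ s ∈ K₃, ¬ G.Adj w s :=
    ⟨hsub hwK, by omega, hwK₃, fun s hs => (hmem₃ s hs).2.2.1⟩
  have fs₁ : s₁ ∈ insert q K ∧ l c < l s₁ ∧ s₁ ∉ K₃ ∧ ∀ s ∈ K₃, ¬ G.Adj s₁ s :=
    ⟨hsub (hK₂ s₁ hs₁).1, by omega, hs₁K₃, fun s hs => (hmem₃ s hs).2.1⟩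
  have fa₀ : a₀ ∈ insert q K ∧ l c < l a₀ ∧ a₀ ∉ K₃ ∧ ∀ s ∈ K₃, ¬ G.Adj a₀ s :=
    ⟨ha₀, by omega, hne _ (by omega), fun s hs => (hmem₃ s hs).2.2.2.1⟩
  have fa' : a' ∈ insert q K ∧ l c < l a' ∧ a' ∉ K₃ ∧ ∀ s ∈ K₃, ¬ G.Adj a' s :=
    ⟨ha', by omega, hne _ (by omega), fun s hs => (hmem₃ s hs).1⟩
  have gw : w ∈ insert q K ∧ l a' < l w ∧ w ∉ K₃ ∧ ∀ s ∈ K₃, ¬ G.Adj w s :=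
    ⟨hsub hwK, by omega, hwK₃, fun s hs => (hmem₃ s hs).2.2.1⟩
  have gs₁ : s₁ ∈ insert q K ∧ l a' < l s₁ ∧ s₁ ∉ K₃ ∧ ∀ s ∈ K₃, ¬ G.Adj s₁ s :=
    ⟨hsub (hK₂ s₁ hs₁).1, by omega, hs₁K₃, fun s hs => (hmem₃ s hs).2.1⟩
  have n1 : a₀ ≠ c := nlev (by omega)
  have n2 : w ≠ c := nlev (by omega)
  have n3 : u ≠ c := nlev (by omega)
  have n4 : w ≠ a₀ := nlev (by omega)
  have n5 : u ≠ a₀ := nlev (by omega)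
  have n6 : a' ≠ c := nlev (by omega)
  have n7 : w ≠ a' := nlev (by omega)
  have n8 : u ≠ a' := nlev (by omega)
  have n9 : s₁ ≠ a' := nlev (by omega)
  have n10 : s₁ ≠ c := nlev (by omega)
  have n11 : s₁ ≠ a₀ := nlev (by omega)
  have n12 : a' ≠ a₀ := fun h => ha'w (h ▸ ha₀w)
  refine ⟨u, huK, K₃, fun x hx => (hK₂ x (h31 hx).1).1, h32, h33, hlu_u, ⟨s₂, hs₂, hus₂⟩, ?_⟩
  -- it suffices to find two such paths of different parity
  suffices h : ∃ L L' : List V, L'.length % 2 ≠ L.length % 2 ∧ ∀ M ∈ [L, L'],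
      G.IsIndPath (M ++ [u]) ∧ (M ++ [u]).head? = some q ∧
        (∀ x ∈ M, x ∈ insert q K ∧ x ∉ K₃ ∧ ∀ s ∈ K₃, ¬ G.Adj x s) by
    obtain ⟨L, L', hLL, hM⟩ := h
    intro p
    have h1 := hM L (by simp)
    have h2 := hM L' (by simp)
    by_cases hp : L.length % 2 = p % 2
    · exact ⟨L, h1.1, h1.2.1, h1.2.2, hp⟩
    · exact ⟨L', h2.1, h2.2.1, h2.2.2, by omega⟩
  -- A descent through `a'` contributes `j` vertices, one through `c` only `j - 1`; with
  -- continuations of equal parity the two routes have opposite parity.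
  have combine : ∀ E E' : List V, G.IsIndPath (a' :: E ++ [u]) → G.IsIndPath (c :: E' ++ [u]) →
      (∀ y ∈ E, y = w ∨ y = s₁) → (∀ y ∈ E', y = w ∨ y = s₁ ∨ y = a₀ ∨ y = a') →
      E.length % 2 = E'.length % 2 → ∃ L L' : List V, L'.length % 2 ≠ L.length % 2 ∧
      ∀ M ∈ [L, L'], G.IsIndPath (M ++ [u]) ∧ (M ++ [u]).head? = some q ∧
        (∀ x ∈ M, x ∈ insert q K ∧ x ∉ K₃ ∧ ∀ s ∈ K₃, ¬ G.Adj x s) := by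
    intro E E' h1 h2 h3 h4 h5
    obtain ⟨L, hL1, hL2, hL3, hL4⟩ := gooda E h1 fun y hy => by
      rcases h3 y hy with rfl | rfl
      exacts [gw, gs₁]
    obtain ⟨L', hL1', hL2', hL3', hL4'⟩ := goodc E' h2 fun y hy => by
      rcases h4 y hy with rfl | rfl | rfl | rfl
      exacts [fw, fs₁, fa₀, fa']
    refine ⟨L, L', by omega, fun M hM => ?_⟩
    simp only [List.mem_cons, List.not_mem_nil, or_false] at hM
    rcases hM with rfl | rfl
    exacts [⟨hL1, hL2, hL3⟩, ⟨hL1', hL2', hL3'⟩]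
  -- A case distinction on which of `a'`, `s₁`, `w` see `u`, with explicit continuations in each
  -- case.
  by_cases hua : G.Adj a' u
  · by_cases huw : G.Adj w u
    · refine combine [] [a₀, w] ?_ ?_ (by simp) (by simp) (by simp)
      · simp [isIndPath_cons_cons, hua]
      · simp [isIndPath_cons_cons, *]
    · by_cases ha'a₀ : G.Adj a₀ a'
      · refine combine [] [a₀, a'] ?_ ?_ (by simp) (by simp) (by simp)
        · simp [isIndPath_cons_cons, hua]
        · simp [isIndPath_cons_cons, *]
      · have n13 : u ≠ s₁ := by rintro rfl; exact huw hws₁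
        have hs₁u : ¬ G.Adj s₁ u := htri.not_adj ha's₁ hua
        have ha'w' : ¬ G.Adj w a' := fun h => ha'w h.symm
        refine combine [] [a₀, w, s₁, a'] ?_ ?_ (by simp) (by simp) (by simp)
        · simp [isIndPath_cons_cons, hua]
        · simp [isIndPath_cons_cons, *, ha's₁.symm, n7.symm, hwu.symm]
  · by_cases hus : G.Adj s₁ u
    · have hwu' : ¬ G.Adj w u := htri.not_adj hws₁.symm hus
      refine combine [s₁] [a₀, w, s₁] ?_ ?_ (by simp) (by simp) (by simp)
      · simp [isIndPath_cons_cons, *]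
      · simp [isIndPath_cons_cons, *, hwu.symm]
    · have huw : G.Adj w u := by
        simp only [Set.mem_union, mem_nbrs_singleton] at hu'
        tauto
      have n13 : u ≠ s₁ := by rintro rfl; exact hua ha's₁
      refine combine [s₁, w] [a₀, w] ?_ ?_ (by simp) (by simp) (by simp)
      · simp [isIndPath_cons_cons, *, hws₁.symm]
      · simp [isIndPath_cons_cons, *]

/-! ### Ropes: chains of parity gadgets -/

theorem IsIndPath.join {l E : List V} {b : V} (h₁ : G.IsIndPath (l ++ [b]))
    (h₂ : G.IsIndPath (b :: E)) (h : ∀ x ∈ l, ∀ y ∈ E, x ≠ y ∧ ¬ G.Adj x y) :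
    G.IsIndPath (l ++ b :: E) := by
  refine h₁.left.append h₂ fun x hx y hy => ?_
  have h₃ := (isIndPath_append.1 h₁).2.2 x hx
  rcases List.mem_cons.1 hy with rfl | hy
  · simpa using h₃ y (by simp)
  · refine ⟨(h x hx y hy).1, ⟨fun hxy => ((h x hx y hy).2 hxy).elim, ?_⟩⟩
    rintro ⟨-, hb⟩
    simp only [List.head?_cons, Option.some.injEq] at hb
    exact (h₂.1 (hb ▸ hy)).elim

/-- First delete `Z`, then run the gadget inside a component of what remains. A fixed induced path
from `q` to the first vertex touching that component is put in front; its length only shifts the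
parity to be requested. -/
theorem exists_parity_stage [Finite V] (hG : G.IsTPerfect) (htri : G.CliqueFree 3) {K Z : Set V} {q : V}
    {k z : ℕ} (hK : G.ConnSet K) (hqK : q ∉ K) (hq : ∃ s ∈ K, G.Adj q s) (hZ : G.ColOn z Z)
    (hbig : ¬ G.ColOn (2 * (k + 5) + z) K) :
    ∃ u ∈ K \ Z, ∃ K' ⊆ K \ Z, G.ConnSet K' ∧ ¬ G.ColOn k K' ∧ u ∉ K' ∧ (∃ s ∈ K', G.Adj u s) ∧
      ∀ p : ℕ, ∃ E : List V, G.IsIndPath (q :: E ++ [u]) ∧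
        (∀ x ∈ q :: E, x ∈ insert q K ∧ x ∉ K' ∧ ∀ s ∈ K', ¬ G.Adj x s) ∧
        (q :: E).length % 2 = p % 2 := by
  obtain ⟨C, hC1, hC2, hC3, -⟩ := exists_component_of_not_colOn
    (fun h => hbig (h.of_diff hZ) : ¬ G.ColOn (2 * (k + 5)) (K \ Z))
  obtain ⟨s₀, hs₀⟩ := exists_mem_of_not_colOn hC3
  have hH : G.ConnSet (insert q K) := by
    obtain ⟨s, hs, hqs⟩ := hq
    exact hK.insert hs hqs.symm
  have hqC : q ∉ C := fun h => hqK (hC1 h).1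
  obtain ⟨l, b, h1, h2, h3, h4, h5⟩ :=
    (hH q (Set.mem_insert q K) s₀ (Or.inr (hC1 hs₀).1)).exists_isIndPath (Set.mem_insert q K)
      (fun y => y ∈ C ∨ ∃ s ∈ C, G.Adj y s) (Or.inl hs₀)
  have hbC : b ∉ C := by
    intro hb
    rcases List.eq_nil_or_concat l with rfl | ⟨l', y, rfl⟩
    · simp only [List.nil_append, List.head?_cons, Option.some.injEq] at h2
      exact hqC (h2 ▸ hb)
    · refine h4 y (by simp) (Or.inr ⟨b, hb, ?_⟩)
      rw [List.concat_eq_append, List.append_assoc] at h1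
      exact (isIndPath_cons_cons.1 h1.right).1
  obtain ⟨u, hu, K', hK'1, hK'2, hK'3, hK'4, hK'5, hL⟩ := exists_parity_gadget hG htri hC2 hbC
    (h3.resolve_left hbC) hC3
  refine ⟨u, hC1 hu, K', hK'1.trans hC1, hK'2, hK'3, hK'4, hK'5, fun p => ?_⟩
  obtain ⟨L, hL1, hL2, hL3, hL4⟩ := hL (p + l.length)
  obtain ⟨E, rfl⟩ : ∃ E, L = b :: E := by
    rcases L with _ | ⟨b', E⟩
    · simp only [List.nil_append, List.head?_cons, Option.some.injEq] at hL2
      exact (hbC (hL2 ▸ hu)).elim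
    · simp only [List.cons_append, List.head?_cons, Option.some.injEq] at hL2
      exact ⟨E, by rw [hL2]⟩
  have hEC : ∀ y ∈ E ++ [u], y ∈ C := by
    intro y hy
    rcases List.mem_append.1 hy with hy' | hy'
    · refine ((hL3 y (by simp [hy'])).1).resolve_left ?_
      rintro rfl
      exact hL1.1 hy
    · rw [List.mem_singleton] at hy'
      exact hy' ▸ hu
  have hIP : G.IsIndPath (l ++ b :: (E ++ [u])) := by
    refine h1.join hL1 fun x hx y hy => ⟨?_, fun hxy => ?_⟩
    · rintro rfl; exact h4 x hx (Or.inl (hEC x hy))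
    · exact h4 x hx (Or.inr ⟨y, hEC y hy, hxy⟩)
  obtain ⟨E', hE'⟩ : ∃ E', l ++ b :: E = q :: E' := by
    have : (l ++ b :: E).head? = some q := by
      rw [show l ++ b :: E = (l ++ [b]) ++ E by simp, List.head?_append, h2]; rfl
    exact List.head?_eq_some_iff.1 this
  refine ⟨E', ?_, ?_, ?_⟩
  · rw [← hE']; simpa using hIP
  · rw [← hE']
    intro x hx
    rcases List.mem_append.1 hx with hx | hx
    · refine ⟨h5 x (by simp [hx]), fun h => h4 x hx (Or.inl (hK'1 h)),
        fun s hs hxs => h4 x hx (Or.inr ⟨s, hK'1 hs, hxs⟩)⟩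
    · refine ⟨?_, (hL3 x hx).2⟩
      rcases List.mem_cons.1 hx with rfl | hx
      · exact h5 x (by simp)
      · exact Or.inr (hC1 (hEC x (by simp [hx]))).1
  · rw [← hE', List.length_append]
    omega

/-- The number of colours needed for a chain of `n` gadgets. -/
def ropeCost (z k : ℕ) : ℕ → ℕ
  | 0 => k
  | n + 1 => 2 * (ropeCost z k n + 5) + z

/-- Each stage starts at the vertex where the previous one ended. Stage `i` deletes `Z (x i)`, so
the later joints and the final set avoid it. Earlier segments see nothing of the set in which later
stages take place, except at the joint; therefore the parities can be chosen independently. -/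
theorem exists_rope [Finite V] (hG : G.IsTPerfect) (htri : G.CliqueFree 3) {Z : V → Set V} {z k : ℕ}
    (hZ : ∀ x, G.ColOn z (Z x)) (n : ℕ) : ∀ (K : Set V) (q : V), G.ConnSet K → q ∉ K →
    (∃ s ∈ K, G.Adj q s) → ¬ G.ColOn (ropeCost z k n) K →
    ∃ (x : ℕ → V) (K' : Set V) (s : ℕ → ℕ → List V), x 0 = q ∧ K' ⊆ K ∧ G.ConnSet K' ∧
      ¬ G.ColOn k K' ∧ x n ∉ K' ∧ (∃ t ∈ K', G.Adj (x n) t) ∧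
      (∀ i < n, x (i + 1) ∈ K) ∧ (∀ i < n, ∀ y ∈ K', y ∉ Z (x i)) ∧
      (∀ j ≤ n, ∀ i < j, x j ∉ Z (x i)) ∧
      (∀ i < n, ∀ p, (∃ E, s i p = x i :: E) ∧ (s i p).length % 2 = p % 2 ∧
        ∀ y ∈ s i p, y ∈ insert q K ∧ y ∉ K' ∧ ∀ t ∈ K', ¬ G.Adj y t) ∧
      ∀ p : ℕ → ℕ, G.IsIndPath ((List.range n).flatMap (fun i => s i (p i)) ++ [x n]) := by
  induction n with
  | zero =>
    intro K q hK hqK hq hbig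
    exact ⟨fun _ => q, K, fun _ _ => [], rfl, subset_rfl, hK, hbig, hqK, hq, by simp, by simp,
      by simp, by simp, by simp⟩
  | succ n ih =>
    intro K q hK hqK hq hbig
    obtain ⟨u, hu, K₁, hK₁, hK₁c, hK₁b, huK₁, huK₁', hL⟩ :=
      exists_parity_stage hG htri hK hqK hq (hZ q) hbig
    choose L hL1 hL2 hL3 using hL
    obtain ⟨x, K', s, hx0, hK', hK'c, hK'b, hxK', hxK'', hxK, hZK', hxZ, hs, hIP⟩ :=
      ih K₁ u hK₁c huK₁ huK₁' hK₁b
    have hxu : ∀ i ≤ n, x i ∈ K \ Z q := by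
      intro i hi
      rcases i with _ | i
      · rw [hx0]; exact hu
      · exact hK₁ (hxK i (by omega))
    refine ⟨fun i => Nat.casesOn i q x, K', fun i => Nat.casesOn i (fun p => q :: L p) s, rfl,
      hK'.trans (hK₁.trans Set.sdiff_subset), hK'c, hK'b, hxK', hxK'', fun i hi => (hxu i (by omega)).1,
      ?_, ?_, ?_, ?_⟩
    · rintro (_ | i) hi y hy
      · exact (hK₁ (hK' hy)).2
      · exact hZK' i (by omega) y hy
    · rintro (_ | j) hj (_ | i) hi
      · omega
      · omega
      · exact (hxu j (by omega)).2
      · exact hxZ j (by omega) i (by omega)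
    · rintro (_ | i) hi p
      · refine ⟨⟨L p, rfl⟩, hL3 p, fun y hy => ?_⟩
        obtain ⟨h1, h2, h3⟩ := hL2 p y hy
        exact ⟨h1, fun h => h2 (hK' h), fun t ht => h3 t (hK' ht)⟩
      · obtain ⟨h1, h2, h3⟩ := hs i (by omega) p
        refine ⟨h1, h2, fun y hy => ⟨Or.inr ?_, (h3 y hy).2⟩⟩
        rcases (h3 y hy).1 with rfl | h
        · exact hu.1
        · exact (hK₁ h).1
    · intro p
      rw [List.range_succ_eq_map, List.flatMap_cons, List.flatMap_map, List.append_assoc]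
      change G.IsIndPath ((q :: L (p 0)) ++
        ((List.range n).flatMap (fun i => s i (p (i + 1))) ++ [x n]))
      have h1 := hIP fun i => p (i + 1)
      have hmem : ∀ y ∈ (List.range n).flatMap (fun i => s i (p (i + 1))) ++ [x n],
          y = u ∨ y ∈ K₁ := by
        intro y hy
        rcases List.mem_append.1 hy with hy | hy
        · obtain ⟨i, hi, hy⟩ := List.mem_flatMap.1 hy
          exact ((hs i (List.mem_range.1 hi) _).2.2 y hy).1
        · rw [List.mem_singleton] at hy
          subst hy
          rcases n with _ | n
          · exact Or.inl hx0
          · exact Or.inr (hxK n (by omega))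
      have hhead : ((List.range n).flatMap (fun i => s i (p (i + 1))) ++ [x n]).head? = some u := by
        rcases n with _ | n
        · simp [hx0]
        · rw [List.range_succ_eq_map, List.flatMap_cons]
          obtain ⟨E, hE⟩ := (hs 0 (by omega) (p 1)).1
          simp only [Nat.zero_add]
          rw [hE, hx0]; rfl
      obtain ⟨E, hE⟩ := List.head?_eq_some_iff.1 hhead
      rw [hE] at h1 hmem ⊢
      refine (hL1 (p 0)).join h1 fun y hy w hw => ?_
      have hwK : w ∈ K₁ := by
        refine (hmem w (by simp [hw])).resolve_left ?_
        rintro rfl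
        exact h1.1 hw
      obtain ⟨-, h2, h3⟩ := hL2 (p 0) y hy
      exact ⟨by rintro rfl; exact h2 hwK, h3 w hwK⟩

/-! ### Segments of an indexed induced path -/

/-- The vertices `r a, …, r (b - 1)`. -/
def seg (r : ℕ → V) (a b : ℕ) : List V := (List.range' a (b - a)).map r

@[simp] theorem length_seg (r : ℕ → V) (a b : ℕ) : (seg r a b).length = b - a := by simp [seg]

theorem mem_seg {r : ℕ → V} {a b : ℕ} {x : V} : x ∈ seg r a b ↔ ∃ i, a ≤ i ∧ i < b ∧ r i = x := by
  simp only [seg, List.mem_map, List.mem_range'_1]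
  constructor
  · rintro ⟨i, ⟨h1, h2⟩, h3⟩; exact ⟨i, h1, by omega, h3⟩
  · rintro ⟨i, h1, h2, h3⟩; exact ⟨i, ⟨h1, by omega⟩, h3⟩

theorem seg_append (r : ℕ → V) {a b c : ℕ} (hab : a ≤ b) (hbc : b ≤ c) :
    seg r a b ++ seg r b c = seg r a c := by
  simp only [seg, ← List.map_append]
  congr 1
  have := List.range'_append (s := a) (m := b - a) (n := c - b) (step := 1)
  rw [Nat.one_mul, show a + (b - a) = b by omega,
    show b - a + (c - b) = c - a by omega] at this
  exact this

theorem seg_cons (r : ℕ → V) {a b : ℕ} (hab : a < b) : seg r a b = r a :: seg r (a + 1) b := by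
  simp only [seg]
  rw [show b - a = b - (a + 1) + 1 by omega, List.range'_succ, List.map_cons]

theorem seg_concat (r : ℕ → V) {a b : ℕ} (hab : a ≤ b) : seg r a (b + 1) = seg r a b ++ [r b] := by
  rw [← seg_append r hab (Nat.le_succ b), seg_cons r (Nat.lt_succ_self b)]
  simp [seg]

/-- `r 0, …, r M` is an induced path. -/
def IsIndexedPath (G : SimpleGraph V) (r : ℕ → V) (M : ℕ) : Prop :=
  ∀ i j, i < j → j ≤ M → r i ≠ r j ∧ (G.Adj (r i) (r j) ↔ j = i + 1)

theorem IsIndexedPath.isIndPath_seg {r : ℕ → V} {M : ℕ} (h : G.IsIndexedPath r M) (a b : ℕ)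
    (hb : b ≤ M + 1) : G.IsIndPath (seg r a b) := by
  induction hn : b - a generalizing a with
  | zero => simp [seg, hn]
  | succ n ih =>
    rw [seg_cons r (by omega)]
    by_cases hab : a + 1 < b
    · rw [seg_cons r hab, isIndPath_cons_cons, ← seg_cons r hab]
      refine ⟨(h a (a + 1) (by omega) (by omega)).2.2 rfl, ?_, ih (a + 1) (by omega)⟩
      intro c hc
      obtain ⟨i, hi1, hi2, rfl⟩ := mem_seg.1 hc
      have := h a i (by omega) (by omega)
      exact ⟨this.1.symm, fun h' => by have := this.2.1 h'; omega⟩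
    · rw [show seg r (a + 1) b = [] by simp [seg]; omega]
      simp

theorem IsIndexedPath.adj_iff {r : ℕ → V} {M : ℕ} (h : G.IsIndexedPath r M) {i j : ℕ}
    (hi : i ≤ M) (hj : j ≤ M) : G.Adj (r i) (r j) ↔ j = i + 1 ∨ i = j + 1 := by
  rcases lt_trichotomy i j with h1 | h1 | h1
  · rw [(h i j h1 hj).2]; omega
  · subst h1
    simp
  · rw [G.adj_comm, (h j i h1 hi).2]; omega

theorem IsIndexedPath.eq_of_eq {r : ℕ → V} {M : ℕ} (h : G.IsIndexedPath r M) {i j : ℕ}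
    (hi : i ≤ M) (hj : j ≤ M) (hij : r i = r j) : i = j := by
  rcases lt_trichotomy i j with h1 | h1 | h1
  · exact ((h i j h1 hj).1 hij).elim
  · exact h1
  · exact ((h j i h1 hi).1 hij.symm).elim

/-- A segment of an induced path is a hub, the sides being the vertices of even and odd index. -/
theorem IsIndexedPath.isHub {r : ℕ → V} {M : ℕ} (h : G.IsIndexedPath r M) (a b : ℕ)
    (hb : b ≤ M + 1) : G.IsHub {x | ∃ i, a ≤ i ∧ i < b ∧ Even i ∧ r i = x}
      {x | ∃ i, a ≤ i ∧ i < b ∧ Odd i ∧ r i = x} := by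
  refine ⟨?_, ?_, ?_, ?_⟩
  · rintro _ ⟨i, hi1, hi2, hi3, rfl⟩ _ ⟨j, hj1, hj2, hj3, rfl⟩ hij
    rw [h.adj_iff (by omega) (by omega)] at hij
    rw [Nat.even_iff] at hi3 hj3; omega
  · rintro _ ⟨i, hi1, hi2, hi3, rfl⟩ _ ⟨j, hj1, hj2, hj3, rfl⟩ hij
    rw [h.adj_iff (by omega) (by omega)] at hij
    rw [Nat.odd_iff] at hi3 hj3; omega
  · rw [Set.disjoint_left]
    rintro _ ⟨i, hi1, hi2, hi3, rfl⟩ ⟨j, hj1, hj2, hj3, hij⟩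
    have := h.eq_of_eq (by omega) (by omega) hij
    subst this
    exact (Nat.not_even_iff_odd.2 hj3) hi3
  · have hmem : ∀ i, a ≤ i → i < b → r i ∈ {x | ∃ i, a ≤ i ∧ i < b ∧ Even i ∧ r i = x} ∪
        {x | ∃ i, a ≤ i ∧ i < b ∧ Odd i ∧ r i = x} := by
      intro i h1 h2
      rcases Nat.even_or_odd i with h3 | h3
      · exact Or.inl ⟨i, h1, h2, h3, rfl⟩
      · exact Or.inr ⟨i, h1, h2, h3, rfl⟩
    have key : ∀ i, a ≤ i → i < b → G.ConnIn ({x | ∃ i, a ≤ i ∧ i < b ∧ Even i ∧ r i = x} ∪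
        {x | ∃ i, a ≤ i ∧ i < b ∧ Odd i ∧ r i = x}) (r a) (r i) := by
      intro i hi
      induction i, hi using Nat.le_induction with
      | base => intro _; exact ConnIn.refl _
      | succ i hi ih =>
        intro hib
        exact (ih (by omega)).trans (ConnIn.single ((h.adj_iff (by omega) (by omega)).2 (Or.inl rfl))
          (hmem i hi (by omega)) (hmem (i + 1) (by omega) hib))
    refine ConnSet.of_root (r a) ?_
    rintro x (⟨i, h1, h2, -, rfl⟩ | ⟨i, h1, h2, -, rfl⟩)
    · exact key i h1 h2
    · exact key i h1 h2

theorem colOn_of_list {k : ℕ} {F : V → Set V} (hF : ∀ x, G.ColOn k (F x)) (L : List V) :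
    G.ColOn (k * L.length) {v | ∃ x ∈ L, v ∈ F x} := by
  induction L with
  | nil => exact (colOn_empty _).subset (by rintro v ⟨x, hx, -⟩; simp at hx)
  | cons a L ih =>
    refine ((hF a).union ih).mono (by rw [List.length_cons]; ring_nf; omega) ?_
    rintro v ⟨x, hx, hv⟩
    rcases List.mem_cons.1 hx with rfl | hx
    · exact Or.inl hv
    · exact Or.inr ⟨x, hx, hv⟩

/-! ### Combs: an induced path, and a set away from it joined to it through the level below -/

/-- An induced path `r 0, …, r M` and a set `K` without edges to it inside level `m` of a
levelling, such that every `v ∈ K` has a neighbour `d v` in level `m - 1` which sees the path,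
for the first time in `r (lam v)`; `g v` is the parent of `d v`. -/
structure Comb (G : SimpleGraph V) (H : Set V) (l : V → ℕ) (m : ℕ) (r : ℕ → V) (M : ℕ) (d0 g0 : V)
    (K : Set V) (d g : V → V) (lam : V → ℕ) : Prop where
  tri : G.CliqueFree 3
  step : ∀ u ∈ H, ∀ v ∈ H, G.Adj u v → l u ≤ l v + 1
  path : G.IsIndexedPath r M
  path_mem : ∀ i ≤ M, r i ∈ H ∧ l (r i) = m
  d0_mem : d0 ∈ H ∧ l d0 + 1 = m
  d0_adj : ∀ i ≤ M, G.Adj d0 (r i) ↔ i = 0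
  g0_mem : g0 ∈ H ∧ l g0 + 2 = m ∧ G.Adj g0 d0
  K_mem : ∀ v ∈ K, v ∈ H ∧ l v = m
  K_d0 : ∀ v ∈ K, ¬ G.Adj d0 v
  K_path : ∀ v ∈ K, ∀ i ≤ M, v ≠ r i ∧ ¬ G.Adj v (r i)
  d_mem : ∀ v ∈ K, d v ∈ H ∧ l (d v) + 1 = m ∧ G.Adj (d v) v
  g_mem : ∀ v ∈ K, g v ∈ H ∧ l (g v) + 2 = m ∧ G.Adj (g v) (d v)
  lam_le : ∀ v ∈ K, lam v ≤ M
  adj_lam : ∀ v ∈ K, G.Adj (d v) (r (lam v))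
  not_adj_lt : ∀ v ∈ K, ∀ i < lam v, ¬ G.Adj (d v) (r i)
  d_d0 : ∀ v ∈ K, ¬ G.Adj (d v) d0
  d_g0 : ∀ v ∈ K, ¬ G.Adj (d v) g0
  conn : ∀ v ∈ K, G.ConnIn ({d v, g v, g0} ∪ {u | u ∈ H ∧ l u + 3 ≤ m}) (d v) g0

/-- An induced path `N` from `u` to `d0` closing up `r 0, …, r t` to an induced cycle. -/
structure IsDetour (G : SimpleGraph V) (H : Set V) (l : V → ℕ) (m : ℕ) (r : ℕ → V) (d0 : V) (t : ℕ)
    (u : V) (N : List V) : Prop where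
  path : G.IsIndPath N
  head : N.head? = some u
  last : N.getLast? = some d0
  mem : ∀ x ∈ N, x ∈ H
  cross : ∀ x ∈ N, ∀ i ≤ t, x ≠ r i ∧ (G.Adj (r i) x ↔ (i = t ∧ x = u) ∨ (i = 0 ∧ x = d0))

variable {H K : Set V} {l lam : V → ℕ} {m M : ℕ} {r : ℕ → V} {d0 g0 : V} {d g : V → V}

/-- The path `P` need not be `r 0, …, r t`: its other vertices only have to miss the detour. Thus a
path rerouted by shortcuts is closed by the same detour. -/
theorem IsDetour.isIndCycle {t : ℕ} {u : V} {N P : List V}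
    (hN : G.IsDetour H l m r d0 t u N) (hP : G.IsIndPath P) (hhead : P.head? = some (r 0))
    (hlast : P.getLast? = some (r t)) (hr : G.IsIndexedPath r t)
    (hPN : ∀ x ∈ P, (∃ i ≤ t, r i = x) ∨ ∀ y ∈ N, x ≠ y ∧ ¬ G.Adj x y) :
    G.IsIndCycle (P ++ N) := by
  rw [isIndCycle_append (by rintro rfl; simp at hhead)
    (by rintro rfl; have := hN.head; simp at this)]
  refine ⟨hP, hN.path, fun x hx y hy => ?_⟩
  rw [hhead, hlast, hN.head, hN.last]
  simp only [Option.some.injEq]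
  rcases hPN x hx with ⟨i, hi, rfl⟩ | h
  · have := hN.cross y hy i hi
    refine ⟨this.1.symm, ?_⟩
    rw [this.2]
    constructor
    · rintro (⟨rfl, rfl⟩ | ⟨rfl, rfl⟩) <;> simp
    · rintro (⟨h, rfl⟩ | ⟨h, rfl⟩)
      · exact Or.inl ⟨(hr.eq_of_eq le_rfl hi h).symm, rfl⟩
      · exact Or.inr ⟨(hr.eq_of_eq (by omega) hi h).symm, rfl⟩
  · obtain ⟨h1, h2⟩ := h y hy
    refine ⟨h1, fun h => (h2 h).elim, ?_⟩
    rintro (⟨rfl, rfl⟩ | ⟨rfl, rfl⟩)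
    · have := hN.cross u hy t le_rfl
      exact (h2 (this.2.2 (Or.inl ⟨rfl, rfl⟩))).elim
    · have := hN.cross d0 hy 0 (by omega)
      exact (h2 (this.2.2 (Or.inr ⟨rfl, rfl⟩))).elim

theorem cross_of_not_adj {x u : V} {t : ℕ} (hxt : ∀ i ≤ t, x ≠ r i ∧ ¬ G.Adj x (r i)) (hu : x ≠ u)
    (h0 : x ≠ d0) {i : ℕ} (hi : i ≤ t) :
    x ≠ r i ∧ (G.Adj (r i) x ↔ (i = t ∧ x = u) ∨ (i = 0 ∧ x = d0)) :=
  ⟨(hxt i hi).1, fun h => ((hxt i hi).2 h.symm).elim, fun h => by tauto⟩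

namespace Comb

theorem not_adj (C : G.Comb H l m r M d0 g0 K d g lam) {x y : V} (hx : x ∈ H) (hy : y ∈ H) (h : l x + 1 < l y) : ¬ G.Adj x y :=
  fun hxy => by have := C.step y hy x hx hxy.symm; omega

theorem ne_path (C : G.Comb H l m r M d0 g0 K d g lam) {x : V} (h : l x ≠ m) {i : ℕ} (hi : i ≤ M) : x ≠ r i := by
  rintro rfl; exact h (C.path_mem i hi).2

/-- The default detour of `v`. Apart from `d v`, `g v`, `g0` and `d0`, its vertices lie too deep to
see level `m` or the level just below it. -/
theorem exists_base_path (C : G.Comb H l m r M d0 g0 K d g lam) {v : V} (hv : v ∈ K) : ∃ Q : List V, G.IsIndPath (d v :: Q) ∧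
    (d v :: Q).getLast? = some d0 ∧
    ∀ x ∈ Q, x = g v ∨ x = g0 ∨ x = d0 ∨ x ∈ H ∧ l x + 3 ≤ m := by
  have hd0 : G.ConnIn (insert d0 ({d v, g v, g0} ∪ {u | u ∈ H ∧ l u + 3 ≤ m})) (d v) d0 :=
    ((C.conn v hv).mono (Set.subset_insert _ _)).trans
      (ConnIn.single C.g0_mem.2.2 (by simp) (by simp))
  obtain ⟨L, b, h1, h2, rfl, h4, h5⟩ := hd0.exists_isIndPath (by simp) (fun y => y = d0) rfl
  obtain ⟨Q, hQ⟩ := List.head?_eq_some_iff.1 h2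
  refine ⟨Q, by rwa [← hQ], by rw [← hQ]; simp, fun x hx => ?_⟩
  have hxd : x ≠ d v := by
    rintro rfl
    rw [hQ] at h1
    exact h1.1 hx
  have := h5 x (by rw [hQ]; simp [hx])
  simp only [Set.mem_insert_iff, Set.mem_union, Set.mem_singleton_iff, Set.mem_ofPred_eq] at this
  tauto

/-- Vertices with first attachment `r t` lie in the second neighbourhood of `r t`. -/
theorem colOn_slice (C : G.Comb H l m r M d0 g0 K d g lam) [Finite V] (hG : G.IsTPerfect) (t : ℕ) :
    G.ColOn 2 {v | v ∈ K ∧ lam v = t} := by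
  refine (colOn_nbrs_nbrs hG C.tri (r t)).subset ?_
  rintro v ⟨hv, rfl⟩
  exact ⟨d v, mem_nbrs_singleton.2 (C.adj_lam v hv).symm, (C.d_mem v hv).2.2⟩

theorem cross_d (C : G.Comb H l m r M d0 g0 K d g lam) {v : V} (hv : v ∈ K) {i : ℕ} (hi : i ≤ lam v) :
    d v ≠ r i ∧ (G.Adj (r i) (d v) ↔ (i = lam v ∧ d v = d v) ∨ (i = 0 ∧ d v = d0)) := by
  have hdv := C.d_mem v hv
  refine ⟨C.ne_path (by omega) (hi.trans (C.lam_le v hv)), ?_⟩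
  have hne : d v ≠ d0 := fun h => C.K_d0 v hv (h ▸ hdv.2.2)
  constructor
  · intro h
    rcases hi.lt_or_eq with h' | h'
    · exact (C.not_adj_lt v hv i h' h.symm).elim
    · exact Or.inl ⟨h', rfl⟩
  · rintro (⟨rfl, -⟩ | ⟨-, h⟩)
    · exact (C.adj_lam v hv).symm
    · exact (hne h).elim

theorem cross_low (C : G.Comb H l m r M d0 g0 K d g lam) {x u : V} {t : ℕ} (ht : t ≤ M) (hx : x ∈ H) (hl : l x + 2 ≤ m) (hu : l u + 1 = m)
    {i : ℕ} (hi : i ≤ t) :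
    x ≠ r i ∧ (G.Adj (r i) x ↔ (i = t ∧ x = u) ∨ (i = 0 ∧ x = d0)) := by
  have hri := C.path_mem i (hi.trans ht)
  refine ⟨C.ne_path (by omega) (hi.trans ht), fun h => ?_, ?_⟩
  · exact (C.not_adj hx hri.1 (by omega) h.symm).elim
  · have := C.d0_mem.2
    rintro (⟨-, rfl⟩ | ⟨-, rfl⟩) <;> omega

theorem cross_d0 (C : G.Comb H l m r M d0 g0 K d g lam) {u : V} {t : ℕ} (ht : t ≤ M) (hu : u ≠ d0) {i : ℕ} (hi : i ≤ t) :
    d0 ≠ r i ∧ (G.Adj (r i) d0 ↔ (i = t ∧ d0 = u) ∨ (i = 0 ∧ d0 = d0)) := by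
  refine ⟨C.ne_path (by have := C.d0_mem.2; omega) (hi.trans ht), ?_⟩
  rw [G.adj_comm, C.d0_adj i (hi.trans ht)]
  constructor
  · exact fun h => Or.inr ⟨h, rfl⟩
  · rintro (⟨-, h⟩ | ⟨h, -⟩)
    · exact (hu h.symm).elim
    · exact h

/-- A base path is followed by a detour for any vertex seeing the comb earlier. -/
theorem cross_tail (C : G.Comb H l m r M d0 g0 K d g lam) {v : V} (hv : v ∈ K) {Q : List V} {u : V} {t : ℕ} (ht : t ≤ M)
    (hu : l u + 1 = m) (hu0 : u ≠ d0)
    (hQ : ∀ x ∈ Q, x = g v ∨ x = g0 ∨ x = d0 ∨ x ∈ H ∧ l x + 3 ≤ m) {x : V} (hx : x ∈ Q)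
    {i : ℕ} (hi : i ≤ t) :
    x ≠ r i ∧ (G.Adj (r i) x ↔ (i = t ∧ x = u) ∨ (i = 0 ∧ x = d0)) := by
  have h1 := C.g_mem v hv
  have h2 := C.g0_mem
  rcases hQ x hx with rfl | rfl | rfl | ⟨h3, h4⟩
  · exact C.cross_low ht h1.1 h1.2.1.le hu hi
  · exact C.cross_low ht h2.1 h2.2.1.le hu hi
  · exact C.cross_d0 ht hu0 hi
  · exact C.cross_low ht h3 (by omega) hu hi

theorem d_ne_d0 (C : G.Comb H l m r M d0 g0 K d g lam) {v : V} (hv : v ∈ K) : d v ≠ d0 :=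
  fun h => C.K_d0 v hv (h ▸ (C.d_mem v hv).2.2)

theorem tail_mem (C : G.Comb H l m r M d0 g0 K d g lam) {v : V} (hv : v ∈ K) {Q : List V}
    (hQ : ∀ x ∈ Q, x = g v ∨ x = g0 ∨ x = d0 ∨ x ∈ H ∧ l x + 3 ≤ m) {x : V} (hx : x ∈ Q) :
    x ∈ H := by
  rcases hQ x hx with rfl | rfl | rfl | ⟨h3, h4⟩
  exacts [(C.g_mem v hv).1, C.g0_mem.1, C.d0_mem.1, h3]

/-- The vertices of `K` admitting a detour that closes up an odd cycle. -/
def OddDetour (_ : G.Comb H l m r M d0 g0 K d g lam) (a : V) : Prop :=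
  ∃ N, G.IsDetour H l m r d0 (lam a) (d a) N ∧ Odd (lam a + 1 + N.length) ∧
    ∃ D : List V, D.length ≤ 7 ∧ ∀ x ∈ N, x ∈ D ∨ l x + 3 ≤ m

/-- The default detour of `a'` closes an even cycle. Prefix it by `d a` if `d a` sees `d a'`, and by
`d a, a, a'` otherwise. An odd number of vertices is added, while `lam` keeps its parity, so the
result is an odd detour for `a` if it is induced. Only an edge from `g a'` to `d a` can spoil that.
-/
theorem adj_of_not_oddDetour (C : G.Comb H l m r M d0 g0 K d g lam) {a a' : V} (ha : a ∈ K) (ha' : a' ∈ K) (haa : G.Adj a a')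
    (hlam : lam a < lam a') (hpar : lam a % 2 = lam a' % 2) (hna : ¬ C.OddDetour a)
    (hna' : ¬ C.OddDetour a') : G.Adj (g a') (d a) := by
  obtain ⟨Q, hQ1, hQ2, hQ3⟩ := C.exists_base_path ha'
  have hd := C.d_mem a ha
  have hd' := C.d_mem a' ha'
  have hg' := C.g_mem a' ha'
  have hKa := C.K_mem a ha
  have hKa' := C.K_mem a' ha'
  have hM := C.lam_le a ha
  have hM' := C.lam_le a' ha'
  have hdd : d a ≠ d a' := by
    intro h
    exact C.not_adj_lt a' ha' _ hlam (h ▸ C.adj_lam a ha)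
  have hQd : ∀ D : List V, ∀ x ∈ Q, x ∈ D ++ [g a', g0, d0] ∨ l x + 3 ≤ m := by
    intro D x hx
    rcases hQ3 x hx with h | h | h | ⟨-, h⟩
    · left; simp [h]
    · left; simp [h]
    · left; simp [h]
    · exact Or.inr h
  have hd0 := C.d_ne_d0 ha
  have hd0' := C.d_ne_d0 ha'
  have hbase : ¬ Odd (lam a' + 1 + (d a' :: Q).length) := by
    intro hodd
    refine hna' ⟨d a' :: Q, ⟨hQ1, rfl, hQ2, ?_, ?_⟩, hodd, [d a'] ++ [g a', g0, d0], by simp, ?_⟩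
    · intro x hx
      rcases List.mem_cons.1 hx with rfl | hx
      · exact hd'.1
      · exact C.tail_mem ha' hQ3 hx
    · intro x hx i hi
      rcases List.mem_cons.1 hx with rfl | hx
      · exact C.cross_d ha' hi
      · exact C.cross_tail ha' hM' hd'.2.1 hd0' hQ3 hx hi
    · intro x hx
      rcases List.mem_cons.1 hx with rfl | hx
      · left; simp
      · exact hQd _ x hx
  -- `d a` sees nothing of the tail `Q` unless it sees `g a'`
  have hdaQ : ¬ G.Adj (g a') (d a) → ∀ x ∈ Q, x ≠ d a ∧ ¬ G.Adj (d a) x := by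
    intro hg x hx
    rcases hQ3 x hx with rfl | rfl | rfl | ⟨h1, h2⟩
    · exact ⟨by intro h; rw [h] at hg'; omega, fun h => hg h.symm⟩
    · refine ⟨fun h => ?_, C.d_g0 a ha⟩
      have := C.g0_mem.2.1
      rw [h] at this; omega
    · exact ⟨hd0.symm, C.d_d0 a ha⟩
    · exact ⟨by intro h; rw [h] at h2; omega, fun h => C.not_adj h1 hd.1 (by omega) h.symm⟩
  by_contra hg
  by_cases hadj : G.Adj (d a) (d a')
  · refine hna ⟨d a :: d a' :: Q, ⟨?_, rfl, ?_, ?_, ?_⟩, ?_, [d a, d a'] ++ [g a', g0, d0], by simp,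
      ?_⟩
    · exact isIndPath_cons_cons.2 ⟨hadj, hdaQ hg, hQ1⟩
    · rw [List.getLast?_cons, hQ2]; rfl
    · intro x hx
      simp only [List.mem_cons] at hx
      rcases hx with rfl | rfl | hx
      · exact hd.1
      · exact hd'.1
      · exact C.tail_mem ha' hQ3 hx
    · intro x hx i hi
      simp only [List.mem_cons] at hx
      rcases hx with rfl | rfl | hx
      · exact C.cross_d ha hi
      · refine cross_of_not_adj (fun i hi => ⟨C.ne_path (by omega) (by omega),
          C.not_adj_lt a' ha' i (by omega)⟩) hdd.symm hd0' hi
      · exact C.cross_tail ha' hM hd.2.1 hd0 hQ3 hx hi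
    · rw [Nat.not_odd_iff] at hbase
      simp only [List.length_cons] at hbase ⊢
      rw [Nat.odd_iff]; omega
    · intro x hx
      simp only [List.mem_cons] at hx
      rcases hx with rfl | rfl | hx
      · left; simp
      · left; simp
      · exact hQd _ x hx
  · have hlowa : ∀ a ∈ K, ∀ x ∈ Q, x ≠ a ∧ ¬ G.Adj a x := by
      intro a ha x hx
      have hKa := C.K_mem a ha
      rcases hQ3 x hx with rfl | rfl | rfl | ⟨h1, h2⟩
      · exact ⟨by intro h; rw [h] at hg'; omega, fun h => C.not_adj hg'.1 hKa.1 (by omega) h.symm⟩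
      · have := C.g0_mem
        exact ⟨by intro h; rw [h] at this; omega, fun h => C.not_adj this.1 hKa.1 (by omega) h.symm⟩
      · have := C.d0_mem
        exact ⟨by intro h; rw [h] at this; omega, fun h => C.K_d0 a ha h.symm⟩
      · exact ⟨by intro h; rw [h] at h2; omega, fun h => C.not_adj h1 hKa.1 (by omega) h.symm⟩
    have hmemN : ∀ x ∈ d a :: a :: a' :: d a' :: Q, x = d a ∨ x = a ∨ x = a' ∨ x = d a' ∨ x ∈ Q := by
      intro x hx
      simpa only [List.mem_cons] using hx
    refine hna ⟨d a :: a :: a' :: d a' :: Q, ⟨?_, rfl, ?_, ?_, ?_⟩, ?_,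
      [d a, a, a', d a'] ++ [g a', g0, d0], by simp, ?_⟩
    · refine isIndPath_cons_cons.2 ⟨hd.2.2, ?_, isIndPath_cons_cons.2 ⟨haa, ?_,
        isIndPath_cons_cons.2 ⟨hd'.2.2.symm, hlowa a' ha', hQ1⟩⟩⟩
      · intro x hx
        simp only [List.mem_cons] at hx
        rcases hx with rfl | rfl | hx
        · exact ⟨by intro h; rw [← h] at hd; omega, C.tri.not_adj hd.2.2.symm haa⟩
        · exact ⟨hdd.symm, hadj⟩
        · exact hdaQ hg x hx
      · intro x hx
        rcases List.mem_cons.1 hx with rfl | hx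
        · exact ⟨by intro h; rw [h] at hd'; omega, C.tri.not_adj haa.symm hd'.2.2.symm⟩
        · exact hlowa a ha x hx
    · rw [List.getLast?_cons, List.getLast?_cons, List.getLast?_cons, hQ2]; rfl
    · intro x hx
      rcases hmemN x hx with rfl | rfl | rfl | rfl | hx
      exacts [hd.1, hKa.1, hKa'.1, hd'.1, C.tail_mem ha' hQ3 hx]
    · intro x hx i hi
      have hne : ∀ a ∈ K, ∀ b, l b + 1 = m → a ≠ b := by
        rintro a ha b hb rfl
        have := (C.K_mem a ha).2
        omega
      rcases hmemN x hx with rfl | rfl | rfl | rfl | hx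
      · exact C.cross_d ha hi
      · exact cross_of_not_adj (fun i hi => C.K_path x ha i (by omega)) (hne x ha _ hd.2.1)
          (hne x ha _ C.d0_mem.2) hi
      · exact cross_of_not_adj (fun i hi => C.K_path x ha' i (by omega)) (hne x ha' _ hd.2.1)
          (hne x ha' _ C.d0_mem.2) hi
      · refine cross_of_not_adj (fun i hi => ⟨C.ne_path (by omega) (by omega),
          C.not_adj_lt a' ha' i (by omega)⟩) hdd.symm hd0' hi
      · exact C.cross_tail ha' hM hd.2.1 hd0 hQ3 hx hi
    · rw [Nat.not_odd_iff] at hbase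
      simp only [List.length_cons] at hbase ⊢
      rw [Nat.odd_iff]; omega
    · intro x hx
      rcases hmemN x hx with rfl | rfl | rfl | rfl | hx
      · left; simp
      · left; simp
      · left; simp
      · left; simp
      · exact hQd _ x hx

/-- Split by the parity of `lam` and by a 2-colouring of each slice, giving four classes. On an odd
induced cycle in one class take `a` with maximal `lam`. Its cycle neighbours have strictly smaller
`lam`, as adjacent vertices of one slice get different colours, so `g a` sees their `d`. The star at
`g a` then touches three consecutive cycle vertices, a forbidden wheel; hence each class takes two
colours. -/
theorem colOn_not_oddDetour (C : G.Comb H l m r M d0 g0 K d g lam) [Finite V] (hG : G.IsTPerfect) :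
    G.ColOn 8 {v | v ∈ K ∧ ¬ C.OddDetour v} := by
  classical
  choose c hc1 hc2 using C.colOn_slice hG
  have key : ∀ i j : ℕ, G.ColOn 2 {v | v ∈ K ∧ ¬ C.OddDetour v ∧ lam v % 2 = i ∧ c (lam v) v = j} := by
    intro i j
    by_contra hcol
    obtain ⟨O, hO, hodd, h3, hsub⟩ := exists_odd_isIndCycle hcol
    obtain ⟨a, haO, hmax⟩ := O.toFinset.exists_max_image lam
      ⟨O.head (by rintro rfl; simp at h3), by simp⟩
    rw [List.mem_toFinset] at haO
    obtain ⟨l₁, l₂, rfl⟩ := List.append_of_mem haO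
    -- rotate so that `a` is the second vertex
    have hrot : ∃ a₁ a₃ D, G.IsIndCycle (a₁ :: a :: a₃ :: D) ∧
        (a₁ :: a :: a₃ :: D).length = (l₁ ++ a :: l₂).length ∧
        ∀ x ∈ a₁ :: a :: a₃ :: D, x ∈ l₁ ++ a :: l₂ := by
      have h4 := hO.rotate
      rcases List.eq_nil_or_concat (l₂ ++ l₁) with h5 | ⟨Y, a₁, h5⟩
      · have := congrArg List.length h5
        simp only [List.length_append, List.length_cons, List.length_nil] at this h3; omega
      · rw [List.cons_append, h5, List.concat_eq_append, ← List.cons_append] at h4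
        have h6 := h4.rotate
        have hlen := congrArg List.length h5
        simp at hlen h3
        rcases Y with _ | ⟨a₃, D⟩
        · simp only [List.length_nil] at hlen; omega
        · refine ⟨a₁, a₃, D, h6, by simp at hlen ⊢; omega, fun x hx => ?_⟩
          have : x = a ∨ x ∈ l₂ ++ l₁ := by
            rw [h5]; simp at hx ⊢; tauto
          simp at this ⊢; tauto
    obtain ⟨a₁, a₃, D, hcyc, hlen, hsub'⟩ := hrot
    have hprop : ∀ x ∈ a₁ :: a :: a₃ :: D, x ∈ K ∧ ¬ C.OddDetour x ∧ lam x % 2 = i ∧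
        c (lam x) x = j ∧ lam x ≤ lam a := fun x hx => by
      obtain ⟨h1, h2, h3, h4⟩ := hsub x (hsub' x hx)
      exact ⟨h1, h2, h3, h4, hmax x (List.mem_toFinset.2 (hsub' x hx))⟩
    obtain ⟨ha, hna, hia, hja, -⟩ := hprop a (by simp)
    have htie : ∀ x ∈ a₁ :: a :: a₃ :: D, G.Adj x a → G.Adj (g a) (d x) := by
      intro x hx hxa
      obtain ⟨h1, h2, h3, h4, h5⟩ := hprop x hx
      refine C.adj_of_not_oddDetour h1 ha hxa (lt_of_le_of_ne h5 fun h6 => ?_) (by omega) h2 hna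
      refine hc2 (lam a) x ⟨h1, h6⟩ a ⟨ha, rfl⟩ hxa ?_
      rw [← h6, h4, h6, hja]
    have hadj1 : G.Adj a₁ a := (isIndPath_cons_cons.1 (show G.IsIndPath ([a₁, a]) from by
      have := (isIndCycle_append (l₁ := [a₁, a]) (l₂ := a₃ :: D) (by simp) (by simp)).1 hcyc
      exact this.1)).1
    have hadj3 : G.Adj a₃ a := by
      have := (isIndPath_cons_cons.1 hcyc.2.2).1
      exact this.symm
    have hg := C.g_mem a ha
    have hd1 := htie a₁ (by simp) hadj1
    have hd3 := htie a₃ (by simp) hadj3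
    have hd2 := hg.2.2
    have hU : G.IsHub {d a₁, d a, d a₃} {g a} := by
      have hsubN : ({d a₁, d a, d a₃} : Set V) ⊆ G.nbrs {g a} := by
        rintro x (rfl | rfl | rfl)
        exacts [mem_nbrs_singleton.2 hd1, mem_nbrs_singleton.2 hd2, mem_nbrs_singleton.2 hd3]
      refine ⟨fun u hu v hv => stable_nbrs_singleton C.tri (g a) u (hsubN hu) v (hsubN hv), stable_singleton _, ?_, ?_⟩
      · rw [Set.disjoint_singleton_right]
        intro h
        exact G.loopless.irrefl _ (mem_nbrs_singleton.1 (hsubN h))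
      · rw [Set.union_comm]
        exact (connSet_singleton _).union_of_adj hsubN
    have hmem : ∀ x ∈ a₁ :: a :: a₃ :: D, x ∈ K := fun x hx => (hprop x hx).1
    have hatt : ∀ x ∈ [a₁, a, a₃], x ∈ G.nbrs {d a₁, d a, d a₃} := by
      intro x hx
      simp only [List.mem_cons, List.not_mem_nil, or_false] at hx
      rcases hx with rfl | rfl | rfl
      · exact ⟨d x, by simp, (C.d_mem x (hmem x (by simp))).2.2⟩
      · exact ⟨d x, by simp, (C.d_mem x (hmem x (by simp))).2.2⟩
      · exact ⟨d x, by simp, (C.d_mem x (hmem x (by simp))).2.2⟩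
    refine hG.wheel_false hU (A := []) (B := []) (D := D) hcyc (by simp) (by simp) ?_ ?_
      (hatt _ (by simp)) (hatt _ (by simp)) (hatt _ (by simp))
    · rw [← hlen] at hodd
      simp only [List.length_cons] at hodd
      rw [Nat.odd_iff] at hodd; rw [Nat.even_iff]; omega
    · intro x hx
      have hxK := hmem x hx
      have hx' := C.K_mem x hxK
      refine ⟨?_, ?_, ?_⟩
      · have hk : ∀ y ∈ K, x ≠ d y := by
          rintro y hy rfl
          have := C.d_mem y hy
          omega
        rintro (h | h | h)
        exacts [hk _ (hmem _ (by simp)) h, hk _ (hmem _ (by simp)) h, hk _ (hmem _ (by simp)) h]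
      · rintro rfl; omega
      · intro h
        exact C.not_adj hg.1 hx'.1 (by omega) (mem_nbrs_singleton.1 h)
  refine (((key 0 0).union (key 0 1)).union ((key 1 0).union (key 1 1))).subset ?_
  rintro v ⟨hv, hnv⟩
  have h1 := hc1 (lam v) v ⟨hv, rfl⟩
  have h2 : c (lam v) v = 0 ∨ c (lam v) v = 1 := by omega
  have h3 : lam v % 2 = 0 ∨ lam v % 2 = 1 := by omega
  rcases h3 with h3 | h3 <;> rcases h2 with h2 | h2
  · exact Or.inl (Or.inl ⟨hv, hnv, h3, h2⟩)
  · exact Or.inl (Or.inr ⟨hv, hnv, h3, h2⟩)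
  · exact Or.inr (Or.inl ⟨hv, hnv, h3, h2⟩)
  · exact Or.inr (Or.inr ⟨hv, hnv, h3, h2⟩)

end Comb

/-! ### Rerouting induced paths -/

/-- As there is no triangle, `x` and `y` are not adjacent and `M` is not empty; putting `d` in its
place creates no chord. -/
theorem IsIndPath.shortcut (htri : G.CliqueFree 3) {P M Q : List V} {x y d : V}
    (h : G.IsIndPath (P ++ x :: (M ++ y :: Q))) (hx : G.Adj d x) (hy : G.Adj d y)
    (hd : ∀ z ∈ P ++ Q, z ≠ d ∧ ¬ G.Adj d z) : G.IsIndPath (P ++ x :: d :: y :: Q) := by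
  obtain ⟨h1, h2, h3⟩ := isIndPath_append.1 h
  have hxy := htri.not_adj hx hy
  have hM : M ≠ [] := by
    rintro rfl
    exact hxy (isIndPath_cons_cons.1 h2).1
  have hnd := h.nodup
  have hxc : ∀ c ∈ y :: Q, c ≠ x ∧ ¬ G.Adj x c := by
    intro c hc
    have hcx : c ≠ x := by
      rintro rfl
      exact h2.1 (by simp at hc ⊢; tauto)
    refine ⟨hcx, fun hxc => ?_⟩
    have h4 := (h2.2.1 c (by simp at hc ⊢; tauto)).1 hxc
    obtain ⟨a, M', rfl⟩ := List.exists_cons_of_ne_nil hM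
    simp only [List.cons_append, List.head?_cons, Option.some.injEq] at h4
    subst h4
    exact h2.2.2.1 (by simp at hc ⊢; tauto)
  have hQ : G.IsIndPath (y :: Q) := by
    have := h2.2.2
    exact this.right
  have hP : G.IsIndPath (P ++ [x]) := by
    rw [show P ++ x :: (M ++ y :: Q) = (P ++ [x]) ++ (M ++ y :: Q) by simp] at h
    exact h.left
  refine hP.join (isIndPath_cons_cons.2 ⟨hx.symm, hxc, isIndPath_cons_cons.2 ⟨hy, ?_, hQ⟩⟩) ?_
  · intro c hc
    exact hd c (by simp [hc])
  · intro p hp z hz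
    rcases List.mem_cons.1 hz with rfl | hz
    · exact ⟨(hd p (by simp [hp])).1, fun h => (hd p (by simp [hp])).2 h.symm⟩
    · have h4 := h3 p hp z (by simp at hz ⊢; tauto)
      refine ⟨h4.1, fun hpz => (hxc z hz).1 ?_⟩
      simpa using (h4.2.1 hpz).2.symm

/-- A segment can be replaced by a path of any parity if some vertex `d` sees it in vertices at odd
distance only at its two extreme attachments. -/
theorem exists_seg_of_parity (htri : G.CliqueFree 3) {r : ℕ → V} {a b i j : ℕ} {d : V}
    (hai : a ≤ i) (hij : i < j) (hjb : j < b) (hodd : (j - i) % 2 = 1)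
    (hdi : G.Adj d (r i)) (hdj : G.Adj d (r j))
    (hd : ∀ k, a ≤ k → k < b → r k ≠ d ∧ (G.Adj d (r k) → i ≤ k ∧ k ≤ j)) (p : ℕ) :
    ∃ L : List V, L.length % 2 = p % 2 ∧ L.head? = some (r a) ∧ L.getLast? = some (r (b - 1)) ∧
      (∀ x ∈ L, x ∈ seg r a b ∨ x = d) ∧
      ∀ A B : List V, G.IsIndPath (A ++ seg r a b ++ B) → (∀ x ∈ A ++ B, x ≠ d ∧ ¬ G.Adj d x) →
        G.IsIndPath (A ++ L ++ B) := by
  have hhead : ∀ i ≤ j, a ≤ i → ∀ Y, (seg r a i ++ r i :: Y).head? = some (r a) := by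
    intro i hij hai Y
    rcases hai.lt_or_eq with h | rfl
    · rw [seg_cons r h]; rfl
    · simp [seg]
  have hlast : ∀ Y, (Y ++ r j :: seg r (j + 1) b).getLast? = some (r (b - 1)) := by
    intro Y
    rw [← seg_cons r hjb, show b = b - 1 + 1 by omega, seg_concat r (by omega)]
    simp
  have hs : seg r a b = seg r a i ++ r i :: (seg r (i + 1) j ++ r j :: seg r (j + 1) b) := by
    rw [← seg_cons r hjb, seg_append r (by omega) hjb.le, ← seg_cons r (by omega),
      seg_append r hai (by omega)]
  by_cases hp : (b - a) % 2 = p % 2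
  · refine ⟨seg r a b, by simpa using hp, ?_, ?_, fun x hx => Or.inl hx, fun A B h _ => h⟩
    · rw [hs]; exact hhead i hij.le hai _
    · have := hlast (seg r a j)
      rwa [← seg_cons r hjb, seg_append r (by omega) hjb.le] at this
  · refine ⟨seg r a i ++ r i :: d :: r j :: seg r (j + 1) b, ?_, hhead i hij.le hai _, ?_, ?_, ?_⟩
    · simp; omega
    · have := hlast (seg r a i ++ [r i, d])
      simpa using this
    · intro x hx
      rw [hs]
      simp only [List.mem_append, List.mem_cons] at hx ⊢
      tauto
    · intro A B h hAB
      rw [hs] at h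
      have h1 : G.IsIndPath ((A ++ seg r a i) ++ r i :: (seg r (i + 1) j ++ r j ::
          (seg r (j + 1) b ++ B))) := by simpa using h
      have h2 := h1.shortcut htri hdi hdj (by
        intro z hz
        simp only [List.mem_append] at hz
        rcases hz with (hz | hz) | hz | hz
        · exact hAB z (by simp [hz])
        · obtain ⟨k, h3, h4, rfl⟩ := mem_seg.1 hz
          exact ⟨(hd k h3 (by omega)).1, fun h => by have := (hd k h3 (by omega)).2 h; omega⟩
        · obtain ⟨k, h3, h4, rfl⟩ := mem_seg.1 hz
          exact ⟨(hd k (by omega) h4).1, fun h => by have := (hd k (by omega) h4).2 h; omega⟩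
        · exact hAB z (by simp [hz]))
      simpa using h2

/-- The hub formed by an induced path. -/
theorem IsIndPath.exists_isHub {a : V} {P : List V} (h : G.IsIndPath (a :: P)) :
    ∃ A B : Set V, G.IsHub A B ∧ a ∈ A ∧ (∀ x, x ∈ A ∨ x ∈ B ↔ x ∈ a :: P) ∧
      ∀ y, (a :: P).getLast? = some y → (Odd (a :: P).length → y ∈ A) := by
  suffices key : ∀ (P : List V) (a : V), G.IsIndPath (a :: P) →
      ∃ A B : Set V, G.IsHub A B ∧ a ∈ A ∧ (∀ x, x ∈ A ∨ x ∈ B ↔ x ∈ a :: P) ∧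
      ∀ y, (a :: P).getLast? = some y → (Odd (a :: P).length → y ∈ A) ∧
        (Even (a :: P).length → y ∈ B) by
    obtain ⟨A, B, h1, h2, h3, h4⟩ := key P a h
    exact ⟨A, B, h1, h2, h3, fun y hy => (h4 y hy).1⟩
  intro P
  induction P with
  | nil =>
    intro a _
    refine ⟨{a}, ∅, ⟨stable_singleton a, fun u hu => hu.elim, by simp, ?_⟩, rfl, by simp, ?_⟩
    · rw [Set.union_empty]; exact connSet_singleton a
    · intro y hy
      simp only [List.getLast?_singleton, Option.some.injEq] at hy
      subst hy
      simp
  | cons b P ih =>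
    intro a h
    obtain ⟨hab, h1, h2⟩ := isIndPath_cons_cons.1 h
    obtain ⟨A, B, hH, hb, hm, hy⟩ := ih b h2
    have haA : a ∉ A := fun h' => h.1 ((hm a).1 (Or.inl h'))
    have haB : a ∉ B := fun h' => h.1 ((hm a).1 (Or.inr h'))
    have haBn : ∀ x ∈ B, ¬ G.Adj a x := by
      intro x hx hax
      have hxP := (hm x).1 (Or.inr hx)
      rcases List.mem_cons.1 hxP with rfl | hxP
      · exact Set.disjoint_left.1 hH.disj hb hx
      · exact (h1 x hxP).2 hax
    refine ⟨insert a B, A, ⟨?_, hH.left, ?_, ?_⟩, Set.mem_insert _ _, ?_, ?_⟩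
    · rintro u (rfl | hu) v (rfl | hv) huv
      · exact G.loopless.irrefl _ huv
      · exact haBn v hv huv
      · exact haBn u hu huv.symm
      · exact hH.right u hu v hv huv
    · rw [Set.disjoint_left]
      rintro u (rfl | hu) huA
      · exact haA huA
      · exact Set.disjoint_left.1 hH.disj huA hu
    · have := hH.conn.insert (Or.inl hb) hab.symm
      rwa [Set.insert_union, Set.union_comm B A]
    · intro x
      rw [List.mem_cons, ← hm x, Set.mem_insert_iff]
      tauto
    · intro y hy'
      have : (b :: P).getLast? = some y := by
        rw [List.getLast?_cons] at hy'
        rw [List.getLast?_cons] at hy' ⊢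
        simpa using hy'
      have h3 := hy y this
      rw [List.length_cons, Nat.odd_add_one, Nat.even_add_one, Nat.not_odd_iff_even,
        Nat.not_even_iff_odd]
      exact ⟨fun h => Or.inr (h3.2 h), h3.1⟩

/-! ### Wheels whose rims have arcs of adjustable parity -/

/-- The arc between `x` and `x'` already has even interior. Each of the other two arcs contains
exactly one of the adjustable pieces `L` and `R`, so their interiors can be made even as well. -/
theorem IsTPerfect.flexible_wheel_false [Finite V] (hG : G.IsTPerfect) {Up Um : Set V}
    (hU : G.IsHub Up Um) {x x' s : V} {X₁ X₂ X₃ N₁ N₂ : List V} (hX₂ : Even X₂.length)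
    (hflex : ∀ p q : ℕ, ∃ L R : List V, L.length % 2 = p % 2 ∧ R.length % 2 = q % 2 ∧
      G.IsIndCycle (L ++ (X₁ ++ x :: X₂ ++ x' :: X₃) ++ R ++ (N₁ ++ s :: N₂)) ∧
      ∀ z ∈ L ++ (X₁ ++ x :: X₂ ++ x' :: X₃) ++ R ++ (N₁ ++ s :: N₂),
        z ∉ Up ∧ z ∉ Um ∧ z ∉ G.nbrs Um)
    (hx : x ∈ G.nbrs Up) (hx' : x' ∈ G.nbrs Up) (hs : s ∈ G.nbrs Up) : False := by
  obtain ⟨L, R, hL, hR, hc, hm⟩ := hflex (X₁.length + N₂.length) (X₃.length + N₁.length)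
  rw [show L ++ (X₁ ++ x :: X₂ ++ x' :: X₃) ++ R ++ (N₁ ++ s :: N₂) =
    (L ++ X₁) ++ (x :: X₂ ++ x' :: (X₃ ++ R ++ N₁) ++ s :: N₂) by simp] at hc hm
  have hc' := hc.rotate
  rw [show x :: X₂ ++ x' :: (X₃ ++ R ++ N₁) ++ s :: N₂ ++ (L ++ X₁) =
    x :: X₂ ++ x' :: (X₃ ++ R ++ N₁) ++ s :: (N₂ ++ L ++ X₁) by simp] at hc'
  refine hG.wheel_false hU hc' hX₂ ?_ ?_ (fun z hz => hm z ?_) hx hx' hs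
  · simp only [List.length_append]; rw [Nat.even_iff]; omega
  · simp only [List.length_append]; rw [Nat.even_iff]; omega
  · simp only [List.mem_append, List.mem_cons] at hz ⊢; tauto

/-- As in `flexible_wheel_false`, but the attachment in `s` goes through `u`. The rim neighbours `e`
and `a` of `s` leave the interiors of their arcs, which shifts both requested parities by one;
nonempty `L` and `R` guarantee that `e` and `a` exist outside the stretch from `x` to `x'`. -/
theorem IsTPerfect.flexible_pendant_false [Finite V] (hG : G.IsTPerfect) {Up Um : Set V}
    (hU : G.IsHub Up Um) {x x' s u : V} {X₁ X₂ X₃ N₁ N₂ : List V} (hX₂ : Even X₂.length)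
    (hflex : ∀ p q : ℕ, ∃ L R : List V, L.length % 2 = p % 2 ∧ R.length % 2 = q % 2 ∧
      L ≠ [] ∧ R ≠ [] ∧
      G.IsIndCycle (L ++ (X₁ ++ x :: X₂ ++ x' :: X₃) ++ R ++ (N₁ ++ s :: N₂)) ∧
      ∀ z ∈ L ++ (X₁ ++ x :: X₂ ++ x' :: X₃) ++ R ++ (N₁ ++ s :: N₂),
        (z ∉ Up ∧ z ∉ Um ∧ z ∉ G.nbrs Um) ∧ u ≠ z ∧ (G.Adj u z → z = s))
    (hx : x ∈ G.nbrs Up) (hx' : x' ∈ G.nbrs Up) (hs : s ∉ G.nbrs Up)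
    (hup : u ∉ Up) (hum : u ∉ Um) (huU : u ∈ G.nbrs Up) (hun : u ∉ G.nbrs Um)
    (hus : G.Adj u s) : False := by
  obtain ⟨L, R, hL, hR, hL0, hR0, hc, hm⟩ :=
    hflex (X₁.length + N₂.length + 1) (X₃.length + N₁.length + 1)
  obtain ⟨Y, e, hY⟩ : ∃ Y e, R ++ N₁ = Y ++ [e] := by
    rcases List.eq_nil_or_concat (R ++ N₁) with h | ⟨Y, e, h⟩
    · simp at h; tauto
    · exact ⟨Y, e, by rw [h, List.concat_eq_append]⟩
  obtain ⟨a, A, hA⟩ : ∃ a A, N₂ ++ L ++ X₁ = a :: A :=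
    List.exists_cons_of_ne_nil (by simp [hL0])
  have hYl := congrArg List.length hY
  have hAl := congrArg List.length hA
  simp only [List.length_append, List.length_cons, List.length_nil] at hYl hAl
  rw [show L ++ (X₁ ++ x :: X₂ ++ x' :: X₃) ++ R ++ (N₁ ++ s :: N₂) =
    (L ++ (X₁ ++ x :: X₂ ++ x' :: X₃) ++ (R ++ N₁) ++ [s]) ++ N₂ by simp, hY] at hc hm
  have hc' := hc.rotate
  rw [show N₂ ++ (L ++ (X₁ ++ x :: X₂ ++ x' :: X₃) ++ (Y ++ [e]) ++ [s]) =
    (N₂ ++ L ++ X₁) ++ x :: X₂ ++ x' :: (X₃ ++ Y) ++ [e, s] by simp, hA] at hc'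
  have hmem : ∀ z ∈ a :: A ++ x :: X₂ ++ x' :: (X₃ ++ Y) ++ [e, s],
      z ∈ (L ++ (X₁ ++ x :: X₂ ++ x' :: X₃) ++ (Y ++ [e]) ++ [s]) ++ N₂ := by
    intro z hz
    rw [← hA] at hz
    simp only [List.mem_append, List.mem_cons] at hz ⊢; tauto
  refine hG.wheel_false_of_pendant hU hc' ?_ hX₂ ?_ (fun z hz => (hm z (hmem z hz)).1) hx hx' hs
    hup hum huU hun hus fun z hz => (hm z (hmem z hz)).2
  · rw [Nat.even_iff]; omega
  · simp only [List.length_append]; rw [Nat.even_iff]; omega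

/-- Choose `t` least such that the part up to `t` is not `k`-colourable. Strictly below `t` there
are `k` colours, the slice at `t` takes `c`, so `e` colours cannot suffice above. -/
theorem exists_threshold {A : Set V} {lam : V → ℕ} {M c k e : ℕ} (hM : ∀ v ∈ A, lam v ≤ M)
    (hslice : ∀ t, G.ColOn c {v | v ∈ A ∧ lam v = t}) (hA : ¬ G.ColOn (k + c + e) A) :
    ∃ t, ¬ G.ColOn k {v | v ∈ A ∧ lam v ≤ t} ∧ ¬ G.ColOn e {v | v ∈ A ∧ t < lam v} := by
  classical
  have hex : ∃ t, ¬ G.ColOn k {v | v ∈ A ∧ lam v ≤ t} :=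
    ⟨M, fun h => hA (h.mono (by omega) fun v hv => ⟨hv, hM v hv⟩)⟩
  refine ⟨Nat.find hex, Nat.find_spec hex, fun he => hA ?_⟩
  have hlow : G.ColOn k {v | v ∈ A ∧ lam v < Nat.find hex} := by
    rcases Nat.eq_zero_or_pos (Nat.find hex) with h0 | h0
    · refine (colOn_empty k).subset ?_
      rintro v ⟨-, hv⟩
      omega
    · have := Nat.find_min hex (m := Nat.find hex - 1) (by omega)
      rw [not_not] at this
      refine this.subset ?_
      rintro v ⟨hv, hv'⟩
      exact ⟨hv, by omega⟩
  refine ((hlow.union (hslice (Nat.find hex))).union he).subset fun v hv => ?_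
  rcases lt_trichotomy (lam v) (Nat.find hex) with h | h | h
  · exact Or.inl (Or.inl ⟨hv, h⟩)
  · exact Or.inl (Or.inr ⟨hv, h⟩)
  · exact Or.inr ⟨hv, h⟩

/-- The attachments of `x` to `r 0, …, r T` lie between `i` and `j ≤ t`, which are attachments at odd
distance. -/
structure OddLetters (G : SimpleGraph V) (r : ℕ → V) (T t : ℕ) (x : V) (i j : ℕ) : Prop where
  lt : i < j
  le : j ≤ t
  odd : (j - i) % 2 = 1
  adj_left : G.Adj x (r i)
  adj_right : G.Adj x (r j)
  between : ∀ k ≤ T, G.Adj x (r k) → i ≤ k ∧ k ≤ j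

theorem IsIndexedPath.mono {T : ℕ} (h : G.IsIndexedPath r M) (hT : T ≤ M) :
    G.IsIndexedPath r T := fun i j hij hj => h i j hij (hj.trans hT)

namespace Comb

/-- A vertex `d v` off the detour `N` does not see the path at three alternating places. -/
theorem no_alternation (C : G.Comb H l m r M d0 g0 K d g lam) [Finite V] (hG : G.IsTPerfect)
    {w v : V} (hw : w ∈ K) (hv : v ∈ K) {N : List V}
    (hN : G.IsDetour H l m r d0 (lam w) (d w) N) (hodd : Odd (lam w + 1 + N.length))
    (hvN : d v ∉ N) {y₁ y₂ y₃ : ℕ} (h12 : y₁ < y₂) (h23 : y₂ < y₃) (h3 : y₃ ≤ lam w)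
    (ho12 : (y₂ - y₁) % 2 = 1) (ho23 : (y₃ - y₂) % 2 = 1) (h1a : G.Adj (d v) (r y₁))
    (h2a : G.Adj (d v) (r y₂)) (h3a : G.Adj (d v) (r y₃)) : False := by
  have hM := C.lam_le w hw
  have hpath := C.path.mono hM
  have hc := hN.isIndCycle (P := seg r 0 (lam w + 1)) (hpath.isIndPath_seg 0 _ le_rfl)
    (by rw [seg_cons r (by omega)]; rfl) (by rw [seg_concat r (by omega)]; simp) hpath
    (fun x hx => by
      obtain ⟨i, -, hi, rfl⟩ := mem_seg.1 hx
      exact Or.inl ⟨i, by omega, rfl⟩)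
  have hseg : seg r 0 (lam w + 1) = seg r 0 y₁ ++ (r y₁ :: seg r (y₁ + 1) y₂ ++
      r y₂ :: seg r (y₂ + 1) y₃ ++ r y₃ :: seg r (y₃ + 1) (lam w + 1)) := by
    rw [← seg_cons r h12, ← seg_cons r h23, ← seg_cons r (by omega : y₃ < lam w + 1),
      seg_append r h12.le h23.le, seg_append r (by omega) (by omega),
      seg_append r (by omega) (by omega)]
  have hmem : ∀ x ∈ seg r 0 (lam w + 1) ++ N, x ≠ d v := by
    intro x hx
    rcases List.mem_append.1 hx with hx | hx
    · obtain ⟨i, -, hi, rfl⟩ := mem_seg.1 hx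
      exact (C.ne_path (by have := C.d_mem v hv; omega) (by omega)).symm
    · rintro rfl; exact hvN hx
  rw [hseg, List.append_assoc] at hc hmem
  have hc' := hc.rotate
  rw [show r y₁ :: seg r (y₁ + 1) y₂ ++ r y₂ :: seg r (y₂ + 1) y₃ ++
      r y₃ :: seg r (y₃ + 1) (lam w + 1) ++ N ++ seg r 0 y₁ =
    r y₁ :: seg r (y₁ + 1) y₂ ++ r y₂ :: seg r (y₂ + 1) y₃ ++
      r y₃ :: (seg r (y₃ + 1) (lam w + 1) ++ N ++ seg r 0 y₁) by simp] at hc'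
  have hU : G.IsHub {d v} ∅ := ⟨stable_singleton _, fun u hu => hu.elim, by simp, by
    rw [Set.union_empty]; exact connSet_singleton _⟩
  refine hG.wheel_false hU hc' ?_ ?_ ?_ (fun x hx => ⟨?_, by simp, by simp [nbrs]⟩)
    ⟨d v, rfl, h1a⟩ ⟨d v, rfl, h2a⟩ ⟨d v, rfl, h3a⟩
  · rw [length_seg, Nat.even_iff]; omega
  · rw [length_seg, Nat.even_iff]; omega
  · simp only [List.length_append, length_seg]
    rw [Nat.odd_iff] at hodd
    rw [Nat.even_iff]; omega
  · refine hmem x ?_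
    simp only [List.mem_append, List.mem_cons] at hx ⊢
    tauto

/-- Regard the stretches up to `t` and beyond `t` as two path hubs. By `IsHub.colOn_eight`, eight
colours each cover the vertices whose `d v` sees a single parity class of a stretch. For the others
`d v` sees both parities up to `t`, and both or none beyond. Three attachments of alternating parity
are impossible, so there is none beyond `t`, and the first and last attachments have different
parity. -/
theorem colOn_not_oddLetters (C : G.Comb H l m r M d0 g0 K d g lam) [Finite V] (hG : G.IsTPerfect)
    {w : V} (hw : w ∈ K) {N : List V}
    (hN : G.IsDetour H l m r d0 (lam w) (d w) N) (hodd : Odd (lam w + 1 + N.length)) {t : ℕ}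
    (ht : t < lam w) :
    G.ColOn 16 {v | v ∈ K ∧ lam v ≤ t ∧ d v ∉ N ∧
      ¬ ∃ j, G.OddLetters r (lam w) t (d v) (lam v) j} := by
  classical
  have hM := C.lam_le w hw
  have h1 := (C.path.isHub 0 (t + 1) (by omega)).colOn_eight hG
  have h2 := (C.path.isHub (t + 1) (lam w + 1) (by omega)).colOn_eight hG
  refine (h1.union h2).subset ?_
  rintro v ⟨hv, hvt, hvN, hno⟩
  have hdv := C.d_mem v hv
  have hnK : ∀ a b, b ≤ M + 1 → ∀ p : ℕ → Prop, v ∉ {x | ∃ i, a ≤ i ∧ i < b ∧ p i ∧ r i = x} ∧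
      v ∉ G.nbrs {x | ∃ i, a ≤ i ∧ i < b ∧ p i ∧ r i = x} ∧
      d v ∉ {x | ∃ i, a ≤ i ∧ i < b ∧ p i ∧ r i = x} := by
    intro a b hb p
    refine ⟨?_, ?_, ?_⟩
    · rintro ⟨i, -, hi, -, h⟩
      exact (C.K_path v hv i (by omega)).1 h.symm
    · rintro ⟨_, ⟨i, -, hi, -, rfl⟩, h⟩
      exact (C.K_path v hv i (by omega)).2 h.symm
    · rintro ⟨i, -, hi, -, h⟩
      exact (C.ne_path (by omega) (by omega)) h.symm
  by_contra hcon
  rw [Set.mem_union, not_or] at hcon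
  have hsame : ∀ a b, b ≤ M + 1 → v ∉ {v | v ∉ {x | ∃ i, a ≤ i ∧ i < b ∧ Even i ∧ r i = x} ∧
      v ∉ {x | ∃ i, a ≤ i ∧ i < b ∧ Odd i ∧ r i = x} ∧
      v ∉ G.nbrs {x | ∃ i, a ≤ i ∧ i < b ∧ Even i ∧ r i = x} ∧
      v ∉ G.nbrs {x | ∃ i, a ≤ i ∧ i < b ∧ Odd i ∧ r i = x} ∧
      ∃ d, d ∉ {x | ∃ i, a ≤ i ∧ i < b ∧ Even i ∧ r i = x} ∧
        d ∉ {x | ∃ i, a ≤ i ∧ i < b ∧ Odd i ∧ r i = x} ∧ G.Adj d v ∧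
        ¬ (d ∈ G.nbrs {x | ∃ i, a ≤ i ∧ i < b ∧ Even i ∧ r i = x} ↔
          d ∈ G.nbrs {x | ∃ i, a ≤ i ∧ i < b ∧ Odd i ∧ r i = x})} →
      ∀ i, a ≤ i → i < b → G.Adj (d v) (r i) →
        ∃ i', a ≤ i' ∧ i' < b ∧ i' % 2 ≠ i % 2 ∧ G.Adj (d v) (r i') := by
    intro a b hb hvn i hai hib hadj
    have he := hnK a b hb Even
    have ho := hnK a b hb Odd
    have hiff : d v ∈ G.nbrs {x | ∃ i, a ≤ i ∧ i < b ∧ Even i ∧ r i = x} ↔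
        d v ∈ G.nbrs {x | ∃ i, a ≤ i ∧ i < b ∧ Odd i ∧ r i = x} := by
      by_contra h
      exact hvn ⟨he.1, ho.1, he.2.1, ho.2.1, d v, he.2.2, ho.2.2, hdv.2.2, h⟩
    rcases Nat.even_or_odd i with hi | hi
    · obtain ⟨_, ⟨i', h3, h4, h5, rfl⟩, h6⟩ := hiff.1 ⟨r i, ⟨i, hai, hib, hi, rfl⟩, hadj.symm⟩
      refine ⟨i', h3, h4, ?_, h6.symm⟩
      rw [Nat.even_iff] at hi; rw [Nat.odd_iff] at h5; omega
    · obtain ⟨_, ⟨i', h3, h4, h5, rfl⟩, h6⟩ := hiff.2 ⟨r i, ⟨i, hai, hib, hi, rfl⟩, hadj.symm⟩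
      refine ⟨i', h3, h4, ?_, h6.symm⟩
      rw [Nat.odd_iff] at hi; rw [Nat.even_iff] at h5; omega
  have hlow := hsame 0 (t + 1) (by omega) hcon.1
  have hup := hsame (t + 1) (lam w + 1) (by omega) hcon.2
  have halt : ∀ y₁ y₂ y₃, y₁ < y₂ → y₂ < y₃ → y₃ ≤ lam w → y₁ % 2 ≠ y₂ % 2 → y₂ % 2 ≠ y₃ % 2 →
      G.Adj (d v) (r y₁) → G.Adj (d v) (r y₂) → G.Adj (d v) (r y₃) → False :=
    fun y₁ y₂ y₃ h12 h23 h3 ho12 ho23 => C.no_alternation hG hw hv hN hodd hvN h12 h23 h3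
      (by omega) (by omega)
  have hadj := C.adj_lam v hv
  have hfirst : ∀ i, G.Adj (d v) (r i) → lam v ≤ i := fun i hi => by
    by_contra h
    exact C.not_adj_lt v hv i (by omega) hi
  obtain ⟨i, -, hi, hpar, hai⟩ := hlow (lam v) (by omega) (by omega) hadj
  have hvi := hfirst i hai
  -- no attachments above `t`
  have hnone : ∀ k, t < k → k ≤ lam w → ¬ G.Adj (d v) (r k) := by
    intro k htk hk hadjk
    obtain ⟨k', h3, h4, h5, h6⟩ := hup k (by omega) (by omega) hadjk
    by_cases h7 : k % 2 = i % 2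
    · exact halt (lam v) i k' (by omega) (by omega) (by omega) (by omega) (by omega) hadj hai h6
    · exact halt (lam v) i k (by omega) (by omega) (by omega) (by omega) (by omega) hadj hai hadjk
  obtain ⟨j, hj, hmax⟩ := ((Finset.range (t + 1)).filter fun k => G.Adj (d v) (r k)).exists_max_image
    id ⟨i, by simp [hi, hai]⟩
  simp only [Finset.mem_filter, Finset.mem_range, id] at hj hmax
  have hij := hmax i ⟨by omega, hai⟩
  refine hno ⟨j, by omega, by omega, ?_, hadj, hj.2, fun k hk hadjk => ⟨hfirst k hadjk, ?_⟩⟩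
  · by_contra hne
    have : i ≠ j := by rintro rfl; omega
    exact halt (lam v) i j (by omega) (by omega) (by omega) (by omega) (by omega) hadj hai hj.2
  · by_contra hkj
    by_cases hkt : k ≤ t
    · have := hmax k ⟨by omega, hadjk⟩; omega
    · exact hnone k (by omega) hk hadjk

/-- A vertex with odd letters whose `d`-neighbour avoids the detour and three further vertices. -/
theorem exists_oddLetters (C : G.Comb H l m r M d0 g0 K d g lam) [Finite V] (hG : G.IsTPerfect)
    {w : V} (hw : w ∈ K) {N D : List V}
    (hN : G.IsDetour H l m r d0 (lam w) (d w) N) (hodd : Odd (lam w + 1 + N.length))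
    (hD : D.length ≤ 7) (hND : ∀ x ∈ N, x ∈ D ∨ l x + 3 ≤ m) {t : ℕ} (ht : t < lam w)
    {F : List V} (hF : F.length ≤ 3) {S : Set V} (hS : ¬ G.ColOn 43 S)
    (hSK : ∀ v ∈ S, v ∈ K ∧ lam v ≤ t) :
    ∃ v ∈ S, d v ∉ N ∧ (∀ x ∈ N, ¬ G.Adj x (d v)) ∧ (∀ x ∈ F, ¬ G.Adj x (d v)) ∧
      ∃ j, G.OddLetters r (lam w) t (d v) (lam v) j := by
  have h1 := C.colOn_not_oddLetters hG hw hN hodd ht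
  have h2 := colOn_of_list (fun x => colOn_nbrs_singleton C.tri x) D
  have h3 := colOn_of_list (fun x => colOn_nbrs_nbrs hG C.tri x) D
  have h4 := colOn_of_list (fun x => colOn_nbrs_nbrs hG C.tri x) F
  by_contra hcon
  push Not at hcon
  -- The 43 colours are 16 for vertices without odd letters, 7 for those with `d v` in `D`, 14 for
  -- those with `d v` adjacent to `D`, and 6 for those with `d v` adjacent to `F`.
  refine hS (((h1.union h2).union (h3.union h4)).mono (by omega) ?_)
  intro v hv
  obtain ⟨hvK, hvt⟩ := hSK v hv
  have hdv := C.d_mem v hvK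
  by_cases hvD : d v ∈ D
  · exact Or.inl (Or.inr ⟨d v, hvD, mem_nbrs_singleton.2 hdv.2.2⟩)
  have hvN : d v ∉ N := fun h => by
    rcases hND _ h with h | h
    · exact hvD h
    · omega
  by_cases hx : ∃ x ∈ D, G.Adj x (d v)
  · obtain ⟨x, hx, hxv⟩ := hx
    exact Or.inr (Or.inl ⟨x, hx, d v, mem_nbrs_singleton.2 hxv, hdv.2.2⟩)
  by_cases hx' : ∃ x ∈ F, G.Adj x (d v)
  · obtain ⟨x, hx, hxv⟩ := hx'
    exact Or.inr (Or.inr ⟨x, hx, d v, mem_nbrs_singleton.2 hxv, hdv.2.2⟩)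
  push Not at hx hx'
  refine Or.inl (Or.inl ⟨hvK, hvt, hvN, ?_⟩)
  rintro ⟨j, hj⟩
  refine hcon v hv hvN (fun x hxN => ?_) hx' j hj
  rcases hND x hxN with h | h
  · exact hx x h
  · exact C.not_adj (hN.mem x hxN) hdv.1 (by omega)

/-- With two shortcuts the rim through a detour is flexible. -/
theorem exists_flexible_rim (C : G.Comb H l m r M d0 g0 K d g lam) {w b₁ b₂ : V} (hw : w ∈ K)
    (hb₁ : b₁ ∈ K) (hb₂ : b₂ ∈ K) {N : List V} (hN : G.IsDetour H l m r d0 (lam w) (d w) N)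
    {t₁ t₂ t₃ j₁ j₂ : ℕ} (h12 : t₁ < t₂) (h23 : t₂ < lam b₂) (h3 : t₃ < lam w)
    (ho₁ : G.OddLetters r (lam w) t₁ (d b₁) (lam b₁) j₁)
    (ho₂ : G.OddLetters r (lam w) t₃ (d b₂) (lam b₂) j₂)
    (hN₁ : ∀ x ∈ N, d b₁ ≠ x ∧ ¬ G.Adj (d b₁) x) (hN₂ : ∀ x ∈ N, d b₂ ≠ x ∧ ¬ G.Adj (d b₂) x)
    (hbb : ¬ G.Adj (d b₁) (d b₂)) (p q : ℕ) :
    ∃ L R : List V, L.length % 2 = p % 2 ∧ R.length % 2 = q % 2 ∧ L ≠ [] ∧ R ≠ [] ∧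
      G.IsIndCycle (L ++ seg r (t₁ + 1) (t₂ + 1) ++ R ++ N) ∧
      ∀ z ∈ L ++ seg r (t₁ + 1) (t₂ + 1) ++ R ++ N,
        (∃ i ≤ lam w, r i = z) ∨ z = d b₁ ∨ z = d b₂ ∨ z ∈ N := by
  have hM := C.lam_le w hw
  have hpath := C.path.mono hM
  have e1 := ho₁.lt
  have e2 := ho₁.le
  have e3 := ho₂.lt
  have e4 := ho₂.le
  have hne₁ : ∀ k ≤ lam w, r k ≠ d b₁ := fun k hk =>
    (C.ne_path (by have := C.d_mem b₁ hb₁; omega) (by omega)).symm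
  have hne₂ : ∀ k ≤ lam w, r k ≠ d b₂ := fun k hk =>
    (C.ne_path (by have := C.d_mem b₂ hb₂; omega) (by omega)).symm
  have hdd : d b₁ ≠ d b₂ := by
    intro h
    have := ho₂.between (lam b₁) (by omega) (h ▸ ho₁.adj_left)
    omega
  obtain ⟨L, hL1, hL2, hL3, hL4, hL5⟩ := exists_seg_of_parity C.tri (r := r) (a := 0) (b := t₁ + 1)
    (Nat.zero_le _) ho₁.lt (by omega) ho₁.odd ho₁.adj_left ho₁.adj_right
    (fun k _ hk => ⟨hne₁ k (by omega), ho₁.between k (by omega)⟩) p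
  obtain ⟨R, hR1, hR2, hR3, hR4, hR5⟩ := exists_seg_of_parity C.tri (r := r) (a := t₂ + 1)
    (b := lam w + 1) (by omega) ho₂.lt (by omega) ho₂.odd ho₂.adj_left ho₂.adj_right
    (fun k _ hk => ⟨hne₂ k (by omega), ho₂.between k (by omega)⟩) q
  have hL0 : L ≠ [] := by rintro rfl; simp at hL2
  have hR0 : R ≠ [] := by rintro rfl; simp at hR2
  have h0 : G.IsIndPath ([] ++ seg r 0 (t₁ + 1) ++
      (seg r (t₁ + 1) (t₂ + 1) ++ seg r (t₂ + 1) (lam w + 1))) := by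
    rw [List.nil_append, seg_append r (by omega) (by omega), seg_append r (by omega) (by omega)]
    exact hpath.isIndPath_seg 0 _ le_rfl
  have h1 := hL5 _ _ h0 (by
    intro x hx
    rw [List.nil_append, seg_append r (by omega) (by omega)] at hx
    obtain ⟨k, hk1, hk2, rfl⟩ := mem_seg.1 hx
    exact ⟨hne₁ k (by omega), fun h => by have := (ho₁.between k (by omega) h).2; omega⟩)
  have h2 := hR5 (L ++ seg r (t₁ + 1) (t₂ + 1)) [] (by simpa using h1) (by
    intro x hx
    rw [List.append_nil] at hx
    have hseg : ∀ k ≤ t₂, r k ≠ d b₂ ∧ ¬ G.Adj (d b₂) (r k) := fun k hk =>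
      ⟨hne₂ k (by omega), fun h => by have := (ho₂.between k (by omega) h).1; omega⟩
    rcases List.mem_append.1 hx with hx | hx
    · rcases hL4 x hx with hx | rfl
      · obtain ⟨k, hk1, hk2, rfl⟩ := mem_seg.1 hx
        exact hseg k (by omega)
      · exact ⟨hdd, fun h => hbb h.symm⟩
    · obtain ⟨k, hk1, hk2, rfl⟩ := mem_seg.1 hx
      exact hseg k (by omega))
  rw [List.append_nil] at h2
  have hmem : ∀ x ∈ L ++ seg r (t₁ + 1) (t₂ + 1) ++ R,
      (∃ i ≤ lam w, r i = x) ∨ x = d b₁ ∨ x = d b₂ := by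
    intro x hx
    simp only [List.mem_append] at hx
    rcases hx with (hx | hx) | hx
    · rcases hL4 x hx with hx | hx
      · obtain ⟨k, hk1, hk2, rfl⟩ := mem_seg.1 hx
        exact Or.inl ⟨k, by omega, rfl⟩
      · exact Or.inr (Or.inl hx)
    · obtain ⟨k, hk1, hk2, rfl⟩ := mem_seg.1 hx
      exact Or.inl ⟨k, by omega, rfl⟩
    · rcases hR4 x hx with hx | hx
      · obtain ⟨k, hk1, hk2, rfl⟩ := mem_seg.1 hx
        exact Or.inl ⟨k, by omega, rfl⟩
      · exact Or.inr (Or.inr hx)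
  refine ⟨L, R, hL1, hR1, hL0, hR0, hN.isIndCycle h2 ?_ ?_ hpath ?_, ?_⟩
  · rw [List.append_assoc, List.head?_append, hL2]; rfl
  · rw [List.getLast?_append, hR3]; rfl
  · intro x hx
    rcases hmem x hx with h | rfl | rfl
    · exact Or.inl h
    · exact Or.inr hN₁
    · exact Or.inr hN₂
  · intro z hz
    rcases List.mem_append.1 hz with hz | hz
    · rcases hmem z hz with h | h | h
      exacts [Or.inl h, Or.inr (Or.inl h), Or.inr (Or.inr (Or.inl h))]
    · exact Or.inr (Or.inr (Or.inr hz))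

end Comb

/-- A detour may be rerouted through a vertex seeing it at least twice. -/
theorem IsDetour.reroute (htri : G.CliqueFree 3) {t : ℕ} {u x y z : V} {N₁ N₂ N₃ : List V}
    (hN : G.IsDetour H l m r d0 t u (N₁ ++ x :: (N₂ ++ y :: N₃))) (hx : G.Adj z x) (hy : G.Adj z y)
    (hz : ∀ w ∈ N₁ ++ N₃, w ≠ z ∧ ¬ G.Adj z w) (hzH : z ∈ H) (hzu : z ≠ u) (hz0 : z ≠ d0)
    (hzr : ∀ i ≤ t, z ≠ r i ∧ ¬ G.Adj z (r i)) :
    G.IsDetour H l m r d0 t u (N₁ ++ x :: z :: y :: N₃) := by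
  have hmem : ∀ w ∈ N₁ ++ x :: z :: y :: N₃, w = z ∨ w ∈ N₁ ++ x :: (N₂ ++ y :: N₃) := by
    intro w hw
    simp only [List.mem_append, List.mem_cons] at hw ⊢
    tauto
  refine ⟨hN.path.shortcut htri hx hy hz, ?_, ?_, ?_, ?_⟩
  · have := hN.head
    rw [List.head?_append] at this ⊢
    simpa using this
  · have := hN.last
    rw [show N₁ ++ x :: (N₂ ++ y :: N₃) = (N₁ ++ x :: N₂) ++ y :: N₃ by simp,
      List.getLast?_append_of_ne_nil _ (by simp)] at this
    rw [show N₁ ++ x :: z :: y :: N₃ = (N₁ ++ [x, z]) ++ y :: N₃ by simp,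
      List.getLast?_append_of_ne_nil _ (by simp)]
    exact this
  · intro w hw
    rcases hmem w hw with rfl | h
    exacts [hzH, hN.mem w h]
  · intro w hw i hi
    rcases hmem w hw with rfl | h
    · exact cross_of_not_adj hzr hzu hz0 hi
    · exact hN.cross w h i hi

namespace Comb

/-- The shortcuts `d b₁` and `d b₂` act on the path before and after the stretch in which `d b` has
its odd letters, so the rim through the detour is flexible. The leg is an induced path from `d b`
through the lower levels to the first vertex `y` touching the detour. It provides two attachments on
the stretch through `d b` and a third one on the detour. -/
theorem leg_false (C : G.Comb H l m r M d0 g0 K d g lam) [Finite V] (hG : G.IsTPerfect)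
    {w b b₁ b₂ : V} (hw : w ∈ K) (hb : b ∈ K) (hb₁ : b₁ ∈ K) (hb₂ : b₂ ∈ K) {N : List V}
    (hN : G.IsDetour H l m r d0 (lam w) (d w) N)
    {t₁ t₂ t₃ j j₁ j₂ : ℕ} (h12 : t₁ < t₂) (h1b : t₁ < lam b) (h23 : t₂ < lam b₂) (h3 : t₃ < lam w)
    (ho : G.OddLetters r (lam w) t₂ (d b) (lam b) j)
    (ho₁ : G.OddLetters r (lam w) t₁ (d b₁) (lam b₁) j₁)
    (ho₂ : G.OddLetters r (lam w) t₃ (d b₂) (lam b₂) j₂)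
    (hbN : d b ∉ N)
    (hN₁ : ∀ x ∈ N, d b₁ ≠ x ∧ ¬ G.Adj (d b₁) x) (hN₂ : ∀ x ∈ N, d b₂ ≠ x ∧ ¬ G.Adj (d b₂) x)
    (hbb : ¬ G.Adj (d b₁) (d b₂))
    (hgb₁ : ¬ G.Adj (g b) (d b₁)) (hgb₂ : ¬ G.Adj (g b) (d b₂)) : False := by
  have hM := C.lam_le w hw
  have e1 := ho.lt
  have e2 := ho.le
  have e3 := ho₁.lt
  have e4 := ho₁.le
  have e5 := ho₂.lt
  have e6 := ho₂.le
  have hd := C.d_mem b hb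
  have hd₁ := C.d_mem b₁ hb₁
  have hd₂ := C.d_mem b₂ hb₂
  have hg := C.g_mem b hb
  have hg0 := C.g0_mem
  have hd0N : d0 ∈ N := List.mem_of_getLast? hN.last
  -- the leg
  obtain ⟨E, y, hE1, hE2, hE3, hE4, hE5⟩ := (C.conn b hb).exists_isIndPath (by simp)
    (fun y => y ∈ N ∨ ∃ x ∈ N, G.Adj y x) (Or.inr ⟨d0, hd0N, hg0.2.2⟩)
  have hyN : y ∉ N := by
    intro hy
    rcases List.eq_nil_or_concat E with rfl | ⟨E', e, rfl⟩
    · simp only [List.nil_append, List.head?_cons, Option.some.injEq] at hE2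
      exact hbN (hE2 ▸ hy)
    · refine hE4 e (by simp) (Or.inr ⟨y, hy, ?_⟩)
      rw [List.concat_eq_append, List.append_assoc] at hE1
      exact (isIndPath_cons_cons.1 hE1.right).1
  have hyN' : ∃ x ∈ N, G.Adj y x := hE3.resolve_left hyN
  have hEN : ∀ e ∈ E, e ∉ N ∧ ∀ x ∈ N, ¬ G.Adj e x := by
    intro e he
    have := hE4 e he
    push Not at this
    exact this
  have hlegN : ∀ e ∈ E ++ [y], e ∉ N := by
    intro e he
    rcases List.mem_append.1 he with he | he
    · exact (hEN e he).1
    · rw [List.mem_singleton] at he; rwa [he]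
  have hlow : ∀ e ∈ E ++ [y], e ≠ d b → e ∈ H ∧ l e + 2 ≤ m ∧ ¬ G.Adj e (d b₁) ∧
      ¬ G.Adj e (d b₂) := by
    intro e he hne
    have := hE5 e he
    simp only [Set.mem_union, Set.mem_insert_iff, Set.mem_singleton_iff, Set.mem_ofPred_eq] at this
    rcases this with (rfl | rfl | rfl) | ⟨h1, h2⟩
    · exact (hne rfl).elim
    · exact ⟨hg.1, by omega, hgb₁, hgb₂⟩
    · exact ⟨hg0.1, by omega, fun h => C.d_g0 b₁ hb₁ h.symm, fun h => C.d_g0 b₂ hb₂ h.symm⟩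
    · exact ⟨h1, by omega, C.not_adj h1 hd₁.1 (by omega), C.not_adj h1 hd₂.1 (by omega)⟩
  have hrim1 : ∀ e ∈ E ++ [y], (∀ i ≤ lam w, e ≠ r i) ∧ e ≠ d b₁ ∧ e ≠ d b₂ := by
    intro e he
    by_cases hne : e = d b
    · subst hne
      refine ⟨fun i hi => C.ne_path (by omega) (by omega), fun h => ?_, fun h => ?_⟩
      · exact C.not_adj_lt b hb (lam b₁) (by omega) (h ▸ ho₁.adj_left)
      · exact C.not_adj_lt b₂ hb₂ (lam b) (by omega) (h ▸ ho.adj_left)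
    · obtain ⟨h1, h2, -, -⟩ := hlow e he hne
      exact ⟨fun i hi => C.ne_path (by omega) (by omega), by rintro rfl; omega,
        by rintro rfl; omega⟩
  have hrim2 : ∀ e ∈ E ++ [y], e ≠ d b → (∀ i ≤ lam w, ¬ G.Adj e (r i)) ∧ ¬ G.Adj e (d b₁) ∧
      ¬ G.Adj e (d b₂) := by
    intro e he hne
    obtain ⟨h1, h2, h3, h4⟩ := hlow e he hne
    refine ⟨fun i hi => ?_, h3, h4⟩
    have := C.path_mem i (by omega)
    exact C.not_adj h1 this.1 (by omega)
  have hX : seg r (t₁ + 1) (t₂ + 1) = seg r (t₁ + 1) (lam b) ++ r (lam b) :: seg r (lam b + 1) j ++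
      r j :: seg r (j + 1) (t₂ + 1) := by
    rw [← seg_cons r (by omega : j < t₂ + 1), List.append_assoc, List.cons_append,
      seg_append r (by omega) (by omega), ← seg_cons r (by omega : lam b < t₂ + 1),
      seg_append r (by omega) (by omega)]
  have hX₂ : Even (seg r (lam b + 1) j).length := by
    have := ho.odd
    rw [length_seg, Nat.even_iff]; omega
  -- the hub misses the rim appropriately
  have hdisj : ∀ (Up Um : Set V) (N' : List V), d b ∈ Up → Disjoint Up Um →
      (∀ e, e ∈ Up ∨ e ∈ Um → e ∈ E ++ [y] ∧ e ∉ N') → (∀ e ∈ Um, ∀ x ∈ N', ¬ G.Adj e x) →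
      ∀ z, (∃ i ≤ lam w, r i = z) ∨ z = d b₁ ∨ z = d b₂ ∨ z ∈ N' →
        z ∉ Up ∧ z ∉ Um ∧ z ∉ G.nbrs Um := by
    intro Up Um N' hdU hdj hmem hadj z hz
    have key : ∀ e, e ∈ Up ∨ e ∈ Um → e ≠ z := by
      intro e he
      obtain ⟨h1, h2⟩ := hmem e he
      obtain ⟨h3, h4, h5⟩ := hrim1 e h1
      rcases hz with ⟨i, hi, rfl⟩ | rfl | rfl | hz
      exacts [h3 i hi, h4, h5, fun h => h2 (h ▸ hz)]
    refine ⟨fun h => key z (Or.inl h) rfl, fun h => key z (Or.inr h) rfl, ?_⟩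
    rintro ⟨e, he, hez⟩
    have hne : e ≠ d b := by
      rintro rfl
      exact Set.disjoint_left.1 hdj hdU he
    obtain ⟨h3, h4, h5⟩ := hrim2 e (hmem e (Or.inr he)).1 hne
    rcases hz with ⟨i, hi, rfl⟩ | rfl | rfl | hz
    exacts [h3 i hi hez, h4 hez, h5 hez, hadj e he z hz hez]
  have hatt : ∀ Up : Set V, d b ∈ Up → r (lam b) ∈ G.nbrs Up ∧ r j ∈ G.nbrs Up := fun Up h =>
    ⟨⟨d b, h, ho.adj_left⟩, ⟨d b, h, ho.adj_right⟩⟩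
  -- With an odd number of vertices `d b` and `y` lie on the same side, and the whole leg is the
  -- hub. With an even number `y` must be treated separately.
  rcases Nat.even_or_odd (E ++ [y]).length with hpar | hpar
  swap
  · obtain ⟨P, hP⟩ := List.head?_eq_some_iff.1 hE2
    rw [hP] at hE1 hpar
    obtain ⟨Up, Um, hU, hdU, hmU, hlU⟩ := hE1.exists_isHub
    rw [← hP] at hmU hlU
    rw [← hP] at hpar
    have hyU := hlU y (by simp) hpar
    obtain ⟨s, hs, hys⟩ := hyN'
    obtain ⟨N₁, N₂, rfl⟩ := List.append_of_mem hs
    have hE' : ∀ e ∈ Um, e ∈ E := by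
      intro e he
      rcases List.mem_append.1 ((hmU e).1 (Or.inr he)) with h | h
      · exact h
      · rw [List.mem_singleton] at h
        exact (Set.disjoint_left.1 hU.disj hyU (h ▸ he)).elim
    refine hG.flexible_wheel_false hU (X₁ := seg r (t₁ + 1) (lam b)) (X₃ := seg r (j + 1) (t₂ + 1))
      (N₁ := N₁) (N₂ := N₂) hX₂ (fun p q => ?_) (hatt Up hdU).1 (hatt Up hdU).2 ⟨y, hyU, hys⟩
    obtain ⟨L, R, hL, hR, -, -, hc, hm⟩ := C.exists_flexible_rim hw hb₁ hb₂ hN h12 h23 h3 ho₁ ho₂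
      hN₁ hN₂ hbb p q
    rw [hX] at hc hm
    exact ⟨L, R, hL, hR, hc, fun z hz => hdisj Up Um _ hdU hU.disj
      (fun e he => ⟨(hmU e).1 he, hlegN e ((hmU e).1 he)⟩)
      (fun e he => (hEN e (hE' e he)).2) z (hm z hz)⟩
  · -- the last vertex of the leg is dropped from the hub
    have hE0 : E ≠ [] := by rintro rfl; simp at hpar
    obtain ⟨P, hP⟩ : ∃ P, E = d b :: P := by
      obtain ⟨a, P, rfl⟩ := List.exists_cons_of_ne_nil hE0
      simp only [List.cons_append, List.head?_cons, Option.some.injEq] at hE2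
      exact ⟨P, by rw [hE2]⟩
    have hEp : G.IsIndPath E := hE1.left
    have hcross := (isIndPath_append.1 hE1).2.2
    have hparE : Odd E.length := by
      simp only [List.length_append, List.length_cons, List.length_nil] at hpar
      rw [Nat.even_iff] at hpar; rw [Nat.odd_iff]; omega
    rw [hP] at hEp
    obtain ⟨Up, Um, hU, hdU, hmU, hlU⟩ := hEp.exists_isHub
    rw [← hP] at hmU hlU
    have hlastE : E.getLast? = some (E.getLast hE0) := List.getLast?_eq_some_getLast hE0
    have heU := hlU _ hlastE hparE
    have hyE : y ∉ E := fun h => ((hcross y h y (by simp)).1 rfl)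
    have hyUp : y ∉ Up := fun h => hyE ((hmU y).1 (Or.inl h))
    have hyUm : y ∉ Um := fun h => hyE ((hmU y).1 (Or.inr h))
    have heY : G.Adj (E.getLast hE0) y :=
      (hcross _ (List.getLast_mem hE0) y (by simp)).2.2 ⟨hlastE, by simp⟩
    have hyn : ∀ e ∈ Um, ¬ G.Adj e y := by
      intro e he hey
      have := ((hcross e ((hmU e).1 (Or.inr he)) y (by simp)).2.1 hey).1
      rw [hlastE, Option.some.injEq] at this
      exact Set.disjoint_left.1 hU.disj heU (this ▸ he)
    have hydb : y ≠ d b := by rintro rfl; exact hyE (by simp [hP])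
    have hyr := hrim1 y (by simp)
    have hyr' := hrim2 y (by simp) hydb
    obtain ⟨N₁, s, R₀, rfl, hys, hN₁'⟩ := exists_split_first hyN'
    -- If `y` sees the detour at least twice, reroute the detour through `y` between its first and
    -- last neighbours there. Then `y` is a rim vertex, attached to the end of the shortened leg.
    by_cases hR₀ : ∃ z ∈ R₀, G.Adj y z
    · obtain ⟨N₂, s', N₃, rfl, hys', hN₃⟩ := exists_split_last hR₀
      have hylow := hlow y (by simp) hydb
      have hdw := C.d_mem w hw
      have hN' := hN.reroute C.tri hys hys' (z := y) (by
        intro z hz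
        rcases List.mem_append.1 hz with hz | hz
        · exact ⟨by rintro rfl; exact hyN (by simp [hz]), hN₁' z hz⟩
        · exact ⟨by rintro rfl; exact hyN (by simp [hz]), hN₃ z hz⟩) hylow.1
        (by rintro rfl; omega) (by rintro rfl; exact hyN hd0N)
        (fun i hi => ⟨hyr.1 i hi, hyr'.1 i hi⟩)
      have hsub : ∀ z ∈ N₁ ++ s :: y :: s' :: N₃, z = y ∨ z ∈ N₁ ++ s :: (N₂ ++ s' :: N₃) := by
        intro z hz
        simp only [List.mem_append, List.mem_cons] at hz ⊢
        tauto
      refine hG.flexible_wheel_false hU (X₁ := seg r (t₁ + 1) (lam b))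
        (X₃ := seg r (j + 1) (t₂ + 1)) (N₁ := N₁ ++ [s]) (N₂ := s' :: N₃) hX₂ (fun p q => ?_)
        (hatt Up hdU).1 (hatt Up hdU).2 ⟨_, heU, heY⟩
      obtain ⟨L, R, hL, hR, -, -, hc, hm⟩ := C.exists_flexible_rim hw hb₁ hb₂ hN' h12 h23 h3 ho₁
        ho₂ (fun z hz => by
          rcases hsub z hz with rfl | hz
          · exact ⟨hyr.2.1.symm, fun h => hyr'.2.1 h.symm⟩
          · exact hN₁ z hz) (fun z hz => by
          rcases hsub z hz with rfl | hz
          · exact ⟨hyr.2.2.symm, fun h => hyr'.2.2 h.symm⟩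
          · exact hN₂ z hz) hbb p q
      rw [hX, show N₁ ++ s :: y :: s' :: N₃ = N₁ ++ [s] ++ y :: s' :: N₃ by simp] at hc hm
      refine ⟨L, R, hL, hR, hc, fun z hz => hdisj Up Um (N₁ ++ [s] ++ y :: s' :: N₃) hdU hU.disj
        (fun e he => ?_) (fun e he x hx => ?_) z (hm z hz)⟩
      · have heE := (hmU e).1 he
        refine ⟨by simp [heE], fun h => ?_⟩
        rcases hsub e (by simpa using h) with rfl | h
        · exact hyE heE
        · exact (hEN e heE).1 h
      · rcases hsub x (by simpa using hx) with rfl | h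
        · exact hyn e he
        · exact (hEN e ((hmU e).1 (Or.inr he))).2 x h
    -- Here `y` sees the detour only in `s`, so it plays the role of the pendant vertex.
    · push Not at hR₀
      refine hG.flexible_pendant_false hU (u := y) (X₁ := seg r (t₁ + 1) (lam b))
        (X₃ := seg r (j + 1) (t₂ + 1)) (N₁ := N₁) (N₂ := R₀) (s := s) hX₂ (fun p q => ?_)
        (hatt Up hdU).1 (hatt Up hdU).2 ?_ hyUp hyUm ⟨_, heU, heY⟩ ?_ hys
      · obtain ⟨L, R, hL, hR, hL0, hR0, hc, hm⟩ := C.exists_flexible_rim hw hb₁ hb₂ hN h12 h23 h3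
          ho₁ ho₂ hN₁ hN₂ hbb p q
        rw [hX] at hc hm
        refine ⟨L, R, hL, hR, hL0, hR0, hc, fun z hz => ⟨hdisj Up Um _ hdU hU.disj
          (fun e he => ⟨by simp [(hmU e).1 he], (hEN e ((hmU e).1 he)).1⟩)
          (fun e he => (hEN e ((hmU e).1 (Or.inr he))).2) z (hm z hz), ?_, ?_⟩⟩
        · rcases hm z hz with ⟨i, hi, rfl⟩ | rfl | rfl | h
          exacts [hyr.1 i hi, hyr.2.1, hyr.2.2, fun h' => hyN (h' ▸ h)]
        · intro hyz
          rcases hm z hz with ⟨i, hi, rfl⟩ | rfl | rfl | h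
          · exact (hyr'.1 i hi hyz).elim
          · exact (hyr'.2.1 hyz).elim
          · exact (hyr'.2.2 hyz).elim
          · simp only [List.mem_append, List.mem_cons] at h
            rcases h with h | h | h
            · exact (hN₁' z h hyz).elim
            · exact h
            · exact (hR₀ z h hyz).elim
      · rintro ⟨e, he, hes⟩
        exact (hEN e ((hmU e).1 (Or.inl he))).2 s (by simp) hes
      · rintro ⟨e, he, hey⟩
        exact hyn e he hey

/-- Three thresholds of `lam` separate four bands: `b₁`, `b`, `b₂` are found in the first three, and
`w`, whose odd detour closes the rim, in the last. Each of the first three bands must exceed the 43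
colours of `exists_oddLetters`, each threshold slice costs 2, and the last band only has to be
nonempty: 3 * (43 + 2) = 135. -/
theorem colOn_oddDetour (C : G.Comb H l m r M d0 g0 K d g lam) [Finite V] (hG : G.IsTPerfect) :
    G.ColOn 135 {v | v ∈ K ∧ C.OddDetour v} := by
  by_contra hA
  have hsl : ∀ A ⊆ K, ∀ t, G.ColOn 2 {v | v ∈ A ∧ lam v = t} := fun A hA t =>
    (C.colOn_slice hG t).subset fun v hv => ⟨hA hv.1, hv.2⟩
  have hA1 : {v | v ∈ K ∧ C.OddDetour v} ⊆ K := fun v hv => hv.1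
  obtain ⟨t₁, hV₁, hA₂⟩ := exists_threshold (M := M) (c := 2) (k := 43) (e := 90)
    (fun v hv => C.lam_le v (hA1 hv)) (hsl _ hA1) hA
  set A₂ := {v | v ∈ {v | v ∈ K ∧ C.OddDetour v} ∧ t₁ < lam v}
  have hA2 : A₂ ⊆ K := fun v hv => hv.1.1
  obtain ⟨t₂, hV₂, hA₃⟩ := exists_threshold (M := M) (c := 2) (k := 43) (e := 45)
    (fun v hv => C.lam_le v (hA2 hv)) (hsl _ hA2) hA₂
  set A₃ := {v | v ∈ A₂ ∧ t₂ < lam v}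
  have hA3 : A₃ ⊆ K := fun v hv => hA2 hv.1
  obtain ⟨t₃, hV₃, hA₄⟩ := exists_threshold (M := M) (c := 2) (k := 43) (e := 0)
    (fun v hv => C.lam_le v (hA3 hv)) (hsl _ hA3) hA₃
  obtain ⟨w, hw, hw₃⟩ := exists_mem_of_not_colOn hA₄
  have hwK := hA3 hw
  obtain ⟨N, hN, hodd, D, hD, hND⟩ := hw.1.1.2
  have h2w : t₂ < lam w := hw.2
  have h1w : t₁ < lam w := hw.1.2
  obtain ⟨b, hbV, hbN, -, -, j, hj⟩ := C.exists_oddLetters hG hwK hN hodd hD hND h2w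
    (F := []) (by simp) hV₂ fun v hv => ⟨hA2 hv.1, hv.2⟩
  obtain ⟨b₁, hb₁V, hb₁N, hb₁N', hb₁F, j₁, hj₁⟩ := C.exists_oddLetters hG hwK hN hodd hD hND h1w
    (F := [g b]) (by simp) hV₁ fun v hv => ⟨hv.1.1, hv.2⟩
  obtain ⟨b₂, hb₂V, hb₂N, hb₂N', hb₂F, j₂, hj₂⟩ := C.exists_oddLetters hG hwK hN hodd hD hND hw₃
    (F := [g b, d b₁]) (by simp) hV₃ fun v hv => ⟨hA3 hv.1, hv.2⟩
  have h1b : t₁ < lam b := hbV.1.2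
  have hb2 : lam b ≤ t₂ := hbV.2
  exact C.leg_false hG hwK (hA2 hbV.1) hb₁V.1.1 (hA3 hb₂V.1) hN (by omega) h1b hb₂V.1.2 hw₃ hj hj₁
    hj₂ hbN (fun x hx => ⟨by rintro rfl; exact hb₁N hx, fun h => hb₁N' x hx h.symm⟩)
    (fun x hx => ⟨by rintro rfl; exact hb₂N hx, fun h => hb₂N' x hx h.symm⟩)
    (hb₂F _ (by simp)) (hb₁F _ (by simp)) (hb₂F _ (by simp))

theorem colOn (C : G.Comb H l m r M d0 g0 K d g lam) [Finite V] (hG : G.IsTPerfect) :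
    G.ColOn 143 K :=
  ((C.colOn_oddDetour hG).union (C.colOn_not_oddDetour hG)).subset fun v hv => by
    by_cases h : C.OddDetour v
    · exact Or.inl ⟨hv, h⟩
    · exact Or.inr ⟨hv, h⟩

end Comb

/-- Let `r 0, …, r M` be an induced path inside level `m` of a levelling, `d0` a vertex of the level
below seeing only `r 0` on it. The set of vertices of level `m` away from both, each with a neighbour
in the level below that sees the path, has few colours. -/
theorem IsLevelling.colOn_of_path [Finite V] (hG : G.IsTPerfect) (htri : G.CliqueFree 3) {z : V}
    (hl : G.IsLevelling H z l) (hm : 2 ≤ m) (hr : G.IsIndexedPath r M)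
    (hrm : ∀ i ≤ M, r i ∈ H ∧ l (r i) = m) (hd0 : d0 ∈ H ∧ l d0 + 1 = m)
    (hd0r : ∀ i ≤ M, G.Adj d0 (r i) ↔ i = 0)
    (hK : ∀ v ∈ K, v ∈ H ∧ l v = m ∧ ¬ G.Adj d0 v ∧ ∀ i ≤ M, v ≠ r i ∧ ¬ G.Adj v (r i))
    (hKd : ∀ v ∈ K, ∃ u ∈ H, l u + 1 = m ∧ G.Adj u v ∧ ∃ i ≤ M, G.Adj u (r i)) :
    G.ColOn 147 K := by
  classical
  obtain ⟨g0, hg0, hg0d, hlg0⟩ := hl.exists_parent d0 hd0.1 (by omega)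
  have hch : ∀ v, ∃ u, v ∈ K → u ∈ H ∧ l u + 1 = m ∧ G.Adj u v ∧ ∃ i ≤ M, G.Adj u (r i) := by
    intro v
    by_cases hv : v ∈ K
    · obtain ⟨u, h1, h2, h3, h4⟩ := hKd v hv
      exact ⟨u, fun _ => ⟨h1, h2, h3, h4⟩⟩
    · exact ⟨v, fun h => (hv h).elim⟩
  choose d hd using hch
  have hch : ∀ v, ∃ u, v ∈ K → u ∈ H ∧ l u + 2 = m ∧ G.Adj u (d v) := by
    intro v
    by_cases hv : v ∈ K
    · obtain ⟨u, h1, h2, h3⟩ := hl.exists_parent (d v) (hd v hv).1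
        (by have := (hd v hv).2.1; omega)
      exact ⟨u, fun _ => ⟨h1, by have := (hd v hv).2.1; omega, h2⟩⟩
    · exact ⟨v, fun h => (hv h).elim⟩
  choose g hg using hch
  have hch : ∀ v, ∃ t, v ∈ K → t ≤ M ∧ G.Adj (d v) (r t) ∧ ∀ i < t, ¬ G.Adj (d v) (r i) := by
    intro v
    by_cases hv : v ∈ K
    · have hex := (hd v hv).2.2.2
      refine ⟨Nat.find hex, fun _ => ⟨(Nat.find_spec hex).1, (Nat.find_spec hex).2, fun i hi h => ?_⟩⟩
      exact Nat.find_min hex hi ⟨hi.le.trans (Nat.find_spec hex).1, h⟩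
    · exact ⟨0, fun h => (hv h).elim⟩
  choose lam hlam using hch
  have C : G.Comb H l m r M d0 g0 {v | v ∈ K ∧ ¬ G.Adj (d v) d0 ∧ ¬ G.Adj (d v) g0} d g lam := by
    refine ⟨htri, hl.le_succ, hr, hrm, hd0, hd0r, ⟨hg0, by omega, hg0d⟩,
      fun v hv => ⟨(hK v hv.1).1, (hK v hv.1).2.1⟩, fun v hv => (hK v hv.1).2.2.1,
      fun v hv => (hK v hv.1).2.2.2,
      fun v hv => ⟨(hd v hv.1).1, (hd v hv.1).2.1, (hd v hv.1).2.2.1⟩, fun v hv => hg v hv.1,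
      fun v hv => (hlam v hv.1).1, fun v hv => (hlam v hv.1).2.1, fun v hv => (hlam v hv.1).2.2,
      fun v hv => hv.2.1, fun v hv => hv.2.2, fun v hv => ?_⟩
    have hgv := hg v hv.1
    have hlow : ∀ u ∈ H, l u + 2 = m → (u = g v ∨ u = g0) →
        G.ConnIn ({d v, g v, g0} ∪ {u | u ∈ H ∧ l u + 3 ≤ m}) u z := by
      intro u hu hlu hu'
      refine (hl.connIn hu).mono ?_
      rintro x (rfl | ⟨hx, hx'⟩)
      · rcases hu' with h | h <;> simp [h]
      · exact Or.inr ⟨hx, by omega⟩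
    exact ((ConnIn.single hgv.2.2.symm (by simp) (by simp)).trans
      (hlow (g v) hgv.1 hgv.2.1 (Or.inl rfl))).trans
      (hlow g0 hg0 (by omega) (Or.inr rfl)).symm
  -- The comb needs `d v` to miss `d0` and `g0`. The exceptions lie in second neighbourhoods of
  -- these two vertices, two colours each beyond the 143.
  refine ((C.colOn hG).union ((colOn_nbrs_nbrs hG htri d0).union
    (colOn_nbrs_nbrs hG htri g0))).mono (by omega) fun v hv => ?_
  by_cases h1 : G.Adj (d v) d0
  · exact Or.inr (Or.inl ⟨d v, mem_nbrs_singleton.2 h1.symm, (hd v hv).2.2.1⟩)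
  by_cases h2 : G.Adj (d v) g0
  · exact Or.inr (Or.inr ⟨d v, mem_nbrs_singleton.2 h2.symm, (hd v hv).2.2.1⟩)
  exact Or.inl ⟨hv, h1, h2⟩

/-! ### Connectors: minimal connected sets containing given marks -/

theorem IsIndPath.connSet {l : List V} (h : G.IsIndPath l) : G.ConnSet {x | x ∈ l} := by
  induction l with
  | nil => intro x hx; simp at hx
  | cons a l ih =>
    rcases l with _ | ⟨b, l⟩
    · simpa using connSet_singleton (G := G) a
    · rw [isIndPath_cons_cons] at h
      have h1 := (ih h.2.2).insert (x := a) (a := b) (by simp) h.1.symm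
      convert h1 using 1
      ext x
      simp

/-- `W` is minimal among the connected sets containing all the marks `μ i`. -/
structure IsConnector {ι : Type*} (G : SimpleGraph V) (μ : ι → V) (W : Set V) : Prop where
  conn : G.ConnSet W
  mem : ∀ i, μ i ∈ W
  minimal : ∀ W' ⊆ W, G.ConnSet W' → (∀ i, μ i ∈ W') → W' = W

theorem ConnSet.exists_isConnector [Finite V] {ι : Type*} {Y : Set V} (hY : G.ConnSet Y)
    {μ : ι → V} (hμ : ∀ i, μ i ∈ Y) : ∃ W ⊆ Y, G.IsConnector μ W := by
  obtain ⟨W, hWY, hW⟩ := exists_minimal_le_of_wellFoundedLT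
    (fun W : Set V => G.ConnSet W ∧ ∀ i, μ i ∈ W) Y ⟨hY, hμ⟩
  exact ⟨W, hWY, hW.prop.1, hW.prop.2, fun W' h1 h2 h3 => h1.antisymm (hW.2 ⟨h2, h3⟩ h1)⟩

/-- Every vertex `v` of an induced cycle in a connector holds a connected part of the connector that
contains a mark and is attached to the rest only at `v`. -/
theorem IsConnector.exists_part {ι : Type*} {μ : ι → V} {W : Set V} (hW : G.IsConnector μ W)
    {c : List V} (hc : G.IsIndCycle c) (h3 : 3 ≤ c.length) (hcW : ∀ x ∈ c, x ∈ W) {v : V}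
    (hv : v ∈ c) : ∃ B ⊆ W, v ∈ B ∧ G.ConnSet B ∧ (∃ i, μ i ∈ B) ∧ (∀ w ∈ c, w ∈ B → w = v) ∧
      ∀ x ∈ B, x ≠ v → ∀ y ∈ W, y ∉ B → ¬ G.Adj x y := by
  obtain ⟨s, t, rfl⟩ := List.append_of_mem hv
  have hrot := hc.rotate
  rw [List.cons_append] at hrot
  have hO := hrot.2.2.connSet
  have hv' : v ∉ t ++ s := hrot.1
  obtain ⟨a, ha⟩ : ∃ a, a ∈ t ++ s := by
    apply List.exists_mem_of_length_pos
    simp at h3 ⊢; omega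
  have hne : ∀ x ∈ t ++ s, x ∈ W \ {v} := fun x hx =>
    ⟨hcW x (by simp at hx ⊢; tauto), fun h => hv' (by rwa [← Set.mem_singleton_iff.1 h])⟩
  -- The part at `v` is what is left of `W` after removing the component of `W \ {v}` that contains
  -- the rest of the cycle. It holds a mark, since otherwise that component would contradict
  -- minimality.
  set A := G.compIn (W \ {v}) a with hA
  have hOA : ∀ x ∈ t ++ s, x ∈ A := fun x hx => ⟨hne x hx, (hO a ha x hx).mono hne⟩
  have hvA : v ∉ A := fun h => h.1.2 rfl
  have hAW : A ⊆ W := fun x hx => hx.1.1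
  have hadj : ∀ x ∈ W \ A, x ≠ v → ∀ y ∈ A, ¬ G.Adj x y := fun x hx hxv y hy h =>
    hx.2 (mem_compIn_of_adj hy ⟨hx.1, hxv⟩ h.symm)
  have hvW : v ∈ W := hcW v hv
  refine ⟨W \ A, Set.sdiff_subset, ⟨hvW, hvA⟩, ?_, ?_, ?_, ?_⟩
  · refine ConnSet.of_root v fun x hx => ?_
    have h1 : x ∈ G.compIn (W \ A) v ∪ A := by
      refine (hW.conn v hvW x hx.1).mem_of_closed (Or.inl ⟨⟨hvW, hvA⟩, ConnIn.refl _⟩) ?_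
      rintro u hu y hy huy
      by_cases hyA : y ∈ A
      · exact Or.inr hyA
      rcases hu with hu | hu
      · exact Or.inl (mem_compIn_of_adj hu ⟨hy, hyA⟩ huy)
      · rcases eq_or_ne y v with rfl | hyv
        · exact Or.inl ⟨⟨hvW, hvA⟩, ConnIn.refl _⟩
        · exact absurd huy.symm (hadj y ⟨hy, hyA⟩ hyv u hu)
    exact (h1.resolve_right hx.2).2
  · by_contra hno
    push Not at hno
    have := hW.minimal A hAW (connSet_compIn _ _) fun i => by
      by_contra h; exact hno i ⟨hW.mem i, h⟩
    exact hvA (this ▸ hvW)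
  · intro w hw hwB
    by_contra hwv
    exact hwB.2 (hOA w (by simp at hw ⊢; tauto))
  · intro x hx hxv y hy hyB
    exact hadj x hx hxv y (by by_contra h; exact hyB ⟨hy, h⟩)

/-- Disjoint connected parts of a connector hanging at the vertices of an induced cycle. -/
theorem IsConnector.exists_parts {ι : Type*} {μ : ι → V} {W : Set V} (hW : G.IsConnector μ W)
    {c : List V} (hc : G.IsIndCycle c) (h3 : 3 ≤ c.length) (hcW : ∀ x ∈ c, x ∈ W) :
    ∃ B : V → Set V, ∃ f : V → ι, (∀ v ∈ c, B v ⊆ W ∧ v ∈ B v ∧ G.ConnSet (B v) ∧ μ (f v) ∈ B v ∧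
      ∀ x ∈ B v, x ≠ v → ∀ y ∈ W, y ∉ B v → ¬ G.Adj x y) ∧
      (∀ v ∈ c, ∀ w ∈ c, v ≠ w → Disjoint (B v) (B w)) := by
  have h : ∀ v, ∃ B : Set V, ∃ i : ι, v ∈ c → B ⊆ W ∧ v ∈ B ∧ G.ConnSet B ∧ μ i ∈ B ∧
      (∀ w ∈ c, w ∈ B → w = v) ∧ ∀ x ∈ B, x ≠ v → ∀ y ∈ W, y ∉ B → ¬ G.Adj x y := by
    intro v
    by_cases hv : v ∈ c
    · obtain ⟨B, h1, h2, h3, ⟨i, h4⟩, h5⟩ := hW.exists_part hc h3 hcW hv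
      exact ⟨B, i, fun _ => ⟨h1, h2, h3, h4, h5⟩⟩
    · obtain ⟨x, hx⟩ := List.exists_mem_of_length_pos (l := c) (by omega)
      obtain ⟨B, -, -, -, ⟨i, -⟩, -⟩ := hW.exists_part hc h3 hcW hx
      exact ⟨∅, i, fun h => absurd h hv⟩
  choose B f hB using h
  refine ⟨B, f, fun v hv => ⟨(hB v hv).1, (hB v hv).2.1, (hB v hv).2.2.1, (hB v hv).2.2.2.1,
    (hB v hv).2.2.2.2.2⟩, ?_⟩
  intro v hv w hw hvw
  obtain ⟨hBW, hvB, hBc, -, hBo, hBa⟩ := hB v hv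
  obtain ⟨hBW', hvB', hBc', -, hBo', hBa'⟩ := hB w hw
  rw [Set.disjoint_left]
  intro x hx hx'
  -- From a common vertex walk inside `B v` to `v`. The set `B w` can be left only at `w`, which is
  -- not in `B v`, so the walk stays in `B w`.
  have h1 : v ∈ B v ∩ B w := by
    refine (hBc x hx v hvB).mem_of_closed ⟨hx, hx'⟩ ?_
    rintro y ⟨hy, hy'⟩ z hz hyz
    refine ⟨hz, ?_⟩
    by_contra hz'
    have hyw : y = w := by
      by_contra hyw
      exact hBa' y hy' hyw z (hBW hz) hz' hyz
    exact hvw (hBo w hw (hyw ▸ hy)).symm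
  exact hvw (hBo' v hv h1.2)

theorem CliqueFree.five_le_length (htri : G.CliqueFree 3) {c : List V} (hc : G.IsIndCycle c)
    (hodd : Odd c.length) (h3 : 3 ≤ c.length) : 5 ≤ c.length := by
  by_contra h
  have h3' : c.length = 3 := by
    obtain ⟨k, hk⟩ := hodd; omega
  obtain ⟨a, b, d, rfl⟩ := List.length_eq_three.1 h3'
  have h01 := (hc.getElem (i := 0) (j := 1) (by omega) (by simp)).2
  have h12 := (hc.getElem (i := 1) (j := 2) (by omega) (by simp)).2
  have h02 := (hc.getElem (i := 0) (j := 2) (by omega) (by simp)).2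
  simp at h01 h12 h02
  exact htri.not_adj h01 h02 h12

theorem IsIndCycle.nodup {c : List V} (hc : G.IsIndCycle c) : c.Nodup := by
  rcases c with _ | ⟨a, l⟩
  · exact hc.elim
  · exact List.nodup_cons.2 ⟨hc.1, hc.2.2.nodup⟩

/-- An odd induced cycle would have at least five vertices, and the disjoint parts hanging there
contain marks with different indices, more than there are. -/
theorem IsConnector.colOn_two {n : ℕ} (hn : n ≤ 4) {μ : Fin n → V} {W : Set V}
    (hW : G.IsConnector μ W) (htri : G.CliqueFree 3) : G.ColOn 2 W := by
  classical
  by_contra hcol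
  obtain ⟨c, hc, hodd, h3, hcW⟩ := exists_odd_isIndCycle hcol
  have h5 := htri.five_le_length hc hodd h3
  obtain ⟨B, f, hB, hdis⟩ := hW.exists_parts hc h3 hcW
  have hnd := hc.nodup
  have := Finset.card_le_card_of_injOn (s := c.toFinset) (t := Finset.univ) f (by simp) (by
    intro v hv w hw hvw
    by_contra hne
    simp only [List.coe_toFinset, Set.mem_ofPred_eq] at hv hw
    exact Set.disjoint_left.1 (hdis v hv w hw hne) (hB v hv).2.2.2.1
      (by rw [hvw]; exact (hB w hw).2.2.2.1))
  rw [List.toFinset_card_of_nodup hnd, Finset.card_univ, Fintype.card_fin] at this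
  omega

theorem ConnSet.exists_colOn_two [Finite V] (htri : G.CliqueFree 3) {B : Set V} (hB : G.ConnSet B)
    {n : ℕ} (hn : n ≤ 4) {μ : Fin n → V} (hμ : ∀ i, μ i ∈ B) :
    ∃ W ⊆ B, G.ConnSet W ∧ G.ColOn 2 W ∧ ∀ i, μ i ∈ W := by
  obtain ⟨W, hWB, hW⟩ := hB.exists_isConnector hμ
  exact ⟨W, hWB, hW.conn, hW.colOn_two hn htri, hW.mem⟩

theorem ColOn.union_of_edge {X Y : Set V} (hX : G.ColOn 2 X) (hY : G.ColOn 2 Y)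
    (hdis : Disjoint X Y) {x y : V} (hx : x ∈ X) (hy : y ∈ Y) 
    (h : ∀ a ∈ X, ∀ b ∈ Y, G.Adj a b → a = x ∧ b = y) : G.ColOn 2 (X ∪ Y) := by
  classical
  obtain ⟨f, hf, hf'⟩ := hX
  obtain ⟨g, hg, hg'⟩ := hY
  have hY : ∀ v ∈ Y, v ∉ X := fun v hv hv' => Set.disjoint_left.1 hdis hv' hv
  -- The shift swaps the colours on `Y` if necessary, so that `y` does not get the colour of `x`.
  refine ⟨fun v => if v ∈ X then f v else (g v + g y + f x + 1) % 2, ?_, ?_⟩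
  · intro v hv
    dsimp only
    split_ifs with h1
    · exact hf v h1
    · omega
  · have key : ∀ u ∈ X, ∀ v ∈ Y, G.Adj u v → f u ≠ (g v + g y + f x + 1) % 2 := by
      intro u hu v hv huv
      obtain ⟨rfl, rfl⟩ := h u hu v hv huv
      have := hf u hu
      omega
    rintro u (hu | hu) v (hv | hv) huv
    · simpa [hu, hv] using hf' u hu v hv huv
    · simpa [hu, hY v hv] using key u hu v hv huv
    · simpa [hv, hY u hu] using (key v hv u hu huv.symm).symm
    · have := hg' u hu v hv huv
      have h1 := hg u hu
      have h2 := hg v hv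
      simp only [hY u hu, hY v hv, if_false]
      omega

/-- Connected bipartite sets hanging at the vertices of a four-vertex path. -/
theorem exists_colOn_two_of_path {P : V → Set V} {a b c d : V} 
    (hp : G.IsIndPath [a, b, c, d])
    (hP : ∀ v ∈ [a, b, c, d], v ∈ P v ∧ G.ConnSet (P v) ∧ G.ColOn 2 (P v))
    (hdis : ∀ v ∈ [a, b, c, d], ∀ w ∈ [a, b, c, d], v ≠ w → Disjoint (P v) (P w) ∧ 
      ∀ x ∈ P v, ∀ y ∈ P w, G.Adj x y → x = v ∧ y = w) :
    G.ConnSet (P a ∪ P b ∪ P c ∪ P d) ∧ G.ColOn 2 (P a ∪ P b ∪ P c ∪ P d) := by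
  have hnd := hp.nodup
  have hab := (hp.getElem (i := 0) (j := 1) (by omega) (by simp)).2
  have hbc := (hp.getElem (i := 1) (j := 2) (by omega) (by simp)).2
  have hcd := (hp.getElem (i := 2) (j := 3) (by omega) (by simp)).2
  have hac := (hp.getElem (i := 0) (j := 2) (by omega) (by simp)).2
  have had := (hp.getElem (i := 0) (j := 3) (by omega) (by simp)).2
  have hbd := (hp.getElem (i := 1) (j := 3) (by omega) (by simp)).2
  simp at hab hbc hcd hac had hbd hnd hdis hP
  obtain ⟨⟨ha, ca, a2⟩, ⟨hb, cb, b2⟩, ⟨hc, cc, c2⟩, ⟨hd, cd, d2⟩⟩ := hP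
  obtain ⟨⟨dab, dac, dad⟩, ⟨-, dbc, dbd⟩, ⟨-, -, dcd⟩, -⟩ := hdis
  have e1 := dab hnd.1.1
  have e2 := dac hnd.1.2.1
  have e3 := dad hnd.1.2.2
  have e4 := dbc hnd.2.1.1
  have e5 := dbd hnd.2.1.2
  have e6 := dcd hnd.2.2
  constructor
  · exact ((ca.union_of_edge cb ha hb hab).union_of_edge cc (Or.inr hb) hc hbc).union_of_edge cd
      (Or.inr hc) hd hcd
  · have h1 : G.ColOn 2 (P a ∪ P b) := a2.union_of_edge b2 e1.1 ha hb e1.2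
    have h2 : G.ColOn 2 (P a ∪ P b ∪ P c) := by
      refine h1.union_of_edge c2 (Set.disjoint_union_left.2 ⟨e2.1, e4.1⟩) (Or.inr hb) hc ?_
      rintro x (hx | hx) y hy hxy
      · obtain ⟨rfl, rfl⟩ := e2.2 x hx y hy hxy
        exact absurd hxy hac
      · exact e4.2 x hx y hy hxy
    refine h2.union_of_edge d2 (Set.disjoint_union_left.2
      ⟨Set.disjoint_union_left.2 ⟨e3.1, e5.1⟩, e6.1⟩) (Or.inr hc) hd ?_
    rintro x ((hx | hx) | hx) y hy hxy
    · obtain ⟨rfl, rfl⟩ := e3.2 x hx y hy hxy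
      exact absurd hxy had
    · obtain ⟨rfl, rfl⟩ := e5.2 x hx y hy hxy
      exact absurd hxy hbd
    · exact e6.2 x hx y hy hxy

theorem IsIndCycle.adj_of_length_five {c : List V} (hc : G.IsIndCycle c) (h5 : c.length = 5)
    {x y z : V} (hx : x ∈ c) (hy : y ∈ c) (hz : z ∈ c) (hxy : x ≠ y) (hxz : x ≠ z) (hyz : y ≠ z) :
    G.Adj x y ∨ G.Adj x z ∨ G.Adj y z := by
  obtain ⟨i, hi, rfl⟩ := List.getElem_of_mem hx
  obtain ⟨j, hj, rfl⟩ := List.getElem_of_mem hy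
  obtain ⟨k, hk, rfl⟩ := List.getElem_of_mem hz
  have key : ∀ i j (hi : i < c.length) (hj : j < c.length), i ≠ j → (G.Adj (c)[i] (c)[j] ↔
      j = i + 1 ∨ i = j + 1 ∨ (i = 0 ∧ j = 4) ∨ (j = 0 ∧ i = 4)) := by
    intro i j hi hj hij
    rcases hij.lt_or_gt with h | h
    · rw [(hc.getElem h hj).2]; omega
    · rw [G.adj_comm, (hc.getElem h hi).2]; omega
  have h1 : i ≠ j := by rintro rfl; exact hxy rfl
  have h2 : i ≠ k := by rintro rfl; exact hxz rfl
  have h3 : j ≠ k := by rintro rfl; exact hyz rfl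
  rw [key i j hi hj h1, key i k hi hk h2, key j k hj hk h3]
  omega

theorem ConnSet.exists_isHub {W : Set V} (hW : G.ConnSet W) (h2 : G.ColOn 2 W) {n : ℕ}
    {μ : Fin n → V} {J : Finset (Fin n)} (hJ : 5 ≤ J.card) (hμ : ∀ j ∈ J, μ j ∈ W) :
    ∃ Up Um : Set V, G.IsHub Up Um ∧ Up ∪ Um = W ∧
      ∃ a b c : Fin n, a < b ∧ b < c ∧ μ a ∈ Um ∧ μ b ∈ Um ∧ μ c ∈ Um := by
  obtain ⟨f, hf, hf'⟩ := h2
  obtain ⟨k, hk, hcard⟩ := Finset.exists_lt_card_fiber_of_mul_lt_card_of_maps_to (s := J)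
    (t := Finset.range 2) (f := fun j => f (μ j)) (n := 2)
    (fun j hj => Finset.mem_range.2 (hf _ (hμ j hj))) (by simp; omega)
  set s := J.filter fun j => f (μ j) = k with hs
  have hun : {v ∈ W | f v ≠ k} ∪ {v ∈ W | f v = k} = W := by
    ext v
    by_cases h : f v = k <;> simp [h]
  refine ⟨{v ∈ W | f v ≠ k}, {v ∈ W | f v = k}, ⟨?_, ?_, ?_, ?_⟩, hun, ?_⟩
  · intro u hu v hv huv
    have h1 := hf u hu.1
    have h2 := hf v hv.1
    have h3 := hf' u hu.1 v hv.1 huv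
    have h4 := hu.2
    have h5 := hv.2
    have := Finset.mem_range.1 hk
    omega
  · intro u hu v hv huv
    exact hf' u hu.1 v hv.1 huv (hu.2.trans hv.2.symm)
  · rw [Set.disjoint_left]
    exact fun v hv hv' => hv.2 hv'.2
  · rwa [hun]
  · have hmem : ∀ i, μ (s.orderEmbOfFin rfl i) ∈ {v ∈ W | f v = k} := fun i => by
      have := s.orderEmbOfFin_mem rfl i
      replace this := Finset.mem_filter.1 this
      exact ⟨hμ _ this.1, this.2⟩
    refine ⟨s.orderEmbOfFin rfl ⟨0, by omega⟩, s.orderEmbOfFin rfl ⟨1, by omega⟩,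
      s.orderEmbOfFin rfl ⟨2, by omega⟩, ?_, ?_, hmem _, hmem _, hmem _⟩
    · exact (s.orderEmbOfFin rfl).strictMono (by simp)
    · exact (s.orderEmbOfFin rfl).strictMono (by simp)

/-- Six marks in a connected set: three of them lie on one side of a connected bipartite subset. -/
theorem ConnSet.exists_isHub_of_six [Finite V] (htri : G.CliqueFree 3) {Y : Set V}
    (hY : G.ConnSet Y) {μ : Fin 6 → V} (hμ : ∀ i, μ i ∈ Y) :
    ∃ Up Um : Set V, G.IsHub Up Um ∧ Up ∪ Um ⊆ Y ∧
      ∃ a b c : Fin 6, a < b ∧ b < c ∧ μ a ∈ Um ∧ μ b ∈ Um ∧ μ c ∈ Um := by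
  classical
  suffices h : ∃ W ⊆ Y, G.ConnSet W ∧ G.ColOn 2 W ∧ ∃ J : Finset (Fin 6), 5 ≤ J.card ∧
      ∀ j ∈ J, μ j ∈ W by
    obtain ⟨W, hWY, hW, h2, J, hJ, hJW⟩ := h
    obtain ⟨Up, Um, h1, h2, h3⟩ := hW.exists_isHub h2 hJ hJW
    exact ⟨Up, Um, h1, h2 ▸ hWY, h3⟩
  obtain ⟨W, hWY, hW⟩ := hY.exists_isConnector hμ
  by_cases hcol : G.ColOn 2 W
  · exact ⟨W, hWY, hW.conn, hcol, Finset.univ, by simp, fun j _ => hW.mem j⟩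
  obtain ⟨c, hc, hodd, h3, hcW⟩ := exists_odd_isIndCycle hcol
  have h5 := htri.five_le_length hc hodd h3
  obtain ⟨B, f, hB, hdis⟩ := hW.exists_parts hc h3 hcW
  have hnd : c.Nodup := hc.nodup
  have hinj : ∀ v ∈ c, ∀ w ∈ c, f v = f w → v = w := by
    intro v hv w hw hvw
    by_contra hne
    exact Set.disjoint_left.1 (hdis v hv w hw hne) (hB v hv).2.2.2.1
      (by rw [hvw]; exact (hB w hw).2.2.2.1)
  have himg : (c.toFinset.image f).card = c.length := by
    rw [Finset.card_image_of_injOn, List.toFinset_card_of_nodup hnd]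
    intro v hv w hw
    simp only [List.coe_toFinset, Set.mem_ofPred_eq] at hv hw
    exact hinj v hv w hw
  -- The length is odd, at least 5 and at most the number of marks, six. So exactly one mark index,
  -- `u`, is not used by the parts.
  have h5' : c.length = 5 := by
    have := Finset.card_le_univ (c.toFinset.image f)
    rw [himg, Fintype.card_fin] at this
    obtain ⟨k, hk⟩ := hodd
    omega
  obtain ⟨u, hu⟩ : ∃ u, u ∉ c.toFinset.image f := by
    by_contra h
    push Not at h
    have := Finset.eq_univ_iff_forall.2 h
    rw [this] at himg
    simp at himg
    omega
  have hother : ∀ k ∈ c, ∃ l ∈ c, k ≠ l := by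
    intro k hk
    have h01 := (hc.getElem (i := 0) (j := 1) (by omega) (by omega)).1
    by_cases h : k = (c)[0]
    · exact ⟨(c)[1], List.getElem_mem _, h ▸ h01⟩
    · exact ⟨(c)[0], List.getElem_mem _, h⟩
  have hcross : ∀ v ∈ c, ∀ w ∈ c, v ≠ w → ∀ x ∈ B v, ∀ y ∈ B w, G.Adj x y → x = v ∧ y = w := by
    intro v hv w hw hvw x hx y hy hxy
    have hd := Set.disjoint_left.1 (hdis v hv w hw hvw)
    constructor
    · by_contra h
      exact (hB v hv).2.2.2.2 x hx h y ((hB w hw).1 hy) (fun h' => hd h' hy) hxy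
    · by_contra h
      exact (hB w hw).2.2.2.2 y hy h x ((hB v hv).1 hx) (fun h' => hd hx h') hxy.symm
  -- Enlarge the part at some `k` to a set `E` that also contains the unused mark and interferes
  -- with at most one other part, at `l`. Removing `l` from the five-cycle leaves a four-vertex path
  -- through `k`.
  obtain ⟨k, hk, l, hl, hkl, E, hEW, hEc, hkE, hfE, huE, hE⟩ : ∃ k ∈ c, ∃ l ∈ c, k ≠ l ∧
      ∃ E ⊆ W, G.ConnSet E ∧ k ∈ E ∧ μ (f k) ∈ E ∧ μ u ∈ E ∧ ∀ w ∈ c, w ≠ k → w ≠ l →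
        Disjoint E (B w) ∧ ∀ x ∈ E, ∀ y ∈ B w, G.Adj x y → x = k ∧ y = w := by
    by_cases hcase : ∃ k ∈ c, μ u ∈ B k
    · obtain ⟨k, hk, hku⟩ := hcase
      obtain ⟨l, hl, hkl⟩ := hother k hk
      obtain ⟨h1, h2, h3, h4, -⟩ := hB k hk
      exact ⟨k, hk, l, hl, hkl, B k, h1, h3, h2, h4, hku, fun w hw hwk _ =>
        ⟨hdis k hk w hw hwk.symm, hcross k hk w hw hwk.symm⟩⟩
    push Not at hcase
    set R : Set V := {x ∈ W | ∀ v ∈ c, x ∉ B v} with hR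
    have huR : μ u ∈ R := ⟨hW.mem u, hcase⟩
    have hRc : ∀ x ∈ R, ∀ w ∈ c, ∀ y ∈ B w, G.Adj x y → y = w := by
      intro x hx w hw y hy hxy
      by_contra h
      exact (hB w hw).2.2.2.2 y hy h x hx.1 (hx.2 w hw) hxy.symm
    obtain ⟨y, hy, v, hv, hyv⟩ : ∃ y ∈ G.compIn R (μ u), ∃ v ∈ c, G.Adj y v := by
      by_contra hno
      push Not at hno
      obtain ⟨v, hv⟩ := List.exists_mem_of_length_pos (l := c) (by omega)
      have : v ∈ G.compIn R (μ u) := by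
        refine (hW.conn _ (hW.mem u) v (hcW v hv)).mem_of_closed ⟨huR, ConnIn.refl _⟩ ?_
        intro x hx y hy hxy
        refine mem_compIn_of_adj hx ⟨hy, fun w hw hyw => ?_⟩ hxy
        have := hRc x hx.1 w hw y hyw hxy
        exact hno x hx w hw (this ▸ hxy)
      exact this.1.2 v hv (hB v hv).2.1
    obtain ⟨L, b, hL, hhead, ⟨k, hk, hbk⟩, hLT, hLR⟩ :=
      (connSet_compIn R (μ u) _ ⟨huR, ConnIn.refl _⟩ y hy).exists_isIndPath ⟨huR, ConnIn.refl _⟩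
        (fun x => ∃ v ∈ c, G.Adj x v) ⟨v, hv, hyv⟩
    -- Among three vertices of a five-cycle two are adjacent, so by triangle-freeness `b` sees at
    -- most two vertices of the cycle.
    obtain ⟨l, hl, hkl, hblw⟩ : ∃ l ∈ c, k ≠ l ∧ ∀ w ∈ c, w ≠ k → w ≠ l → ¬ G.Adj b w := by
      by_cases h : ∃ l ∈ c, k ≠ l ∧ G.Adj b l
      · obtain ⟨l, hl, hkl, hbl⟩ := h
        refine ⟨l, hl, hkl, fun w hw hwk hwl hbw => ?_⟩
        rcases hc.adj_of_length_five h5' hk hl hw hkl hwk.symm hwl.symm with h | h | h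
        · exact htri.not_adj hbk hbl h
        · exact htri.not_adj hbk hbw h
        · exact htri.not_adj hbl hbw h
      · obtain ⟨l, hl, hkl⟩ := hother k hk
        exact ⟨l, hl, hkl, fun w hw hwk _ hbw => h ⟨w, hw, hwk.symm, hbw⟩⟩
    obtain ⟨h1, h2, h3, h4, -⟩ := hB k hk
    refine ⟨k, hk, l, hl, hkl, B k ∪ {x | x ∈ L ++ [b]}, ?_, ?_, Or.inl h2, Or.inl h4, Or.inr ?_, ?_⟩
    · exact Set.union_subset h1 fun x hx => (hLR x hx).1.1
    · exact h3.union_of_edge hL.connSet h2 (by simp) hbk.symm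
    · exact List.mem_of_head? hhead
    · intro w hw hwk hwl
      refine ⟨Set.disjoint_union_left.2 ⟨hdis k hk w hw hwk.symm, Set.disjoint_left.2 fun x hx =>
        (hLR x hx).1.2 w hw⟩, ?_⟩
      rintro x (hx | hx) y hy hxy
      · exact hcross k hk w hw hwk.symm x hx y hy hxy
      · obtain rfl := hRc x (hLR x hx).1 w hw y hy hxy
        exfalso
        rcases List.mem_append.1 hx with hx | hx
        · exact hLT x hx ⟨_, hw, hxy⟩
        · rw [List.mem_singleton] at hx
          exact hblw _ hw hwk hwl (hx ▸ hxy)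
  obtain ⟨s, t, rfl⟩ := List.append_of_mem hl
  have hrot := hc.rotate
  rw [List.cons_append] at hrot
  obtain ⟨hlts, -, hpath⟩ := hrot
  have hmem : ∀ x ∈ t ++ s, x ∈ s ++ l :: t ∧ x ≠ l := fun x hx =>
    ⟨by simp at hx ⊢; tauto, fun h => hlts (h ▸ hx)⟩
  have hkts : k ∈ t ++ s := by simp at hk ⊢; tauto
  have hlen : (t ++ s).length = 4 := by simp at h5' ⊢; omega
  generalize t ++ s = p at hlts hpath hmem hkts hlen
  -- Inside each part take a bipartite connector: three marks at `k` (the cycle vertex and two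
  -- original marks), two elsewhere. Joined along the path they stay bipartite and carry five of the
  -- six marks.
  have hex : ∀ w, ∃ P : Set V, w ∈ p → P ⊆ (if w = k then E else B w) ∧ G.ConnSet P ∧ G.ColOn 2 P ∧
      w ∈ P ∧ μ (f w) ∈ P ∧ (w = k → μ u ∈ P) := by
    intro w
    by_cases hw : w ∈ p
    · obtain ⟨h1, h2, h3, h4, -⟩ := hB w (hmem w hw).1
      by_cases hwk : w = k
      · subst hwk
        obtain ⟨P, hP, hPc, hP2, hPm⟩ := hEc.exists_colOn_two htri (n := 3) (by omega)
          (μ := ![w, μ (f w), μ u]) (by simp [Fin.forall_fin_succ, hkE, hfE, huE])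
        simp [Fin.forall_fin_succ] at hPm
        exact ⟨P, fun _ => ⟨by simpa using hP, hPc, hP2, hPm.1, hPm.2.1, fun _ => hPm.2.2⟩⟩
      · obtain ⟨P, hP, hPc, hP2, hPm⟩ := h3.exists_colOn_two htri (n := 2) (by omega)
          (μ := ![w, μ (f w)]) (by simp [Fin.forall_fin_succ, h2, h4])
        simp [Fin.forall_fin_succ] at hPm
        exact ⟨P, fun _ => ⟨by simpa [hwk] using hP, hPc, hP2, hPm.1, hPm.2, fun h => absurd h hwk⟩⟩
    · exact ⟨∅, fun h => absurd h hw⟩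
  choose P hP using hex
  have hPdis : ∀ v ∈ p, ∀ w ∈ p, v ≠ w → Disjoint (P v) (P w) ∧
      ∀ x ∈ P v, ∀ y ∈ P w, G.Adj x y → x = v ∧ y = w := by
    intro v hv w hw hvw
    have h1 := (hP v hv).1
    have h2 := (hP w hw).1
    by_cases hvk : v = k
    · subst hvk
      rw [if_pos rfl] at h1
      rw [if_neg hvw.symm] at h2
      obtain ⟨e1, e2⟩ := hE w (hmem w hw).1 hvw.symm (hmem w hw).2
      exact ⟨e1.mono h1 h2, fun x hx y hy => e2 x (h1 hx) y (h2 hy)⟩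
    rw [if_neg hvk] at h1
    by_cases hwk : w = k
    · subst hwk
      rw [if_pos rfl] at h2
      obtain ⟨e1, e2⟩ := hE v (hmem v hv).1 hvk (hmem v hv).2
      exact ⟨(e1.mono h2 h1).symm, fun x hx y hy hxy => (e2 y (h2 hy) x (h1 hx) hxy.symm).symm⟩
    · rw [if_neg hwk] at h2
      exact ⟨(hdis v (hmem v hv).1 w (hmem w hw).1 hvw).mono h1 h2, fun x hx y hy =>
        hcross v (hmem v hv).1 w (hmem w hw).1 hvw x (h1 hx) y (h2 hy)⟩
  have hPW : ∀ w ∈ p, P w ⊆ W := by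
    intro w hw
    refine (hP w hw).1.trans ?_
    split_ifs
    exacts [hEW, (hB w (hmem w hw).1).1]
  have hpnd := hpath.nodup
  have hJ : (Insert.insert u (p.toFinset.image f)).card = 5 := by
    rw [Finset.card_insert_of_notMem, Finset.card_image_of_injOn, List.toFinset_card_of_nodup hpnd,
      hlen]
    · intro v hv w hw
      simp only [List.coe_toFinset, Set.mem_ofPred_eq] at hv hw
      exact hinj v (hmem v hv).1 w (hmem w hw).1
    · intro h
      refine hu ?_
      simp only [Finset.mem_image, List.mem_toFinset] at h ⊢
      obtain ⟨v, hv, hfv⟩ := h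
      exact ⟨v, (hmem v hv).1, hfv⟩
  obtain ⟨a₁, a₂, a₃, a₄, rfl⟩ : ∃ a₁ a₂ a₃ a₄, p = [a₁, a₂, a₃, a₄] := by
    match p, hlen with
    | [a₁, a₂, a₃, a₄], _ => exact ⟨a₁, a₂, a₃, a₄, rfl⟩
  have := exists_colOn_two_of_path hpath
    (fun v hv => ⟨(hP v hv).2.2.2.1, (hP v hv).2.1, (hP v hv).2.2.1⟩) hPdis
  have hsub : ∀ v ∈ [a₁, a₂, a₃, a₄], P v ⊆ P a₁ ∪ P a₂ ∪ P a₃ ∪ P a₄ := by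
    intro v hv x hx
    simp at hv
    rcases hv with rfl | rfl | rfl | rfl <;> simp [hx]
  refine ⟨P a₁ ∪ P a₂ ∪ P a₃ ∪ P a₄, ?_, this.1, this.2, Insert.insert u ([a₁, a₂, a₃, a₄].toFinset.image f),
    hJ.ge, ?_⟩
  · refine Set.Subset.trans ?_ hWY
    simp only [Set.union_subset_iff]
    exact ⟨⟨⟨hPW _ (by simp), hPW _ (by simp)⟩, hPW _ (by simp)⟩, hPW _ (by simp)⟩
  · intro j hj
    simp only [Finset.mem_insert, Finset.mem_image, List.mem_toFinset] at hj
    rcases hj with rfl | ⟨v, hv, rfl⟩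
    · exact hsub k hkts ((hP k hkts).2.2.2.2.2 rfl)
    · exact hsub v hv (hP v hv).2.2.2.2.1

/-! ### Closing a rope to a cycle and finding its hub -/

/-- An induced path whose last vertex is attached to a level piece `K` can be closed to an induced
cycle through `K` and the lower levels. -/
theorem IsLevelling.exists_closing {H : Set V} {z : V} {l : V → ℕ} (hl : G.IsLevelling H z l) {m : ℕ}
    {K : Set V} (hK : G.ConnSet K) (hKH : ∀ v ∈ K, v ∈ H ∧ l v = m) {x d0 d e : V} (hxK : x ∉ K)
    (hxK' : ∃ t ∈ K, G.Adj x t) (hx : x ∈ H ∧ l x = m) (hd0 : d0 ∈ H ∧ l d0 + 1 = m)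
    (hd : d ∈ H ∧ l d + 1 = m) (hdd0 : d ≠ d0) (he : e ∈ K) (hde : G.Adj d e)
    (hd0K : ∀ v ∈ insert x K, ¬ G.Adj d0 v) :
    ∃ T : List V, T.head? = some x ∧ (∀ y ∈ T, y ∈ H) ∧ ∀ r0 R, G.IsIndPath (r0 :: R ++ [x]) →
      (∀ y ∈ r0 :: R, y ∈ H ∧ l y = m ∧ y ∉ K ∧ (∀ t ∈ K, ¬ G.Adj y t) ∧ ¬ G.Adj d y) →
      G.Adj d0 r0 → (∀ y ∈ R, ¬ G.Adj d0 y) → G.IsIndCycle (r0 :: R ++ T) := by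
  obtain ⟨t, ht, hxt⟩ := hxK'
  have hc : G.ConnSet (insert x K) := hK.insert ht hxt.symm
  obtain ⟨L, b, hP, hPx, hdb, hLd, hPK⟩ := (hc x (by simp) e (by simp [he])).exists_isIndPath
    (by simp) (fun v => G.Adj d v) hde
  have hPH : ∀ y ∈ L ++ [b], y ∈ H ∧ l y = m := by
    intro y hy
    rcases hPK y hy with rfl | h
    exacts [hx, hKH y h]
  have hz : ∀ v, v ∈ H → l v + 1 = m → (v = d ∨ v = d0) →
      G.ConnIn ({d, d0} ∪ {u | u ∈ H ∧ l u + 2 ≤ m}) v z := by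
    intro v hv hlv hvd
    refine (hl.connIn hv).mono ?_
    rintro u (hu | ⟨hu, hlu⟩)
    · rw [Set.mem_singleton_iff] at hu
      subst hu
      left; simpa using hvd
    · exact Or.inr ⟨hu, by omega⟩
  obtain ⟨L', b', hQ, hQd, hb', hLd0, hQA⟩ :=
    ((hz d hd.1 hd.2 (Or.inl rfl)).trans (hz d0 hd0.1 hd0.2 (Or.inr rfl)).symm).exists_isIndPath
      (by simp) (fun v => v = d0) rfl
  subst hb'
  have hQH : ∀ y ∈ L' ++ [b'], y ∈ H ∧ (y = d ∨ y = b' ∨ l y + 2 ≤ m) := by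
    intro y hy
    rcases hQA y hy with (h | h) | ⟨h, h'⟩
    · subst h; exact ⟨hd.1, Or.inl rfl⟩
    · rw [Set.mem_singleton_iff] at h; subst h; exact ⟨hd0.1, Or.inr (Or.inl rfl)⟩
    · exact ⟨h, Or.inr (Or.inr h')⟩
  refine ⟨(L ++ [b]) ++ (L' ++ [b']), ?_, ?_, ?_⟩
  · rw [List.head?_append, hPx]; rfl
  · intro y hy
    rcases List.mem_append.1 hy with hy | hy
    exacts [(hPH y hy).1, (hQH y hy).1]
  intro r0 R hR hRK hd0r hd0R
  have hRP : G.IsIndPath ((r0 :: R) ++ (L ++ [b])) := by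
    rw [isIndPath_append] at hR ⊢
    refine ⟨hR.1, hP, fun u hu v hv => ?_⟩
    rcases hPK v hv with rfl | hvK
    · rw [hPx]
      simpa using hR.2.2 u hu v (by simp)
    · refine ⟨?_, ?_⟩
      · rintro rfl; exact (hRK u hu).2.2.1 hvK
      · refine iff_of_false ((hRK u hu).2.2.2.1 v hvK) ?_
        rintro ⟨-, h⟩
        rw [hPx, Option.some.injEq] at h
        subst h
        exact hxK hvK
  rw [← List.append_assoc, isIndCycle_append (by simp) (by simp)]
  refine ⟨hRP, hQ, fun u hu v hv => ?_⟩
  have hum : u ∈ H ∧ l u = m := by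
    rcases List.mem_append.1 hu with hu | hu
    exacts [⟨(hRK u hu).1, (hRK u hu).2.1⟩, hPH u hu]
  have hlast : ((r0 :: R) ++ (L ++ [b])).getLast? = some b := by
    rw [← List.append_assoc, List.getLast?_concat]
  have hdu : G.Adj u d ↔ b = u := by
    constructor
    · intro h
      rcases List.mem_append.1 hu with hu | hu
      · exact absurd h.symm (hRK u hu).2.2.2.2
      · rcases List.mem_append.1 hu with hu | hu
        · exact absurd h.symm (hLd u hu)
        · exact (List.mem_singleton.1 hu).symm
    · rintro rfl; exact hdb.symm
  have hd0u : G.Adj u b' ↔ r0 = u := by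
    constructor
    · intro h
      rcases List.mem_append.1 hu with hu | hu
      · rcases List.mem_cons.1 hu with hu | hu
        · exact hu.symm
        · exact absurd h.symm (hd0R u hu)
      · exact absurd h.symm (hd0K u (hPK u hu))
    · rintro rfl; exact hd0r.symm
  rw [hlast, hQd, List.getLast?_concat]
  simp only [List.cons_append, List.head?_cons, Option.some.injEq]
  rcases (hQH v hv).2 with rfl | rfl | hv'
  · refine ⟨fun h => by have := hd.2; rw [← h] at this; omega, ?_⟩
    rw [hdu]
    simp [hdd0.symm]
  · refine ⟨fun h => by have := hd0.2; rw [← h] at this; omega, ?_⟩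
    rw [hd0u]
    simp [hdd0]
  · refine ⟨fun h => by rw [← h] at hv'; omega, iff_of_false (fun h => ?_) ?_⟩
    · have := hl.le_succ u hum.1 v (hQH v hv).1 h
      omega
    · rintro (⟨-, rfl⟩ | ⟨-, rfl⟩) <;> omega

theorem even_length_flatMap {α β : Type*} {f : α → List β} {L : List α}
    (h : ∀ a ∈ L, Even (f a).length) : Even (L.flatMap f).length := by
  induction L with
  | nil => simp
  | cons a L ih =>
    rw [List.flatMap_cons, List.length_append]
    exact (h a (by simp)).add (ih fun b hb => h b (by simp [hb]))

/-- A chain of parity gadgets closed to a cycle has no hub attached to three of its joints. -/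
theorem IsTPerfect.rope_false [Finite V] (hG : G.IsTPerfect) {Up Um : Set V}
    (hU : G.IsHub Up Um) {n : ℕ} {x : ℕ → V} {s : ℕ → ℕ → List V} {T : List V}
    (hs : ∀ i < n, ∀ p, (∃ E, s i p = x i :: E) ∧ (s i p).length % 2 = p % 2)
    (hT : T.head? = some (x n))
    (hc : ∀ p : ℕ → ℕ, G.IsIndCycle ((List.range n).flatMap (fun i => s i (p i)) ++ T))
    (hdisj : ∀ p : ℕ → ℕ, ∀ y ∈ (List.range n).flatMap (fun i => s i (p i)) ++ T,
      y ∉ Up ∧ y ∉ Um ∧ y ∉ G.nbrs Um) {a b c : ℕ} (h0a : 0 < a) (hab : a < b) (hbc : b < c)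
    (hcn : c ≤ n) (ha : x a ∈ G.nbrs Up) (hb : x b ∈ G.nbrs Up) (hd : x c ∈ G.nbrs Up) : False := by
  -- Segments `a` and `b` are odd and give two odd arcs. The initial segment compensates the length
  -- of `T` so that the third arc is odd as well; `0 < a` keeps it free for this purpose.
  set p : ℕ → ℕ := fun i => if i = a ∨ i = b then 1 else if i = 0 then T.length + 1 else 0 with hp
  set f : ℕ → List V := fun i => s i (p i) with hf
  have hlen : ∀ i < n, (f i).length % 2 = p i % 2 := fun i hi => (hs i hi _).2
  have hodd : ∀ i < n, i = a ∨ i = b → Odd (f i).length := by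
    intro i hi h
    rw [Nat.odd_iff, hlen i hi]
    simp [hp, h]
  have heven : ∀ i < n, i ≠ a → i ≠ b → i ≠ 0 → Even (f i).length := by
    intro i hi h h' h''
    rw [Nat.even_iff, hlen i hi]
    simp [hp, h, h', h'']
  have hzero : (f 0).length % 2 = (T.length + 1) % 2 := by
    rw [hlen 0 (by omega)]
    simp [hp, h0a.ne, (h0a.trans hab).ne]
  have hsplit : (List.range n).flatMap f = f 0 ++ (List.range' 1 (a - 1)).flatMap f ++
      (f a ++ (List.range' (a + 1) (b - a - 1)).flatMap f ++
      (f b ++ (List.range' (b + 1) (c - b - 1)).flatMap f) ++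
      (List.range' c (n - c)).flatMap f) := by
    have h1 : List.range n = 0 :: List.range' 1 (a - 1) ++ (a :: List.range' (a + 1) (b - a - 1) ++
        (b :: List.range' (b + 1) (c - b - 1)) ++ List.range' c (n - c)) := by
      have h2 : ∀ u v, u ≤ v → List.range' 0 u ++ List.range' u (v - u) = List.range' 0 v := by
        intro u v huv
        have := List.range'_append_1 (s := 0) (m := u) (n := v - u)
        rwa [Nat.zero_add, Nat.add_sub_cancel' huv] at this
      have h3 : ∀ u v, u < v → u :: List.range' (u + 1) (v - u - 1) = List.range' u (v - u) := by
        intro u v huv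
        rw [← List.range'_succ, Nat.sub_add_cancel (by omega)]
      rw [h3 a b hab, h3 b c hbc, List.range_eq_range', ← List.append_assoc, ← List.append_assoc,
        show 0 :: List.range' 1 (a - 1) = List.range' 0 a from h3 0 a h0a, h2 a b hab.le,
        h2 b c hbc.le, h2 c n hcn]
    rw [h1]
    simp [List.flatMap_append, List.flatMap_cons]
  obtain ⟨A, hA⟩ := (hs a (by omega) (p a)).1
  obtain ⟨B, hB⟩ := (hs b (by omega) (p b)).1
  obtain ⟨D, hD⟩ : ∃ D, (List.range' c (n - c)).flatMap f ++ T = x c :: D := by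
    rcases hcn.eq_or_lt with rfl | h
    · obtain ⟨D, hD⟩ := List.head?_eq_some_iff.1 hT
      exact ⟨D, by simpa using hD⟩
    · obtain ⟨E, hE⟩ := (hs c h (p c)).1
      rw [show n - c = (n - c - 1) + 1 by omega, List.range'_succ, List.flatMap_cons]
      exact ⟨_, by rw [show f c = x c :: E from hE]; rfl⟩
  have hA' : f a = x a :: A := hA
  have hB' : f b = x b :: B := hB
  have hcyc := hc p
  have hmem := hdisj p
  change G.IsIndCycle ((List.range n).flatMap f ++ T) at hcyc
  change ∀ y ∈ (List.range n).flatMap f ++ T, _ at hmem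
  rw [hsplit, List.append_assoc] at hcyc hmem
  set R₁ := f 0 ++ (List.range' 1 (a - 1)).flatMap f with hR₁
  set R₂ := (List.range' (a + 1) (b - a - 1)).flatMap f with hR₂
  set R₃ := (List.range' (b + 1) (c - b - 1)).flatMap f with hR₃
  have e : f a ++ R₂ ++ (f b ++ R₃) ++ (List.range' c (n - c)).flatMap f ++ T =
      (x a :: (A ++ R₂)) ++ x b :: (B ++ R₃) ++ x c :: D := by
    rw [List.append_assoc _ _ T, hD, hA', hB']
    simp
  rw [e] at hcyc hmem
  have hcyc' := hcyc.rotate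
  have e' : (x a :: (A ++ R₂)) ++ x b :: (B ++ R₃) ++ x c :: D ++ R₁ =
      (x a :: (A ++ R₂)) ++ x b :: (B ++ R₃) ++ x c :: (D ++ R₁) := by simp
  rw [e'] at hcyc'
  have e2 : Even R₂.length := even_length_flatMap fun i hi => by
    rw [List.mem_range'_1] at hi
    exact heven i (by omega) (by omega) (by omega) (by omega)
  have e3 : Even R₃.length := even_length_flatMap fun i hi => by
    rw [List.mem_range'_1] at hi
    exact heven i (by omega) (by omega) (by omega) (by omega)
  have e4 : Even ((List.range' c (n - c)).flatMap f).length := even_length_flatMap fun i hi => by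
    rw [List.mem_range'_1] at hi
    exact heven i (by omega) (by omega) (by omega) (by omega)
  have e1 : Even ((List.range' 1 (a - 1)).flatMap f).length := even_length_flatMap fun i hi => by
    rw [List.mem_range'_1] at hi
    exact heven i (by omega) (by omega) (by omega) (by omega)
  have oa := hodd a (by omega) (Or.inl rfl)
  have ob := hodd b (by omega) (Or.inr rfl)
  have hDl := congrArg List.length hD
  rw [hA', List.length_cons] at oa
  rw [hB', List.length_cons] at ob
  rw [List.length_append, List.length_cons] at hDl
  have hR1l : R₁.length = (f 0).length + ((List.range' 1 (a - 1)).flatMap f).length := by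
    rw [hR₁, List.length_append]
  rw [Nat.even_iff] at e1 e2 e3 e4
  rw [Nat.odd_iff] at oa ob
  refine hG.wheel_false hU hcyc' ?_ ?_ ?_ ?_ ha hb hd
  · rw [List.length_append, Nat.even_iff]; omega
  · rw [List.length_append, Nat.even_iff]; omega
  · rw [List.length_append, Nat.even_iff]; omega
  · intro y hy
    refine hmem y ?_
    rw [← e'] at hy
    simp only [List.mem_append] at hy ⊢
    tauto

/-- Three of six vertices of one level, far from each other as seen from the levels below, are
attached to a common hub in the lower levels. -/
theorem IsLevelling.exists_isHub [Finite V] (htri : G.CliqueFree 3) {H : Set V} {z : V} {l : V → ℕ}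
    (hl : G.IsLevelling H z l) {i : ℕ} {x p g : Fin 6 → V}
    (hp : ∀ j, p j ∈ H ∧ G.Adj (p j) (x j) ∧ l (p j) + 1 = i)
    (hg : ∀ j, g j ∈ H ∧ G.Adj (g j) (p j) ∧ l (g j) + 2 = i)
    (hpp : ∀ j k, j < k → x k ∉ G.nbrs (G.nbrs {p j}))
    (hgp : ∀ j k, j < k → x k ∉ G.nbrs (G.nbrs {g j}))
    (hpg : ∀ j k, j < k → x k ∉ G.nbrs (G.nbrs (G.nbrs {p j}))) :
    ∃ Up Um : Set V, G.IsHub Up Um ∧ (∀ u ∈ Up, u ∈ H ∧ l u + 1 ≤ i) ∧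
      (∀ u ∈ Um, u ∈ H ∧ l u + 2 ≤ i) ∧ ∃ a b c : Fin 6, a < b ∧ b < c ∧
        x a ∈ G.nbrs Up ∧ x b ∈ G.nbrs Up ∧ x c ∈ G.nbrs Up := by
  -- Only the six grandparents are admitted from level `i - 2`, so an edge from `Y` to a parent must
  -- come from one of them, where the distance hypotheses apply.
  set Y : Set V := {u | (∃ j, u = g j) ∨ (u ∈ H ∧ l u + 3 ≤ i)} with hY
  have hYconn : G.ConnSet Y := by
    refine ConnSet.of_root z fun u hu => ?_
    rcases hu with ⟨j, rfl⟩ | ⟨hu, hui⟩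
    · refine ((hl.connIn (hg j).1).mono ?_).symm
      rintro v (hv | ⟨hv, hv'⟩)
      · exact Or.inl ⟨j, hv⟩
      · have := (hg j).2.2
        exact Or.inr ⟨hv, by omega⟩
    · refine ((hl.connIn hu).mono ?_).symm
      rintro v (hv | ⟨hv, hv'⟩)
      · rw [Set.mem_singleton_iff] at hv
        subst hv
        exact Or.inr ⟨hu, hui⟩
      · exact Or.inr ⟨hv, by omega⟩
  have hYH : ∀ u ∈ Y, u ∈ H ∧ l u + 2 ≤ i := by
    rintro u (⟨j, rfl⟩ | ⟨hu, hui⟩)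
    · exact ⟨(hg j).1, (hg j).2.2.le⟩
    · exact ⟨hu, by omega⟩
  obtain ⟨Up, Um, hU, hUY, a, b, c, hab, hbc, ha, hb, hc⟩ :=
    hYconn.exists_isHub_of_six htri (μ := g) fun j => Or.inl ⟨j, rfl⟩
  -- The parents of the joints whose grandparents lie in `Um` join the side `Up`; this side then
  -- reaches the joints, while `Um` stays two levels below.
  set P : Set V := {u | ∃ j, g j ∈ Um ∧ u = p j} with hP
  have hpnot : ∀ j k, j < k → ¬ G.Adj (p j) (p k) := fun j k hjk h =>
    hpp j k hjk ⟨p k, mem_nbrs_singleton.2 h, (hp k).2.1⟩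
  have hPs : G.Stable P := by
    rintro _ ⟨j, -, rfl⟩ _ ⟨k, -, rfl⟩ h
    rcases lt_trichotomy j k with hjk | rfl | hjk
    · exact hpnot j k hjk h
    · exact h.ne rfl
    · exact hpnot k j hjk h.symm
  have hUpP : ∀ u ∈ Up, ∀ v ∈ P, ¬ G.Adj u v := by
    rintro u hu _ ⟨j, hj, rfl⟩ h
    rcases hUY (Or.inl hu) with ⟨k, rfl⟩ | ⟨huH, hui⟩
    · rcases lt_trichotomy j k with hjk | rfl | hjk
      · exact hpg j k hjk ⟨p k, ⟨g k, mem_nbrs_singleton.2 h.symm, (hg k).2.1⟩, (hp k).2.1⟩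
      · exact Set.disjoint_left.1 hU.disj hu hj
      · exact hgp k j hjk ⟨p j, mem_nbrs_singleton.2 h, (hp j).2.1⟩
    · have := hl.le_succ _ (hp j).1 u huH h.symm
      have := (hp j).2.2
      omega
  have hnbr : ∀ j, g j ∈ Um → x j ∈ G.nbrs (Up ∪ P) := fun j hj =>
    ⟨p j, Or.inr ⟨j, hj, rfl⟩, (hp j).2.1⟩
  refine ⟨Up ∪ P, Um, ⟨?_, hU.right, ?_, ?_⟩, ?_, ?_, a, b, c, hab, hbc, hnbr a ha, hnbr b hb,
    hnbr c hc⟩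
  · rintro u (hu | hu) v (hv | hv) h
    · exact hU.left u hu v hv h
    · exact hUpP u hu v hv h
    · exact hUpP v hv u hu h.symm
    · exact hPs u hu v hv h
  · rw [Set.disjoint_union_left]
    refine ⟨hU.disj, Set.disjoint_left.2 ?_⟩
    rintro _ ⟨j, -, rfl⟩ hm
    have := (hYH _ (hUY (Or.inr hm))).2
    have := (hp j).2.2
    omega
  · have := hU.conn.union_of_adj (B := P) (by
      rintro _ ⟨j, hj, rfl⟩
      exact ⟨g j, Or.inr hj, (hg j).2.1⟩)
    rwa [Set.union_right_comm] at this
  · rintro u (hu | ⟨j, -, rfl⟩)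
    · have := hYH u (hUY (Or.inl hu))
      exact ⟨this.1, by omega⟩
    · exact ⟨(hp j).1, (hp j).2.2.le⟩
  · exact fun u hu => hYH u (hUY (Or.inr hu))

theorem IsLevelling.colOn_of_isIndPath [Finite V] (hG : G.IsTPerfect) (htri : G.CliqueFree 3)
    {H K : Set V} {l : V → ℕ} {m : ℕ} {z d0 r0 : V} {R : List V} (hl : G.IsLevelling H z l)
    (hm : 2 ≤ m) (hr : G.IsIndPath (r0 :: R)) (hrm : ∀ y ∈ r0 :: R, y ∈ H ∧ l y = m)
    (hd0 : d0 ∈ H ∧ l d0 + 1 = m) (hd0r : G.Adj d0 r0) (hd0R : ∀ y ∈ R, ¬ G.Adj d0 y)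
    (hK : ∀ v ∈ K, v ∈ H ∧ l v = m ∧ ¬ G.Adj d0 v ∧ ∀ y ∈ r0 :: R, v ≠ y ∧ ¬ G.Adj v y)
    (hKd : ∀ v ∈ K, ∃ u ∈ H, l u + 1 = m ∧ G.Adj u v ∧ ∃ y ∈ r0 :: R, G.Adj u y) :
    G.ColOn 147 K := by
  set r : ℕ → V := fun i => (r0 :: R).getD i r0 with hrdef
  have hget : ∀ i (hi : i < (r0 :: R).length), r i = (r0 :: R)[i] := fun i hi =>
    List.getD_eq_getElem _ _ hi
  have hlt : ∀ i, i ≤ R.length → i < (r0 :: R).length := fun i hi => by simp; omega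
  have hmem : ∀ i ≤ R.length, r i ∈ r0 :: R := fun i hi => by
    rw [hget i (hlt i hi)]; exact List.getElem_mem _
  refine hl.colOn_of_path hG htri hm (r := r) (M := R.length) ?_ (fun i hi => hrm _ (hmem i hi)) hd0
    ?_ (fun v hv => ?_) fun v hv => ?_
  · intro i j hij hj
    rw [hget i (hlt i (by omega)), hget j (hlt j hj)]
    exact hr.getElem hij (hlt j hj)
  · rintro (_ | i) hi
    · simpa [hrdef] using hd0r
    · simp only [Nat.add_eq_zero_iff, one_ne_zero, and_false, iff_false]
      apply hd0R
      rw [hget _ (hlt _ hi)]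
      simp
  · obtain ⟨h1, h2, h3, h4⟩ := hK v hv
    exact ⟨h1, h2, h3, fun i hi => h4 _ (hmem i hi)⟩
  · obtain ⟨u, h1, h2, h3, y, hy, huy⟩ := hKd v hv
    obtain ⟨i, hi, rfl⟩ := List.getElem_of_mem hy
    refine ⟨u, h1, h2, h3, i, by simp at hi; omega, ?_⟩
    rwa [hget i hi]

/-- A connected set of many colours has a level of many colours. -/
theorem ConnSet.exists_level (htri : G.CliqueFree 3) {C : Set V} (hC : G.ConnSet C) {k : ℕ}
    (hk : 1 ≤ k) (hbig : ¬ G.ColOn (2 * k) C) : ∃ z l i, G.IsLevelling C z l ∧ 2 ≤ i ∧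
      ¬ G.ColOn k {v | v ∈ C ∧ l v = i} := by
  obtain ⟨z, hz⟩ := exists_mem_of_not_colOn hbig
  obtain ⟨l, hl⟩ := hC.exists_isLevelling hz
  by_contra hno
  push Not at hno
  refine hbig (ColOn.of_levels l hl.le_succ fun i => ?_)
  rcases Nat.lt_or_ge i 2 with hi | hi
  · have hi' : i = 0 ∨ i = 1 := by omega
    rcases hi' with rfl | rfl
    · refine (colOn_one (stable_singleton (G := G) z)).mono hk ?_
      rintro v ⟨hv, hlv⟩
      exact (hl.eq_zero_iff v hv).1 hlv
    · refine (colOn_nbrs_singleton htri z).mono hk ?_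
      rintro v ⟨hv, hlv⟩
      obtain ⟨u, hu, huv, hlu⟩ := hl.exists_parent v hv (by omega)
      rw [(hl.eq_zero_iff u hu).1 (by omega)] at huv
      exact mem_nbrs_singleton.2 huv
  · exact hno z l i hl hi

end SimpleGraph

/-! ### Assembly of the forbidden wheel -/

open SimpleGraph in
theorem theorem3p2 {V : Type*} [Finite V] (G : SimpleGraph V)
    (hG : G.IsTPerfect) (htri : G.CliqueFree 3) : G.Colorable 199052 := by
  by_contra hcol
  obtain ⟨C₀, -, hC₀, hbig₀, -⟩ :=
    exists_component_of_not_colOn (G := G) (fun h : G.ColOn 199052 Set.univ => hcol h.colorable)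
  -- Passing to a level halves the number of colours. The outer levelling will supply the hub, the
  -- inner one the closure of the rope.
  obtain ⟨z, l, i, hl, hi, hbig₁⟩ := hC₀.exists_level htri (k := 99526) (by norm_num) hbig₀
  obtain ⟨C₁, hC₁l, hC₁, hbig₁, -⟩ := exists_component_of_not_colOn hbig₁
  obtain ⟨z', l', m, hl', hm, hbig₂⟩ := hC₁.exists_level htri (k := 49763) (by norm_num) hbig₁
  obtain ⟨C₂, hC₂l, hC₂, hbig₂, -⟩ := exists_component_of_not_colOn hbig₂
  obtain ⟨v, hv⟩ := exists_mem_of_not_colOn hbig₂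
  obtain ⟨d0, hd0, hd0v, hld0⟩ := hl'.exists_parent v (hC₂l hv).1 (by rw [(hC₂l hv).2]; omega)
  rw [(hC₂l hv).2] at hld0
  -- For one colour all neighbours of `d0` are deleted; one of them, attached to what remains,
  -- becomes the start `r0`. Hence `d0` sees nothing of the rope except `r0`.
  obtain ⟨C₃, hC₃2, hC₃, hbig₃, r0, hr0, hd0r, hr0C⟩ := hC₂.exists_component_diff (k := 49762)
    hbig₂ (colOn_nbrs_singleton htri d0) hv (mem_nbrs_singleton.2 hd0v)
  rw [mem_nbrs_singleton] at hd0r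
  have hpar : ∀ x, ∃ p g, (x ∈ C₀ ∧ l x = i) → (p ∈ C₀ ∧ G.Adj p x ∧ l p + 1 = i) ∧
      (g ∈ C₀ ∧ G.Adj g p ∧ l g + 2 = i) := by
    intro x
    by_cases hx : x ∈ C₀ ∧ l x = i
    · obtain ⟨p, hp, hpx, hlp⟩ := hl.exists_parent x hx.1 (by omega)
      obtain ⟨g, hg, hgp, hlg⟩ := hl.exists_parent p hp (by omega)
      exact ⟨p, g, fun _ => ⟨⟨hp, hpx, by omega⟩, hg, hgp, by omega⟩⟩
    · exact ⟨x, x, fun h => absurd h hx⟩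
  choose p g hpg using hpar
  -- Deleting these sets keeps later joints clear of the parent and grandparent of an earlier one;
  -- the cost is 2 + 7 + 2 colours.
  have hZ : ∀ x, G.ColOn 11 (G.nbrs (G.nbrs {g x}) ∪ G.nbrs (G.nbrs (G.nbrs {p x})) ∪
      G.nbrs (G.nbrs {p x})) := fun x => ((colOn_nbrs_nbrs hG htri _).union
    (colOn_nbrs_nbrs_nbrs hG htri _)).union (colOn_nbrs_nbrs hG htri _)
  have hr0C₃ : r0 ∉ C₃ := fun h => (hC₃2 h).2 (mem_nbrs_singleton.2 hd0r)
  -- The remaining 294 is 2 * 147, one application of the comb bound for each of two routes. The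
  -- cost of the rope is then 20139, well below the available 49762.
  obtain ⟨x, K, s, hx0, hKC, hK, hKbig, hx6, hx6K, hxC, -, hxZ, hs, hpath⟩ :=
    exists_rope hG htri hZ (k := 294) 6 C₃ r0 hC₃ hr0C₃ hr0C
      (fun h => hbig₃ (h.mono (by norm_num [ropeCost]) subset_rfl))
  have hC₂' : ∀ y ∈ C₂, y ∈ C₁ ∧ l' y = m := fun y hy => hC₂l hy
  have hC₁' : ∀ y ∈ C₁, y ∈ C₀ ∧ l y = i := fun y hy => hC₁l hy
  have hC₃' : ∀ y ∈ C₃, y ∈ C₁ ∧ l' y = m := fun y hy => hC₂' y (hC₃2 hy).1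
  have hd0C : ∀ y ∈ C₃, ¬ G.Adj d0 y := fun y hy h => (hC₃2 hy).2 (mem_nbrs_singleton.2 h)
  -- the routes of the rope
  have hroute : ∀ q : ℕ → ℕ, ∃ R, (List.range 6).flatMap (fun i => s i (q i)) = r0 :: R ∧
      G.IsIndPath (r0 :: R ++ [x 6]) ∧ (∀ y ∈ r0 :: R, (∃ i < 6, y ∈ s i (q i)) ∧
        y ∈ C₁ ∧ l' y = m ∧ y ∉ K ∧ ∀ t ∈ K, ¬ G.Adj y t) ∧ ∀ y ∈ R, ¬ G.Adj d0 y := by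
    intro q
    obtain ⟨E, hE⟩ := (hs 0 (by omega) (q 0)).1
    obtain ⟨R, hR⟩ : ∃ R, (List.range 6).flatMap (fun i => s i (q i)) = r0 :: R := by
      rw [List.range_succ_eq_map, List.flatMap_cons, hE, hx0]
      exact ⟨_, rfl⟩
    have hq := hpath q
    rw [hR] at hq
    have hmem : ∀ y ∈ r0 :: R, ∃ i < 6, y ∈ s i (q i) := by
      intro y hy
      rw [← hR, List.mem_flatMap] at hy
      obtain ⟨i, hi, hy⟩ := hy
      exact ⟨i, List.mem_range.1 hi, hy⟩
    refine ⟨R, hR, hq, fun y hy => ?_, fun y hy hdy => ?_⟩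
    · obtain ⟨i, hi, hyi⟩ := hmem y hy
      obtain ⟨h1, h2, h3⟩ := (hs i hi (q i)).2.2 y hyi
      have : y ∈ C₁ ∧ l' y = m := by
        rcases h1 with rfl | h1
        exacts [hC₂' _ hr0, hC₃' y h1]
      exact ⟨⟨i, hi, hyi⟩, this.1, this.2, h2, h3⟩
    · obtain ⟨i, hi, hyi⟩ := hmem y (List.mem_cons_of_mem _ hy)
      rcases ((hs i hi (q i)).2.2 y hyi).1 with rfl | h1
      · exact (List.nodup_cons.1 hq.left.nodup).1 hy
      · exact hd0C y h1 hdy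
  -- a vertex of `K` whose parents do not see the routes
  have hdense : ∀ j : ℕ, G.ColOn 147 {e | e ∈ K ∧ ∃ u ∈ C₁, l' u + 1 = m ∧ G.Adj u e ∧
      ∃ i < 6, ∃ y ∈ s i j, G.Adj u y} := by
    intro j
    obtain ⟨R, hR, hRp, hRm, hRd⟩ := hroute fun _ => j
    refine hl'.colOn_of_isIndPath hG htri hm hRp.left (fun y hy => ⟨(hRm y hy).2.1, (hRm y hy).2.2.1⟩)
      ⟨hd0, hld0⟩ hd0r hRd ?_ ?_
    · rintro e ⟨he, -⟩
      refine ⟨(hC₃' e (hKC he)).1, (hC₃' e (hKC he)).2, hd0C e (hKC he), fun y hy => ⟨?_, ?_⟩⟩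
      · rintro rfl; exact (hRm _ hy).2.2.2.1 he
      · exact fun h => (hRm y hy).2.2.2.2 e he h.symm
    · rintro e ⟨he, u, hu, hlu, hue, i, hi, y, hy, huy⟩
      refine ⟨u, hu, hlu, hue, y, ?_, huy⟩
      rw [← hR, List.mem_flatMap]
      exact ⟨i, List.mem_range.2 hi, hy⟩
  obtain ⟨e, heK, he⟩ : ∃ e ∈ K, ∀ j < 2, ∀ u ∈ C₁, l' u + 1 = m → G.Adj u e →
      ∀ i < 6, ∀ y ∈ s i j, ¬ G.Adj u y := by
    by_contra hno
    push Not at hno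
    refine hKbig (((hdense 0).union (hdense 1)).subset fun e he => ?_)
    obtain ⟨j, hj, u, hu, hlu, hue, h⟩ := hno e he
    obtain rfl | rfl : j = 0 ∨ j = 1 := by omega
    · exact Or.inl ⟨he, u, hu, hlu, hue, h⟩
    · exact Or.inr ⟨he, u, hu, hlu, hue, h⟩
  have heC := hC₃' e (hKC heK)
  obtain ⟨d, hd, hde, hld⟩ := hl'.exists_parent e heC.1 (by omega)
  have hxC' : ∀ j, 1 ≤ j → j ≤ 6 → x j ∈ C₃ := by
    rintro (_ | j) hj hj'
    · omega
    · exact hxC j (by omega)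
  have hx6C := hxC' 6 (by omega) le_rfl
  obtain ⟨T, hT, hTC, hTc⟩ := hl'.exists_closing hK (fun v hv => hC₃' v (hKC hv)) hx6 hx6K
    (hC₃' _ hx6C) ⟨hd0, hld0⟩ ⟨hd, by omega⟩ (fun h => hd0C e (hKC heK) (h ▸ hde)) heK hde (by
      rintro v (rfl | hv)
      exacts [hd0C _ hx6C, hd0C v (hKC hv)])
  -- Requests are reduced modulo 2 since the parent `d` is only known to miss the segments for
  -- requests 0 and 1.
  have hcycle : ∀ q : ℕ → ℕ, G.IsIndCycle ((List.range 6).flatMap (fun i => s i (q i % 2)) ++ T) ∧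
      ∀ y ∈ (List.range 6).flatMap (fun i => s i (q i % 2)) ++ T, y ∈ C₁ := by
    intro q
    obtain ⟨R, hR, hRp, hRm, hRd⟩ := hroute fun i => q i % 2
    rw [hR]
    refine ⟨hTc r0 R hRp (fun y hy => ?_) hd0r hRd, fun y hy => ?_⟩
    · obtain ⟨⟨i, hi, hyi⟩, h1, h2, h3, h4⟩ := hRm y hy
      exact ⟨h1, h2, h3, h4, he _ (Nat.mod_lt _ two_pos) d hd (by omega) hde i hi y hyi⟩
    · rcases List.mem_append.1 hy with hy | hy
      exacts [(hRm y hy).2.1, hTC y hy]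
  -- The joints are `x 1, …, x 6`, which all lie in `C₃`; the start `x 0 = r0` is not among them.
  have hx : ∀ j : Fin 6, x (j + 1) ∈ C₀ ∧ l (x (j + 1)) = i := fun j =>
    hC₁' _ (hC₃' _ (hxC' _ (by omega) (by omega))).1
  have hxZ' : ∀ j k : Fin 6, j < k → _ := fun j k hjk =>
    hxZ (k + 1) (by omega) (j + 1) (by have := Fin.lt_def.1 hjk; omega)
  simp only [Set.mem_union, not_or] at hxZ'
  obtain ⟨Up, Um, hU, hUp, hUm, a, b, c, hab, hbc, ha, hb, hc⟩ := hl.exists_isHub htri (i := i)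
    (x := fun j => x (j + 1)) (p := fun j => p (x (j + 1))) (g := fun j => g (x (j + 1)))
    (fun j => (hpg _ (hx j)).1) (fun j => (hpg _ (hx j)).2) (fun j k hjk => (hxZ' j k hjk).2)
    (fun j k hjk => (hxZ' j k hjk).1.1) (fun j k hjk => (hxZ' j k hjk).1.2)
  refine hG.rope_false hU (s := fun i q => s i (q % 2)) (n := 6) (x := x)
    (fun i hi q => ⟨(hs i hi _).1, ?_⟩) hT (fun q => (hcycle q).1) (fun q y hy => ?_)
    (Nat.succ_pos a) (Nat.succ_lt_succ (Fin.lt_def.1 hab)) (Nat.succ_lt_succ (Fin.lt_def.1 hbc))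
    (by omega) ha hb hc
  · have := (hs i hi (q % 2)).2.1
    simpa using this
  · obtain ⟨hy₀, hly⟩ := hC₁' y ((hcycle q).2 y hy)
    refine ⟨fun h => ?_, fun h => ?_, ?_⟩
    · have := (hUp y h).2; omega
    · have := (hUm y h).2; omega
    · rintro ⟨u, hu, huy⟩
      have h1 := hUm u hu
      have := hl.le_succ y hy₀ u h1.1 huy.symm
      omega
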